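/- Let $\mathbf F_q$ be a finite field of characteristic $p$, let $V/\mathbf F_q$ be a smooth, geometrically irreducible, projective variety of dimension $m$, and let $\mathcal L$ be an ample line bundle on $V$. For each integer $k\ge 1$ let $P_k$ be the (finite) set of tuples $\mathbf a=(a_1,a_2,a_3,a_4,a_6)$ with $a_i\in H^0(V,\mathcal L^{ik})$ such that $a_2=0$ if $p=2$; $a_1=a_3=0$ if $p=3$; and $a_1=a_2=a_3=0$ if $p>3$. For $\mathbf a\in P_k$ let \[ W_{\mathbf a}=\{\,Y^2Z+a_1XYZ+a_3YZ^2=X^3+a_2X^2Z+a_4XZ^2+a_6Z^3\,\}\subset \mathbf P(\mathcal O\oplus\mathcal L^{-2k}\oplus\mathcal L^{-3k}), \] where $Z$, $X$, $Y$ are the sections of $\mathcal O(1)$, $\mathcal O(1)\otimes\mathcal L^{2k}$, $\mathcal O(1)\otimes\mathcal L^{3k}$ given by the three summands, and let $\pi_{\mathbf a}:W_{\mathbf a}\to V$ be the projection. For a subset $S$ of the disjoint union $\bigcup_{i\ge1}P_i$ put \[ \mu(S)=\lim_{k\to\infty}\frac{\#\bigl(S\cap\bigcup_{i=1}^kP_i\bigr)}{\#\bigcup_{i=1}^kP_i}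 \] whenever the limit exists. For an integer $r\ge 0$ let $V_{<r}$ be the set of closed points $P$ of $V$ of degree $\deg P=[\kappa(P):\mathbf F_q]<r$, and let \[ \mathcal P_r=\Bigl\{\mathbf a\in\bigcup_{i\ge1}P_i \;\Bigm|\; W_{\mathbf a}\text{ is smooth over }\mathbf F_q\text{ at all points of }\pi_{\mathbf a}^{-1}(P)\text{ for all }P\in V_{<r}\Bigr\}. \] Then $V_{<r}$ is finite, the density $\mu(\mathcal P_r)$ exists, and \[ \mu(\mathcal P_r)=\prod_{P\in V_{<r}}\bigl(1-q^{-(m+1)\deg P}\bigr). \] -/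

import Mathlib

open CategoryTheory AlgebraicGeometry TopologicalSpace

universe u

noncomputable section

section QuotientGrading

variable {R A : Type u} [CommRing R] [CommRing A] [Algebra R A] (𝒜 : ℕ → Submodule R A)

/-- The grading on `A ⧸ I` by the images of the graded pieces of `A`. -/
def quotientGrading (I : Ideal A) (i : ℕ) : Submodule R (A ⧸ I) :=
  (𝒜 i).map (Ideal.Quotient.mkₐ R I).toLinearMap

/-- The projection from a graded piece of `A` to that of `A ⧸ I`. -/
def quotientGradingMk (I : Ideal A) (i : ℕ) : 𝒜 i →ₗ[R] quotientGrading 𝒜 I i :=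
  (Ideal.Quotient.mkₐ R I).toLinearMap.restrict fun _ hx => Submodule.mem_map_of_mem hx

theorem quotientGrading_gradedMonoid [SetLike.GradedMonoid 𝒜] (I : Ideal A) :
    SetLike.GradedMonoid (quotientGrading 𝒜 I) where
  one_mem := ⟨1, SetLike.GradedOne.one_mem, rfl⟩
  mul_mem := by
    rintro i j _ _ ⟨x, hx, rfl⟩ ⟨y, hy, rfl⟩
    exact ⟨x * y, SetLike.GradedMul.mul_mem hx hy, rfl⟩

/-- The decomposition of `A ⧸ I` into graded pieces, for a homogeneous ideal `I`. -/
def quotientGradingDecompose [GradedAlgebra 𝒜] (I : Ideal A) (hI : I.IsHomogeneous 𝒜) :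
    (A ⧸ I) →+ DirectSum ℕ fun i => quotientGrading 𝒜 I i :=
  QuotientAddGroup.lift I.toAddSubgroup
    ((DirectSum.map fun i => (quotientGradingMk 𝒜 I i).toAddMonoidHom).comp
      (DirectSum.decomposeAddEquiv 𝒜).toAddMonoidHom) (by
    intro x hx
    refine DFinsupp.ext fun i => Subtype.ext ?_
    exact Ideal.Quotient.eq_zero_iff_mem.mpr (hI i hx))

theorem quotientGradingDecompose_mk [GradedAlgebra 𝒜] (I : Ideal A) (hI : I.IsHomogeneous 𝒜)
    {i : ℕ} (x : 𝒜 i) :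
    quotientGradingDecompose 𝒜 I hI (Ideal.Quotient.mk I (x : A)) =
      DirectSum.of (fun i => quotientGrading 𝒜 I i) i (quotientGradingMk 𝒜 I i x) := by
  change DirectSum.map _ (DirectSum.decompose 𝒜 (x : A)) = _
  rw [DirectSum.decompose_coe, DirectSum.map_of]
  rfl

/-- For a homogeneous ideal `I`, the quotient `A ⧸ I` is a graded algebra. -/
abbrev quotientGradedAlgebra [GradedAlgebra 𝒜] (I : Ideal A) (hI : I.IsHomogeneous 𝒜) :
    GradedAlgebra (quotientGrading 𝒜 I) where
  __ := quotientGrading_gradedMonoid 𝒜 I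
  __ := DirectSum.Decomposition.ofAddHom (ℳ := quotientGrading 𝒜 I)
    (quotientGradingDecompose 𝒜 I hI)
    (by
      ext y
      obtain ⟨y, rfl⟩ := Ideal.Quotient.mk_surjective y
      induction y using DirectSum.Decomposition.inductionOn 𝒜 with
      | zero => simp
      | homogeneous x =>
        simp only [AddMonoidHom.comp_apply, quotientGradingDecompose_mk,
          DirectSum.coeAddMonoidHom_of]
        rfl
      | add x y hx hy => rw [map_add, map_add, hx, hy, map_add])
    (by
      ext i ⟨y, x, hx, rfl⟩ : 2
      simp only [AddMonoidHom.comp_apply, DirectSum.coeAddMonoidHom_of]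
      exact quotientGradingDecompose_mk 𝒜 I hI ⟨x, hx⟩)

end QuotientGrading

/-! ### The Weierstrass cubic over a ring as a scheme -/

namespace WeierstrassScheme

variable {A : Type u} [CommRing A] (W : WeierstrassCurve A)

attribute [local instance] MvPolynomial.gradedAlgebra

/-- The ideal of `A[X, Y, Z]` generated by the form
`Y²Z + a₁XYZ + a₃YZ² - (X³ + a₂X²Z + a₄XZ² + a₆Z³)`. -/
def cubicIdeal : Ideal (MvPolynomial (Fin 3) A) :=
  Ideal.span {WeierstrassCurve.Projective.polynomial W}

theorem isHomogeneous_polynomial :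
    (WeierstrassCurve.Projective.polynomial W).IsHomogeneous 3 := by
  have X (i : Fin 3) := MvPolynomial.isHomogeneous_X A i
  have C (c : A) := MvPolynomial.isHomogeneous_C (Fin 3) c
  unfold WeierstrassCurve.Projective.polynomial
  refine .sub (.add (.add ?_ ?_) ?_) (.add (.add (.add ?_ ?_) ?_) ?_)
  · exact ((X 1).pow 2).mul (X 2)
  · exact (((C _).mul (X 0)).mul (X 1)).mul (X 2)
  · exact ((C _).mul (X 1)).mul ((X 2).pow 2)
  · exact (X 0).pow 3
  · exact ((C _).mul ((X 0).pow 2)).mul (X 2)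
  · exact ((C _).mul (X 0)).mul ((X 2).pow 2)
  · exact (C _).mul ((X 2).pow 3)

theorem isHomogeneous_cubicIdeal :
    (cubicIdeal W).IsHomogeneous (MvPolynomial.homogeneousSubmodule (Fin 3) A) :=
  Ideal.homogeneous_span _ _ (by
    rintro _ rfl
    exact ⟨3, isHomogeneous_polynomial W⟩)

/-- The grading by degree on `A[X, Y, Z] ⧸ (cubic form)`. -/
abbrev grading (i : ℕ) : Submodule A (MvPolynomial (Fin 3) A ⧸ cubicIdeal W) :=
  quotientGrading (MvPolynomial.homogeneousSubmodule (Fin 3) A) (cubicIdeal W) i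

instance gradedAlgebra : GradedAlgebra (grading W) :=
  quotientGradedAlgebra _ _ (isHomogeneous_cubicIdeal W)

/-- The hypersurface in `ℙ²` over `A` defined by the homogeneous Weierstrass equation,
`Proj (A[X, Y, Z] ⧸ (cubic form))`. -/
def hypersurface : Scheme.{u} := Proj (grading W)

/-- The structure morphism of the hypersurface. -/
def toSpec : hypersurface W ⟶ Spec (.of A) :=
  Proj.toSpecZero (grading W) ≫ Spec.map (CommRingCat.ofHom (algebraMap A (grading W 0)))

end WeierstrassScheme

/-! ### Line bundles, sections of their powers, ampleness -/

variable {V : Scheme.{u}}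

/-- `e ∈ Γ(U, L)` is a frame of `L` on `U`: `r ↦ r • e` is an isomorphism `𝒪_U ≅ L|_U`. -/
def IsFrame (L : V.Modules) {U : V.Opens} (e : Γ(L, U)) : Prop :=
  ∀ (U' : V.Opens) (h : U' ≤ U),
    Function.Bijective fun r : Γ(V, U') => r • L.presheaf.map (homOfLE h).op e

/-- `L` is a line bundle: locally isomorphic to `𝒪`. -/
def IsLineBundle (L : V.Modules) : Prop :=
  ∀ x : V, ∃ (U : V.Opens) (e : Γ(L, U)), x ∈ U ∧ IsFrame L e

/-- A global section `s` of the tensor power `L^{⊗ n}` of a line bundle, given through its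
coordinates: for each frame `e` of `L` on an open `U`, the function `f = coord e` on `U` with
`s = f • e^{⊗ n}`. Coordinates are compatible with restriction, and
`e' = u • e` gives `f • e^{⊗ n} = f' • e'^{⊗ n} = (u ^ n * f') • e^{⊗ n}`. -/
@[ext]
structure PowSection (L : V.Modules) (n : ℕ) where
  coord : ∀ {U : V.Opens} (e : Γ(L, U)), IsFrame L e → Γ(V, U)
  map_coord : ∀ {U U' : V.Opens} (h : U' ≤ U) (e : Γ(L, U)) (he : IsFrame L e)
    (he' : IsFrame L (L.presheaf.map (homOfLE h).op e)),
    coord (L.presheaf.map (homOfLE h).op e) he' = V.presheaf.map (homOfLE h).op (coord e he)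
  coord_smul : ∀ {U : V.Opens} (e : Γ(L, U)) (he : IsFrame L e) (u : Γ(V, U))
    (he' : IsFrame L (u • e)), coord e he = u ^ n * coord (u • e) he'

namespace PowSection

variable {L : V.Modules} {n : ℕ}

instance : Zero (PowSection L n) where
  zero :=
    { coord := fun _ _ => 0
      map_coord := fun _ _ _ _ => (map_zero _).symm
      coord_smul := fun _ _ _ _ => (mul_zero _).symm }

/-- The open set `V_s` of points at which the section `s` does not vanish. -/
def nonvanishing (s : PowSection L n) : V.Opens :=
  ⨆ (U : V.Opens) (e : Γ(L, U)) (he : IsFrame L e), V.basicOpen (s.coord e he)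

end PowSection

/-- `L` is ample (on a quasi-compact scheme): every point lies in an affine open set `V_s` with
`s` a section of some power `L^{⊗ n}`, `n ≥ 1`. -/
def IsAmple (L : V.Modules) : Prop :=
  ∀ x : V, ∃ (n : ℕ) (s : PowSection L n),
    1 ≤ n ∧ x ∈ s.nonvanishing ∧ IsAffineOpen s.nonvanishing

/-! ### Weierstrass equations with coefficients in powers of `L` -/

/-- Tuples `(a₁, a₂, a₃, a₄, a₆)` with `aᵢ ∈ H⁰(V, L^{⊗ ik})`. -/
@[ext]
structure WeierstrassTuple (L : V.Modules) (k : ℕ) where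
  a₁ : PowSection L k
  a₂ : PowSection L (2 * k)
  a₃ : PowSection L (3 * k)
  a₄ : PowSection L (4 * k)
  a₆ : PowSection L (6 * k)

namespace WeierstrassTuple

variable {L : V.Modules} {k : ℕ}

/-- The normal form in characteristic `p`. -/
def IsNormal (p : ℕ) (a : WeierstrassTuple L k) : Prop :=
  (p = 2 → a.a₂ = 0) ∧ (p = 3 → a.a₁ = 0 ∧ a.a₃ = 0) ∧
    (3 < p → a.a₁ = 0 ∧ a.a₂ = 0 ∧ a.a₃ = 0)

/-- The Weierstrass equation in the trivialisation given by a frame `e` of `L` on `U`. -/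
def curve (a : WeierstrassTuple L k) {U : V.Opens} (e : Γ(L, U)) (he : IsFrame L e) :
    WeierstrassCurve Γ(V, U) where
  a₁ := a.a₁.coord e he
  a₂ := a.a₂.coord e he
  a₃ := a.a₃.coord e he
  a₄ := a.a₄.coord e he
  a₆ := a.a₆.coord e he

/-- A frame `e` of `L` on an affine open `U` identifies the restriction to `U` of the bundle
`ℙ(𝒪 ⊕ L^{-2k} ⊕ L^{-3k})` with `ℙ²_U`, the homogeneous coordinates being `Z`, `X e^{-2k}` and
`Y e^{-3k}`. Under it, the part of the hypersurface `W_a` over `U` is this scheme. -/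
def chart (a : WeierstrassTuple L k) {U : V.Opens} (e : Γ(L, U)) (he : IsFrame L e) :
    Scheme.{u} :=
  WeierstrassScheme.hypersurface (a.curve e he)

/-- The projection `π_a` to `V` on the part of `W_a` over `U`. -/
def chartπ (a : WeierstrassTuple L k) {U : V.Opens} (hU : IsAffineOpen U) (e : Γ(L, U))
    (he : IsFrame L e) : a.chart e he ⟶ V :=
  WeierstrassScheme.toSpec (a.curve e he) ≫ hU.fromSpec

end WeierstrassTuple

/-- A morphism is smooth at a point if it is smooth on an open neighbourhood of the point. -/
def IsSmoothAt {X S : Scheme.{u}} (f : X ⟶ S) (x : X) : Prop :=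
  ∃ U : X.Opens, x ∈ U ∧ Smooth (U.ι ≫ f)

/-- `W_a` is smooth (over the base `S`) at all points of `π_a⁻¹(P)`. Smoothness at a point is
local, so this is expressed on the parts of `W_a` over trivialising affine opens. -/
def WeierstrassTuple.IsSmoothAbove {L : V.Modules} {k : ℕ} {S : Scheme.{u}} (f : V ⟶ S)
    (a : WeierstrassTuple L k) (P : V) : Prop :=
  ∀ (U : V.Opens) (hU : IsAffineOpen U) (e : Γ(L, U)) (he : IsFrame L e) (w : a.chart e he),
    a.chartπ hU e he w = P → IsSmoothAt (a.chartπ hU e he ≫ f) w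

/-- The closed points of `V` of degree `< r` over the base field. -/
def closedPointsLT {K : Type u} [Field K] (f : V ⟶ Spec (.of K)) (r : ℕ) : Set V :=
  {P | IsClosed {P} ∧ f.residueDegree P < r}

/-- `⋃_{1 ≤ k ≤ N} P_k`, where `P_k` is the set of coefficient tuples in normal form; the sets
`P_k` are regarded as disjoint. -/
def normalTuples (L : V.Modules) (p N : ℕ) : Set (Σ k : ℕ, WeierstrassTuple L k) :=
  {a | 1 ≤ a.1 ∧ a.1 ≤ N ∧ a.2.IsNormal p}

/-- The set `T` of tuples has density `μ(T) = d`. -/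
def HasDensity (L : V.Modules) (p : ℕ) (T : Set (Σ k : ℕ, WeierstrassTuple L k)) (d : ℝ) :
    Prop :=
  Filter.Tendsto
    (fun N : ℕ => ((T ∩ normalTuples L p N).ncard : ℝ) / ((normalTuples L p N).ncard : ℝ))
    Filter.atTop (nhds d)

/-- The set `𝒫_r` of tuples in normal form for which `W_a` is smooth above every closed point of
degree `< r`. -/
def smoothTuples {K : Type u} [Field K] (f : V ⟶ Spec (.of K)) (L : V.Modules) (r : ℕ) :
    Set (Σ k : ℕ, WeierstrassTuple L k) :=
  {a | 1 ≤ a.1 ∧ a.2.IsNormal (ringChar K) ∧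
    ∀ P ∈ closedPointsLT f r, a.2.IsSmoothAbove f P}

end

/-! Write `R_P = 𝒪_P/𝔪_P²` for the truncated local ring of `V` at a closed point `P`. The theorem is
an equidistribution statement: smoothness above `P` depends only on the coefficients of the
Weierstrass equation in `R_P`, the proportion of bad equations over `R_P` is `1/#R_P`, and by
ampleness the coefficients of high degree are equidistributed in the product of the `R_P` over
finitely many points.

Local criterion. A hypersurface `g = 0` in a smooth variety is smooth at a point exactly when some
tangent vector, that is, some map to the dual numbers, does not kill `g`
(`isSmoothAt_iff_exists_dualNumber`). The points at infinity are always smooth. At an affine point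
where a fibre partial derivative is nonzero, a vertical tangent vector does the job. Otherwise the
point is singular in its fibre; the normal form makes it unique and rational over the perfect
residue field, so it lifts to a pair `(x, y)` over `𝒪_P`, and non-smoothness means that the value of
the equation at `(x, y)` lies in `𝔪_P²`. This is `IsSingularModSq`; the equivalence is
`forall_isSmoothAt_toSpec_iff`.

Local count. Over `R = R_P`, Taylor expansion shows that the value of the equation at a lift of the
singular point does not depend on the lift. A singular equation is therefore given by the residue
classes of the singular coordinates, the derivatives in the maximal ideal and the coefficients left
free; `a₆` is then forced. This gives `1/#R` of all normal forms (`card_singular_mul_card`). Since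
`𝔪_P/𝔪_P²` has dimension `m` over the residue field, `#R_P = q^((m+1) deg P)`.

Globalisation. Sections of powers of `L` become rational functions with prescribed poles
(`exists_isEncoding`). Ampleness gives, for all large `n`, sections of `L^n` with arbitrary images
in the rings `R_P` (`IsAmpleCocycle.exists_section`). Thus the reduction of normal tuples is a group
homomorphism onto all tuples of local normal forms, its fibres have equal size, and the proportion
of good tuples in `P_k` is exactly the product once `k` is large (`IsEncoding.card_smooth`). The
finitely many small `k` do not affect the limit.

Finiteness of `H⁰(V, L^n)` is proved by valuations: a global section is integral over a polynomial
ring, and properness bounds it at every valuation ring containing the base field. The coefficients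
of its minimal polynomial thus have bounded degree, which leaves finitely many over a finite field.
-/

noncomputable section

/-! ### Singular points of Weierstrass equations -/

namespace WeierstrassCurve

section CommRing

variable {R S : Type*} [CommRing R] [CommRing S]

/-- The value at `(x, y)` of the affine Weierstrass equation. -/
def affineForm (W : WeierstrassCurve R) (x y : R) : R :=
  y ^ 2 + W.a₁ * x * y + W.a₃ * y - (x ^ 3 + W.a₂ * x ^ 2 + W.a₄ * x + W.a₆)

/-- The partial derivative in the first variable of the affine Weierstrass equation. -/
def affineFormX (W : WeierstrassCurve R) (x y : R) : R :=
  W.a₁ * y - (3 * x ^ 2 + 2 * W.a₂ * x + W.a₄)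

/-- The partial derivative in the second variable of the affine Weierstrass equation. -/
def affineFormY (W : WeierstrassCurve R) (x y : R) : R :=
  2 * y + W.a₁ * x + W.a₃

@[simp] theorem affineForm_map (W : WeierstrassCurve R) (φ : R →+* S) (x y : R) :
    (W.map φ).affineForm (φ x) (φ y) = φ (W.affineForm x y) := by
  simp [affineForm]

@[simp] theorem affineFormX_map (W : WeierstrassCurve R) (φ : R →+* S) (x y : R) :
    (W.map φ).affineFormX (φ x) (φ y) = φ (W.affineFormX x y) := by
  simp [affineFormX, map_ofNat]

@[simp] theorem affineFormY_map (W : WeierstrassCurve R) (φ : R →+* S) (x y : R) :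
    (W.map φ).affineFormY (φ x) (φ y) = φ (W.affineFormY x y) := by
  simp [affineFormY, map_ofNat]

theorem affineForm_add (W : WeierstrassCurve R) (x y s t : R) :
    W.affineForm (x + s) (y + t) = W.affineForm x y + W.affineFormX x y * s +
      W.affineFormY x y * t + (t ^ 2 + W.a₁ * s * t - (3 * x + s + W.a₂) * s ^ 2) := by
  simp only [affineForm, affineFormX, affineFormY]
  ring

theorem affineFormX_add (W : WeierstrassCurve R) (x y s t : R) :
    W.affineFormX (x + s) (y + t) = W.affineFormX x y +
      (W.a₁ * t - (6 * x + 3 * s + 2 * W.a₂) * s) := by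
  simp only [affineFormX]
  ring

theorem affineFormY_add (W : WeierstrassCurve R) (x y s t : R) :
    W.affineFormY (x + s) (y + t) = W.affineFormY x y + (2 * t + W.a₁ * s) := by
  simp only [affineFormY]
  ring

/-- The normal form of a Weierstrass equation in characteristic `p`. -/
def IsNormalForm (p : ℕ) (W : WeierstrassCurve R) : Prop :=
  (p = 2 → W.a₂ = 0) ∧ (p = 3 → W.a₁ = 0 ∧ W.a₃ = 0) ∧
    (3 < p → W.a₁ = 0 ∧ W.a₂ = 0 ∧ W.a₃ = 0)

theorem IsNormalForm.map {p : ℕ} {W : WeierstrassCurve R} (h : W.IsNormalForm p) (φ : R →+* S) :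
    (W.map φ).IsNormalForm p := by
  refine ⟨fun hp => ?_, fun hp => ?_, fun hp => ?_⟩
  · simp [h.1 hp]
  · simp [h.2.1 hp]
  · simp [h.2.2 hp]

end CommRing

section Field

theorem prime_cases {p : ℕ} (hp : p.Prime) : p = 2 ∨ p = 3 ∨ 3 < p := by
  have := hp.two_le
  omega

variable {k : Type*} [Field k] {p : ℕ} [hp : Fact p.Prime] [CharP k p]

/-- A Weierstrass cubic in normal form has at most one singular point. -/
theorem singular_point_unique {W : WeierstrassCurve k} (hW : W.IsNormalForm p) {x y x' y' : k}
    (h : W.affineForm x y = 0) (hx : W.affineFormX x y = 0) (hy : W.affineFormY x y = 0)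
    (h' : W.affineForm x' y' = 0) (hx' : W.affineFormX x' y' = 0)
    (hy' : W.affineFormY x' y' = 0) : x = x' ∧ y = y' := by
  have hpk : (p : k) = 0 := CharP.cast_eq_zero k p
  -- For `p ≠ 2` both points have `y = 0`, and a cubic in `x` with double roots at `x` and `x'`
  -- forces `(x' - x)³ = 0`.
  have key : (x' - x) ^ 3 = 0 ∨ p = 2 := by
    rcases prime_cases hp.out with rfl | hp'
    · exact Or.inr rfl
    · left
      have h2 : (2 : k) ≠ 0 := by
        have : ¬ p ∣ 2 := fun hd => by have := Nat.le_of_dvd two_pos hd; omega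
        exact_mod_cast (CharP.cast_eq_zero_iff k p 2).not.mpr this
      obtain ⟨h1, h3⟩ : W.a₁ = 0 ∧ W.a₃ = 0 := by
        rcases hp' with h | h
        · exact hW.2.1 h
        · exact ⟨(hW.2.2 h).1, (hW.2.2 h).2.2⟩
      have e1 : y = 0 := by
        simpa [affineFormY, h1, h3, h2] using hy
      have e2 : y' = 0 := by
        simpa [affineFormY, h1, h3, h2] using hy'
      subst e1 e2
      simp only [affineForm, affineFormX, h1, h3] at *
      linear_combination -(x' - x) * hx' - (x' - x) * hx + 2 * h' - 2 * h
  rcases key with key | rfl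
  · have e : x' = x := by
      have := pow_eq_zero_iff (n := 3) (by norm_num) |>.mp key
      linear_combination this
    refine ⟨e.symm, ?_⟩
    subst e
    have : (y - y') ^ 2 = 0 := by
      simp only [affineForm, affineFormX, affineFormY] at *
      linear_combination h - h' - (y - y') * hy'
    have := pow_eq_zero_iff (n := 2) (by norm_num) |>.mp this
    linear_combination this
  · have h2 : (2 : k) = 0 := by exact_mod_cast hpk
    have ha2 := hW.1 rfl
    -- In characteristic 2 the `y`-derivative is `a₁x + a₃`. It determines `x` unless `a₁ = 0`, and
    -- then the `x`-derivative determines `x²`.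
    have e1 : W.a₁ * (x - x') = 0 := by
      simp only [affineFormY] at *
      linear_combination hy - hy' - (y - y') * h2
    have e : x = x' := by
      rcases mul_eq_zero.mp e1 with h1 | h1
      · have : (x - x') ^ 2 = 0 := by
          simp only [affineFormX, h1, ha2] at *
          linear_combination hx' - hx + (-x ^ 2 + 2 * x' ^ 2 - x * x') * h2
        have := pow_eq_zero_iff (n := 2) (by norm_num) |>.mp this
        linear_combination this
      · linear_combination h1
    refine ⟨e, ?_⟩
    subst e
    have : (y - y') ^ 2 = 0 := by
      simp only [affineForm, affineFormX, affineFormY] at *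
      linear_combination h - h' - (y - y') * hy'
    have := pow_eq_zero_iff (n := 2) (by norm_num) |>.mp this
    linear_combination this

/-- The `p`-th power has a `p`-th root in the perfect field, and `p`-th roots are unique in
characteristic `p`. -/
theorem mem_range_of_pow_mem_range {κ : Type*} [Field κ] [CharP κ p] [PerfectRing κ p]
    (φ : κ →+* k) {x : k} (h : x ^ p ∈ φ.range) : x ∈ φ.range := by
  obtain ⟨c, hc⟩ := h
  obtain ⟨d, rfl⟩ := (PerfectRing.bijective_frobenius (R := κ) (p := p)).2 c
  refine ⟨d, ?_⟩
  simp only [map_pow] at hc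
  exact frobenius_inj k p (by simpa [frobenius_def] using hc)

/-- A singular point of a Weierstrass cubic in normal form over a perfect field is rational. -/
theorem singular_point_mem_range {κ : Type*} [Field κ] [CharP κ p] [PerfectRing κ p]
    (φ : κ →+* k) {W : WeierstrassCurve κ} (hW : W.IsNormalForm p) {x y : k}
    (h : (W.map φ).affineForm x y = 0) (hx : (W.map φ).affineFormX x y = 0)
    (hy : (W.map φ).affineFormY x y = 0) : x ∈ φ.range ∧ y ∈ φ.range := by
  have hpk : (p : k) = 0 := CharP.cast_eq_zero k p
  have div {a b z : k} (ha : a ∈ φ.fieldRange) (hb : b ∈ φ.fieldRange) (ha0 : a ≠ 0)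
      (h : a * z = b) : z ∈ φ.range := by
    have : z = b / a := by field_simp; linear_combination h
    rw [this]
    exact (div_mem hb ha : _ ∈ φ.fieldRange)
  have num (n : ℕ) : (n : k) ∈ φ.fieldRange := natCast_mem _ n
  have c (a : κ) : φ a ∈ φ.fieldRange := ⟨a, rfl⟩
  simp only [affineForm, affineFormX, affineFormY, map_a₁, map_a₂, map_a₃, map_a₄, map_a₆] at *
  have key : p ≠ 2 → y = 0 := by
    intro hp2
    have hp' := (prime_cases hp.out).resolve_left hp2
    have h2 : (2 : k) ≠ 0 := by
      have : ¬ p ∣ 2 := fun hd => by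
        have := Nat.le_of_dvd two_pos hd
        have := hp.out.two_le
        omega
      exact_mod_cast (CharP.cast_eq_zero_iff k p 2).not.mpr this
    obtain ⟨h1, h3⟩ : W.a₁ = 0 ∧ W.a₃ = 0 := by
      rcases hp' with h | h
      · exact hW.2.1 h
      · exact ⟨(hW.2.2 h).1, (hW.2.2 h).2.2⟩
    simpa [h1, h3, h2] using hy
  rcases prime_cases hp.out with rfl | rfl | hp3
  · have h2 : (2 : k) = 0 := by exact_mod_cast hpk
    have ha2 := hW.1 rfl
    have hxr : x ∈ φ.range := by
      -- Either `x` is a square root of `a₄`, or `x = -a₃/a₁`. The coordinate `y` is found likewise,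
      -- as a square root or as a quotient by `a₁`.
      by_cases h1 : W.a₁ = 0
      · apply mem_range_of_pow_mem_range (p := 2) φ
        simp only [h1, ha2, map_zero] at hx
        exact ⟨W.a₄, by linear_combination - hx - 2 * x ^ 2 * h2⟩
      · exact div (c W.a₁) (neg_mem (c W.a₃)) (by simpa using h1)
          (by linear_combination hy - y * h2)
    refine ⟨hxr, ?_⟩
    obtain ⟨x, rfl⟩ := hxr
    by_cases h1 : W.a₁ = 0
    · apply mem_range_of_pow_mem_range (p := 2) φ
      have h3 : φ W.a₃ = 0 := by
        simp only [h1, map_zero] at hy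
        linear_combination hy - y * h2
      simp only [h1, ha2, h3, map_zero] at h
      exact ⟨x ^ 3 + W.a₄ * x + W.a₆, by simp; linear_combination - h⟩
    · exact div (c W.a₁) (c (3 * x ^ 2 + W.a₄)) (by simpa using h1)
        (by simp [ha2, map_ofNat] at hx ⊢; linear_combination hx)
  · have hy0 := key (by norm_num)
    subst hy0
    refine ⟨?_, zero_mem _⟩
    have h3 : (3 : k) = 0 := by exact_mod_cast hpk
    have h2 : (2 : k) ≠ 0 := fun h => one_ne_zero (α := k) (by linear_combination h3 - h)
    -- Either `x` is a cube root of `-a₆`, or `x = -a₄/(2a₂)`.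
    by_cases ha : W.a₂ = 0
    · apply mem_range_of_pow_mem_range (p := 3) φ
      simp only [ha, map_zero] at hx h
      exact ⟨-W.a₆, by simp; linear_combination h - x * hx - 3 * x ^ 3 * h3 + 2 * x ^ 3 * h3⟩
    · exact div (mul_mem (num 2) (c W.a₂)) (neg_mem (c W.a₄)) (by simpa [h2] using ha)
        (by push_cast; linear_combination -hx - x ^ 2 * h3)
  · have hy0 := key (by omega)
    subst hy0
    refine ⟨?_, zero_mem _⟩
    obtain ⟨h1, ha2, ha3⟩ := hW.2.2 hp3
    have h2 : (2 : k) ≠ 0 := by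
      have : ¬ p ∣ 2 := fun hd => by have := Nat.le_of_dvd two_pos hd; omega
      exact_mod_cast (CharP.cast_eq_zero_iff k p 2).not.mpr this
    have h3 : (3 : k) ≠ 0 := by
      have : ¬ p ∣ 3 := fun hd => by have := Nat.le_of_dvd three_pos hd; omega
      exact_mod_cast (CharP.cast_eq_zero_iff k p 3).not.mpr this
    simp only [ha2, map_zero] at h hx
    -- If `a₄ = 0` the derivative is `-3x²`; otherwise eliminating powers of `x` gives `x =
    -- -3a₆/(2a₄)`.
    by_cases h4 : W.a₄ = 0
    · have : x = 0 := by simpa [h4, h3] using hx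
      rw [this]
      exact zero_mem _
    · exact div (mul_mem (num 2) (c W.a₄)) (mul_mem (num 3) (neg_mem (c W.a₆)))
        (by simpa [h2] using h4) (by push_cast; linear_combination -3 * h + x * hx)

end Field

end WeierstrassCurve

/-! ### Singularity modulo the square of the maximal ideal, and its frequency -/

namespace WeierstrassCurve

open IsLocalRing

section LocalRing

variable {R : Type*} [CommRing R] [IsLocalRing R]

/-- The Weierstrass equation over a local ring has, modulo the square of the maximal ideal, a
singular point of the total space above the closed point. -/
def IsSingularModSq (W : WeierstrassCurve R) : Prop :=
  ∃ x y : R, W.affineForm x y ∈ maximalIdeal R ^ 2 ∧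
    W.affineFormX x y ∈ maximalIdeal R ∧ W.affineFormY x y ∈ maximalIdeal R

/-- The equation is weighted homogeneous: `(x, y)` moves to `(u²x, u³y)`, and the value and the two
derivatives are multiplied by `u⁶`, `u⁴`, `u³`. This makes the condition independent of the frame of
the line bundle. -/
theorem IsSingularModSq.scale {W W' : WeierstrassCurve R} (h : W.IsSingularModSq) (u : R)
    (h₁ : W'.a₁ = u * W.a₁) (h₂ : W'.a₂ = u ^ 2 * W.a₂) (h₃ : W'.a₃ = u ^ 3 * W.a₃)
    (h₄ : W'.a₄ = u ^ 4 * W.a₄) (h₆ : W'.a₆ = u ^ 6 * W.a₆) : W'.IsSingularModSq := by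
  obtain ⟨x, y, h, hx, hy⟩ := h
  refine ⟨u ^ 2 * x, u ^ 3 * y, ?_, ?_, ?_⟩
  · convert Ideal.mul_mem_left _ (u ^ 6) h using 1
    simp only [affineForm, h₁, h₂, h₃, h₄, h₆]
    ring
  · convert Ideal.mul_mem_left _ (u ^ 4) hx using 1
    simp only [affineFormX, h₁, h₂, h₄]
    ring
  · convert Ideal.mul_mem_left _ (u ^ 3) hy using 1
    simp only [affineFormY, h₁, h₃]
    ring

/-- Membership in the maximal ideal and in its square is detected modulo the square, so the
condition can be tested over the truncated local ring. -/
theorem isSingularModSq_map_iff {B : Type*} [CommRing B] [IsLocalRing B] (φ : R →+* B)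
    (hφ : Function.Surjective φ) (hker : RingHom.ker φ = maximalIdeal R ^ 2)
    (W : WeierstrassCurve R) : (W.map φ).IsSingularModSq ↔ W.IsSingularModSq := by
  have : IsLocalHom φ := hφ.isLocalHom
  have h1 (x : R) : φ x ∈ maximalIdeal B ↔ x ∈ maximalIdeal R := by
    simp [mem_maximalIdeal, mem_nonunits_iff]
  have hm : maximalIdeal B = (maximalIdeal R).map φ := by
    refine le_antisymm (fun b hb => ?_) (Ideal.map_le_iff_le_comap.mpr fun x hx => (h1 x).mpr hx)
    obtain ⟨x, rfl⟩ := hφ b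
    exact Ideal.mem_map_of_mem _ ((h1 x).mp hb)
  have h2 (x : R) : φ x ∈ maximalIdeal B ^ 2 ↔ x ∈ maximalIdeal R ^ 2 := by
    rw [hm, ← Ideal.map_pow, ← hker, (Ideal.map_eq_bot_iff_le_ker φ).mpr le_rfl, Ideal.mem_bot,
      RingHom.mem_ker]
  constructor
  · rintro ⟨x, y, h⟩
    obtain ⟨x, rfl⟩ := hφ x
    obtain ⟨y, rfl⟩ := hφ y
    simp only [affineForm_map, affineFormX_map, affineFormY_map, h1, h2] at h
    exact ⟨x, y, h⟩
  · rintro ⟨x, y, h⟩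
    refine ⟨φ x, φ y, ?_⟩
    simpa only [affineForm_map, affineFormX_map, affineFormY_map, h1, h2] using h

-- The map `τ` only chooses representatives of residue classes. An element `r` is then the pair of
-- its class and `r - τ r`, so that one parameter in `R` can encode both a coordinate of the
-- residual singular point and the value of a derivative in the maximal ideal.
variable (R) in
theorem exists_residue_section : ∃ τ : R → R, (∀ r s : R, r - s ∈ maximalIdeal R → τ r = τ s) ∧
    ∀ r, r - τ r ∈ maximalIdeal R := by
  obtain ⟨σ, hσ⟩ := (residue_surjective (R := R)).hasRightInverse
  refine ⟨fun r => σ (residue R r), fun r s h => ?_, fun r => ?_⟩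
  · rw [← residue_eq_zero_iff, map_sub, sub_eq_zero] at h
    simp only [h]
  · rw [← residue_eq_zero_iff, map_sub, hσ, sub_self]

/-- In the Taylor expansion every correction to the value is a multiple of a product of two elements
of the maximal ideal, hence zero. -/
theorem affineForm_eq_of_sub_mem (h2 : maximalIdeal R ^ 2 = ⊥) {W : WeierstrassCurve R}
    {x y x' y' : R} (hx : W.affineFormX x y ∈ maximalIdeal R)
    (hy : W.affineFormY x y ∈ maximalIdeal R)
    (hxx : x' - x ∈ maximalIdeal R) (hyy : y' - y ∈ maximalIdeal R) :
    W.affineForm x' y' = W.affineForm x y ∧ W.affineFormX x' y' ∈ maximalIdeal R ∧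
      W.affineFormY x' y' ∈ maximalIdeal R := by
  have z {a b : R} (ha : a ∈ maximalIdeal R) (hb : b ∈ maximalIdeal R) : a * b = 0 := by
    have := Ideal.mul_mem_mul ha hb
    rwa [← pow_two, h2] at this
  obtain ⟨s, rfl⟩ : ∃ s, x' = x + s := ⟨x' - x, by ring⟩
  obtain ⟨t, rfl⟩ : ∃ t, y' = y + t := ⟨y' - y, by ring⟩
  rw [add_sub_cancel_left] at hxx hyy
  refine ⟨?_, ?_, ?_⟩
  · rw [affineForm_add]
    linear_combination z hx hxx + z hy hyy + z hyy hyy + W.a₁ * z hxx hyy -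
      (3 * x + s + W.a₂) * z hxx hxx
  · rw [affineFormX_add]
    exact add_mem hx (sub_mem (Ideal.mul_mem_left _ _ hyy) (Ideal.mul_mem_left _ _ hxx))
  · rw [affineFormY_add]
    exact add_mem hy (add_mem (Ideal.mul_mem_left _ _ hyy) (Ideal.mul_mem_left _ _ hxx))

variable {p : ℕ} [hp : Fact p.Prime] [CharP R p]

theorem charP_residueField : CharP (ResidueField R) p := by
  have : (p : ResidueField R) = 0 := by
    rw [← map_natCast (residue R), CharP.cast_eq_zero, map_zero]
  exact (CharP.charP_iff_prime_eq_zero hp.out).mpr this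

theorem sub_mem_of_isSingular {W : WeierstrassCurve R} (hW : W.IsNormalForm p) {x y x' y' : R}
    (h : W.affineForm x y ∈ maximalIdeal R) (hx : W.affineFormX x y ∈ maximalIdeal R)
    (hy : W.affineFormY x y ∈ maximalIdeal R)
    (h' : W.affineForm x' y' ∈ maximalIdeal R) (hx' : W.affineFormX x' y' ∈ maximalIdeal R)
    (hy' : W.affineFormY x' y' ∈ maximalIdeal R) :
    x - x' ∈ maximalIdeal R ∧ y - y' ∈ maximalIdeal R := by
  have := charP_residueField (R := R) (p := p)
  simp only [← residue_eq_zero_iff, map_sub, sub_eq_zero, ← affineForm_map, ← affineFormX_map,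
    ← affineFormY_map] at *
  exact singular_point_unique (p := p) (hW.map _) h hx hy h' hx' hy'

theorem isUnit_natCast {n : ℕ} (hn : ¬ p ∣ n) : IsUnit (n : R) := by
  have := charP_residueField (R := R) (p := p)
  have h : residue R (n : R) ≠ 0 := by
    rw [map_natCast]
    exact (CharP.cast_eq_zero_iff _ p n).not.mpr hn
  rwa [Ne, residue_eq_zero_iff, mem_maximalIdeal, mem_nonunits_iff, not_not] at h

end LocalRing

section Count

variable {R : Type*} [CommRing R]

instance [Finite R] : Finite (WeierstrassCurve R) :=
  Finite.of_injective (fun W => (W.a₁, W.a₂, W.a₃, W.a₄, W.a₆)) fun W W' h => by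
    simp only [Prod.mk.injEq] at h
    exact WeierstrassCurve.ext h.1 h.2.1 h.2.2.1 h.2.2.2.1 h.2.2.2.2

variable [IsLocalRing R] {p : ℕ} [hp : Fact p.Prime] [CharP R p]

/-- In a triple `v`, the first entry is `a₁`. The second encodes the residual `x`-coordinate by `τ`
and the `y`-derivative by the difference with `τ`; the third encodes the residual `y`-coordinate
and, up to sign, the `x`-derivative. The derivatives give `a₃` and `a₄`, and vanishing at the point
gives `a₆`. Uniqueness of the singular point makes the parametrisation injective. -/
theorem card_singular_of_two (h2 : maximalIdeal R ^ 2 = ⊥) [CharP R 2] :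
    Nat.card {W : WeierstrassCurve R // W.IsNormalForm 2 ∧ W.IsSingularModSq} =
      Nat.card (R × R × R) := by
  obtain ⟨τ, hτ, hτ'⟩ := exists_residue_section R
  have : Fact (Nat.Prime 2) := ⟨Nat.prime_two⟩
  let C (v : R × R × R) : WeierstrassCurve R :=
    { a₁ := v.1
      a₂ := 0
      a₃ := -2 * τ v.2.2 - v.1 * τ v.2.1 + (v.2.1 - τ v.2.1)
      a₄ := v.1 * τ v.2.2 - 3 * τ v.2.1 ^ 2 + (v.2.2 - τ v.2.2)
      a₆ := τ v.2.2 ^ 2 + v.1 * τ v.2.1 * τ v.2.2 +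
        (-2 * τ v.2.2 - v.1 * τ v.2.1 + (v.2.1 - τ v.2.1)) * τ v.2.2 - τ v.2.1 ^ 3 -
        (v.1 * τ v.2.2 - 3 * τ v.2.1 ^ 2 + (v.2.2 - τ v.2.2)) * τ v.2.1 }
  have hC (v) : (C v).affineForm (τ v.2.1) (τ v.2.2) = 0 ∧
      (C v).affineFormX (τ v.2.1) (τ v.2.2) = -(v.2.2 - τ v.2.2) ∧
      (C v).affineFormY (τ v.2.1) (τ v.2.2) = v.2.1 - τ v.2.1 := by
    refine ⟨?_, ?_, ?_⟩ <;> simp only [C, affineForm, affineFormX, affineFormY] <;> ring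
  have hN (v) : (C v).IsNormalForm 2 := ⟨fun _ => rfl, by simp, by simp⟩
  have h0 (v) : (C v).affineForm (τ v.2.1) (τ v.2.2) ∈ maximalIdeal R := by
    rw [(hC v).1]; exact zero_mem _
  have hX (v) : (C v).affineFormX (τ v.2.1) (τ v.2.2) ∈ maximalIdeal R := by
    rw [(hC v).2.1]; exact neg_mem (hτ' _)
  have hY (v) : (C v).affineFormY (τ v.2.1) (τ v.2.2) ∈ maximalIdeal R := by
    rw [(hC v).2.2]; exact hτ' _
  refine (Nat.card_congr (Equiv.ofBijective (fun v => ⟨C v, hN v, τ v.2.1, τ v.2.2,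
    by rw [(hC v).1]; exact zero_mem _, hX v, hY v⟩) ⟨fun v w h => ?_, ?_⟩)).symm
  · have h : C v = C w := congrArg Subtype.val h
    have e := sub_mem_of_isSingular (hN v) (h0 v) (hX v) (hY v)
      (h ▸ h0 w) (h ▸ hX w) (h ▸ hY w)
    have e1 : τ v.2.1 = τ w.2.1 := by
      have := add_mem (sub_mem (add_mem (hτ' v.2.1) e.1) (hτ' w.2.1)) (zero_mem _)
      exact hτ _ _ (by convert this using 1; ring)
    have e2 : τ v.2.2 = τ w.2.2 := by
      have := add_mem (sub_mem (add_mem (hτ' v.2.2) e.2) (hτ' w.2.2)) (zero_mem _)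
      exact hτ _ _ (by convert this using 1; ring)
    have f1 : v.1 = w.1 := congrArg a₁ h
    have f2 : v.2.1 = w.2.1 := by
      have := (hC v).2.2
      rw [h, e1, e2, (hC w).2.2] at this
      linear_combination -this
    have f3 : v.2.2 = w.2.2 := by
      have := (hC v).2.1
      rw [h, e1, e2, (hC w).2.1] at this
      linear_combination this
    exact Prod.ext f1 (Prod.ext f2 f3)
  · rintro ⟨W, hW, x, y, h, hx, hy⟩
    have hxx : τ x - x ∈ maximalIdeal R := by
      rw [← neg_sub]; exact neg_mem (hτ' _)
    have hyy : τ y - y ∈ maximalIdeal R := by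
      rw [← neg_sub]; exact neg_mem (hτ' _)
    obtain ⟨g, gx, gy⟩ := affineForm_eq_of_sub_mem h2 hx hy hxx hyy
    rw [h2, Ideal.mem_bot] at h
    rw [h] at g
    have hr : τ (τ x + W.affineFormY (τ x) (τ y)) = τ x :=
      hτ _ _ (by convert add_mem gy hxx using 1; ring) |>.trans rfl
    have hs : τ (τ y - W.affineFormX (τ x) (τ y)) = τ y :=
      hτ _ _ (by convert sub_mem hyy gx using 1; ring) |>.trans rfl
    refine ⟨⟨W.a₁, τ x + W.affineFormY (τ x) (τ y), τ y - W.affineFormX (τ x) (τ y)⟩, ?_⟩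
    refine Subtype.ext (WeierstrassCurve.ext rfl (hW.1 rfl).symm ?_ ?_ ?_)
    · simp only [C, hr, hs]
      simp only [affineFormY]
      ring
    · simp only [C, hr, hs]
      simp only [affineFormX, hW.1 rfl]
      ring
    · simp only [C, hr, hs]
      simp only [affineForm, affineFormX, affineFormY, hW.1 rfl] at g ⊢
      linear_combination g

variable [Finite R]

/-- Here `a₁ = a₃ = 0` and `2` is a unit, so the singular point has residual `y`-coordinate zero and
may be lifted with `y = 0`. What remains is `a₂`, zero when `p > 3`, and one parameter encoding the
residual `x`-coordinate and the `x`-derivative. -/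
theorem card_singular_of_ne_two (h2 : maximalIdeal R ^ 2 = ⊥) (hp2 : p ≠ 2) :
    Nat.card {W : WeierstrassCurve R // W.IsNormalForm p ∧ W.IsSingularModSq} =
      Nat.card ({a : R // 3 < p → a = 0} × R) := by
  obtain ⟨τ, hτ, hτ'⟩ := exists_residue_section R
  have hp' := (prime_cases hp.out).resolve_left hp2
  have hu2 : IsUnit (2 : R) := by
    refine mod_cast isUnit_natCast (R := R) (p := p) (n := 2) fun hd => ?_
    have := Nat.le_of_dvd two_pos hd
    omega
  let C (v : {a : R // 3 < p → a = 0} × R) : WeierstrassCurve R :=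
    { a₁ := 0
      a₂ := v.1.1
      a₃ := 0
      a₄ := - 3 * τ v.2 ^ 2 - 2 * v.1.1 * τ v.2 + (v.2 - τ v.2)
      a₆ := - τ v.2 ^ 3 - v.1.1 * τ v.2 ^ 2 -
        (- 3 * τ v.2 ^ 2 - 2 * v.1.1 * τ v.2 + (v.2 - τ v.2)) * τ v.2 }
  have hC (v) : (C v).affineForm (τ v.2) 0 = 0 ∧
      (C v).affineFormX (τ v.2) 0 = -(v.2 - τ v.2) ∧
      (C v).affineFormY (τ v.2) 0 = 0 := by
    refine ⟨?_, ?_, ?_⟩ <;> simp only [C, affineForm, affineFormX, affineFormY] <;> ring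
  have hN (v) : (C v).IsNormalForm p :=
    ⟨fun h => (hp2 h).elim, fun _ => ⟨rfl, rfl⟩, fun h => ⟨rfl, v.1.2 h, rfl⟩⟩
  have h0 (v) : (C v).affineForm (τ v.2) 0 ∈ maximalIdeal R := by
    rw [(hC v).1]; exact zero_mem _
  have hX (v) : (C v).affineFormX (τ v.2) 0 ∈ maximalIdeal R := by
    rw [(hC v).2.1]; exact neg_mem (hτ' _)
  have hY (v) : (C v).affineFormY (τ v.2) 0 ∈ maximalIdeal R := by
    rw [(hC v).2.2]; exact zero_mem _
  refine (Nat.card_congr (Equiv.ofBijective (fun v => ⟨C v, hN v, τ v.2, 0,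
    by rw [(hC v).1]; exact zero_mem _, hX v, hY v⟩) ⟨fun v w h => ?_, ?_⟩)).symm
  · have h : C v = C w := congrArg Subtype.val h
    have e := sub_mem_of_isSingular (hN v) (h0 v) (hX v) (hY v)
      (h ▸ h0 w) (h ▸ hX w) (h ▸ hY w)
    have e1 : τ v.2 = τ w.2 := by
      have := add_mem (sub_mem (add_mem (hτ' v.2) e.1) (hτ' w.2)) (zero_mem _)
      exact hτ _ _ (by convert this using 1; ring)
    have f3 : v.2 = w.2 := by
      have := (hC v).2.1
      rw [h, e1, (hC w).2.1] at this
      linear_combination this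
    exact Prod.ext (Subtype.ext (congrArg a₂ h)) f3
  · rintro ⟨W, hW, x, y, h, hx, hy⟩
    obtain ⟨h1, h3⟩ : W.a₁ = 0 ∧ W.a₃ = 0 := by
      rcases hp' with h | h
      · exact hW.2.1 h
      · exact ⟨(hW.2.2 h).1, (hW.2.2 h).2.2⟩
    have hxx : τ x - x ∈ maximalIdeal R := by
      rw [← neg_sub]; exact neg_mem (hτ' _)
    have hyy : 0 - y ∈ maximalIdeal R := by
      have : 2 * y ∈ maximalIdeal R := by simpa [affineFormY, h1, h3] using hy
      simpa [Ideal.unit_mul_mem_iff_mem _ hu2] using this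
    obtain ⟨g, gx, gy⟩ := affineForm_eq_of_sub_mem h2 hx hy hxx hyy
    rw [h2, Ideal.mem_bot] at h
    rw [h] at g
    have hs : τ (τ x - W.affineFormX (τ x) 0) = τ x :=
      hτ _ _ (by convert sub_mem hxx gx using 1; ring) |>.trans rfl
    refine ⟨⟨⟨W.a₂, fun h => (hW.2.2 h).2.1⟩, τ x - W.affineFormX (τ x) 0⟩, ?_⟩
    refine Subtype.ext (WeierstrassCurve.ext h1.symm rfl h3.symm ?_ ?_)
    · simp only [C, hs]
      simp only [affineFormX, h1]
      ring
    · simp only [C, hs]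
      simp only [affineForm, affineFormX, h1, h3] at g ⊢
      linear_combination g

/-- Among the Weierstrass equations in normal form over a finite local ring with maximal ideal of
square zero, the proportion of those with a singular point of the total space is `1 / #R`. -/
theorem card_singular_mul_card (h2 : maximalIdeal R ^ 2 = ⊥) :
    Nat.card {W : WeierstrassCurve R // W.IsNormalForm p ∧ W.IsSingularModSq} * Nat.card R =
      Nat.card {W : WeierstrassCurve R // W.IsNormalForm p} := by
  rcases eq_or_ne p 2 with rfl | hp2
  · rw [card_singular_of_two h2, ← Nat.card_prod]
    refine Nat.card_congr
      { toFun := fun v => ⟨⟨v.1.1, 0, v.1.2.1, v.1.2.2, v.2⟩, fun _ => rfl, by simp, by simp⟩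
        invFun := fun W => ((W.1.a₁, W.1.a₃, W.1.a₄), W.1.a₆)
        left_inv := fun v => rfl
        right_inv := fun W =>
          Subtype.ext (WeierstrassCurve.ext rfl (W.2.1 rfl).symm rfl rfl rfl) }
  · rw [card_singular_of_ne_two h2 hp2, ← Nat.card_prod]
    have hp' := (prime_cases hp.out).resolve_left hp2
    have h1 (W : WeierstrassCurve R) (hW : W.IsNormalForm p) : W.a₁ = 0 ∧ W.a₃ = 0 := by
      rcases hp' with h | h
      · exact hW.2.1 h
      · exact ⟨(hW.2.2 h).1, (hW.2.2 h).2.2⟩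
    refine Nat.card_congr
      { toFun := fun v => ⟨⟨0, v.1.1.1, 0, v.1.2, v.2⟩, fun h => (hp2 h).elim,
          fun _ => ⟨rfl, rfl⟩, fun h => ⟨rfl, v.1.1.2 h, rfl⟩⟩
        invFun := fun W => ((⟨W.1.a₂, fun h => (W.2.2.2 h).2.1⟩, W.1.a₄), W.1.a₆)
        left_inv := fun v => rfl
        right_inv := fun W =>
          Subtype.ext (WeierstrassCurve.ext (h1 _ W.2).1.symm rfl (h1 _ W.2).2.symm rfl rfl) }

end Count

end WeierstrassCurve

/-! ### A tangent vector criterion for the smoothness of hypersurfaces -/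

section Tangent

open IsLocalRing TensorProduct KaehlerDifferential

/-- The homomorphism to the dual numbers defined by a derivation. -/
def Derivation.toDualNumber {K P k : Type*} [CommRing K] [CommRing P] [Field k] [Algebra K P]
    [Algebra P k] [Algebra K k] [IsScalarTower K P k] (D : Derivation K P k) :
    P →ₐ[K] DualNumber k :=
  AlgHom.ofLinearMap
    { toFun := fun a => (algebraMap P k a, D a)
      map_add' := fun a b => by simp; rfl
      map_smul' := fun c a => by
        refine TrivSqZeroExt.ext ?_ ?_
        · exact (Algebra.smul_def c a ▸ map_mul (algebraMap P k) _ _).trans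
            (by rw [← IsScalarTower.algebraMap_apply, ← Algebra.smul_def]; rfl)
        · exact D.map_smul c a }
    (TrivSqZeroExt.ext (map_one _) D.map_one_eq_zero)
    (fun a b => TrivSqZeroExt.ext (map_mul _ _ _) (by
      refine (D.leibniz a b).trans ?_
      simp only [TrivSqZeroExt.snd_mul]
      change a • D b + b • D a = algebraMap P k a • D b + MulOpposite.op (algebraMap P k b) • D a
      simp [Algebra.smul_def, mul_comm]))

/-- The derivation defined by a homomorphism to the dual numbers. -/
def Derivation.ofDualNumber {K P k : Type*} [CommRing K] [CommRing P] [Field k] [Algebra K P]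
    [Algebra P k] [Algebra K k] [IsScalarTower K P k] (φ : P →ₐ[K] DualNumber k)
    (hφ : ∀ a, (φ a).fst = algebraMap P k a) : Derivation K P k :=
  Derivation.mk' ((TrivSqZeroExt.sndHom k k).restrictScalars K ∘ₗ φ.toLinearMap) fun a b => by
    simp [hφ, Algebra.smul_def, mul_comm]

/-- Maps to the dual numbers above the given point are derivations into `k`, that is, linear forms
on the vector space `k ⊗ Ω`, and a vector is nonzero exactly when some linear form detects it. -/
theorem exists_dualNumber_iff {K P k : Type*} [CommRing K] [CommRing P] [Field k] [Algebra K P]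
    [Algebra P k] [Algebra K k] [IsScalarTower K P k] (f : P) (hf : algebraMap P k f = 0) :
    (∃ φ : P →ₐ[K] DualNumber k, (∀ a, (φ a).fst = algebraMap P k a) ∧ φ f ≠ 0) ↔
      (1 : k) ⊗ₜ[P] D K P f ≠ 0 := by
  constructor
  · rintro ⟨φ, hφ, h⟩ h0
    apply h
    refine TrivSqZeroExt.ext ((hφ f).trans hf) ?_
    have := congrArg ((Derivation.ofDualNumber φ hφ).liftKaehlerDifferential.liftBaseChange k) h0
    simpa [Derivation.ofDualNumber] using this
  · intro h
    obtain ⟨l, hl⟩ : ∃ l : k ⊗[P] Ω[P⁄K] →ₗ[k] k, l (1 ⊗ₜ D K P f) ≠ 0 := by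
      by_contra! H
      exact h ((Module.forall_dual_apply_eq_zero_iff k _).mp H)
    let E : Derivation K P k := ((l.restrictScalars P) ∘ₗ
      (TensorProduct.mk P k Ω[P⁄K] 1)).compDer (D K P)
    refine ⟨E.toDualNumber, fun _ => rfl, fun h0 => hl ?_⟩
    exact congrArg TrivSqZeroExt.snd h0

/-- Jacobian criterion for one equation: as `f` is a nonzero element of a domain, the conormal
module tensored with `k` is a line generated by `f`. Smoothness means that this line injects into `k
⊗ Ω`, and `f` goes to its differential. -/
theorem formallySmooth_iff_one_tmul_D_ne_zero {K P S k : Type*} [CommRing K] [CommRing P]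
    [CommRing S] [Field k] [Algebra K P] [Algebra P S] [Algebra K S] [IsScalarTower K P S]
    [IsLocalRing S] [Algebra P k] [Algebra S k] [IsScalarTower P S k]
    [Algebra.FormallySmooth K P] [Module.Free P Ω[P⁄K]] [Module.Finite P Ω[P⁄K]] [IsDomain P]
    (hS : Function.Surjective (algebraMap P S)) {f : P} (hf : f ≠ 0)
    (hker : RingHom.ker (algebraMap P S) = Ideal.span {f})
    (hk : maximalIdeal S ≤ RingHom.ker (algebraMap S k)) :
    Algebra.FormallySmooth K S ↔ (1 : k) ⊗ₜ[P] D K P f ≠ 0 := by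
  have hfk : f ∈ RingHom.ker (algebraMap P S) := hker ▸ Ideal.mem_span_singleton_self f
  rw [Algebra.FormallySmooth.iff_injective_cotangentComplexBaseChange P k hS
    (hker ▸ (Submodule.fg_span_singleton f)) hk]
  have hval (c : k) : cotangentComplexBaseChange K S P k (c ⊗ₜ ⟨f, hfk⟩) = c • (1 ⊗ₜ D K P f) :=
    (KaehlerDifferential.cotangentComplexBaseChange_tmul _ _).trans (by rfl)
  have hgen (z : k ⊗[P] RingHom.ker (algebraMap P S)) : ∃ c : k, z = c ⊗ₜ ⟨f, hfk⟩ := by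
    induction z with
    | zero => exact ⟨0, (zero_tmul _ _).symm⟩
    | add x y hx hy =>
      obtain ⟨c, rfl⟩ := hx
      obtain ⟨d, rfl⟩ := hy
      exact ⟨c + d, (add_tmul _ _ _).symm⟩
    | tmul x y =>
      obtain ⟨a, ha⟩ := Ideal.mem_span_singleton'.mp (hker.le y.2)
      refine ⟨a • x, ?_⟩
      rw [smul_tmul]
      congr 1
      exact Subtype.ext ha.symm
  constructor
  · intro hinj h0
    have h1 : (1 : k) ⊗ₜ[P] (⟨f, hfk⟩ : RingHom.ker (algebraMap P S)) = 0 := by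
      apply hinj
      rw [hval, h0, smul_zero, map_zero]
    let e : P →ₗ[P] RingHom.ker (algebraMap P S) := LinearMap.toSpanSingleton P _ ⟨f, hfk⟩
    have he : Function.Bijective e := by
      refine ⟨fun a b h => mul_right_cancel₀ hf (congrArg Subtype.val h), fun y => ?_⟩
      obtain ⟨a, ha⟩ := Ideal.mem_span_singleton'.mp (hker.le y.2)
      exact ⟨a, Subtype.ext ha⟩
    let E := (LinearEquiv.ofBijective e he).symm.lTensor k ≪≫ₗ (TensorProduct.rid P k)
    have hE : E ((1 : k) ⊗ₜ[P] ⟨f, hfk⟩) = 1 := by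
      have : (LinearEquiv.ofBijective e he).symm ⟨f, hfk⟩ = 1 := by
        rw [LinearEquiv.symm_apply_eq]
        exact Subtype.ext (one_mul f).symm
      simp [E, this]
    rw [h1, map_zero] at hE
    exact zero_ne_one hE
  · intro h
    rw [injective_iff_map_eq_zero]
    intro z hz
    obtain ⟨c, rfl⟩ := hgen z
    rw [hval, smul_eq_zero] at hz
    rw [hz.resolve_right h, zero_tmul]

/-- A hypersurface `g = 0` in a smooth variety is smooth at a point if and only if some tangent
vector of the variety at the point is not tangent to it. -/
theorem isSmoothAt_iff_exists_dualNumber {K Q C k : Type*} [CommRing K] [CommRing Q] [CommRing C]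
    [Field k] [Algebra K Q] [Algebra K C] [Algebra Q C] [IsScalarTower K Q C]
    [Algebra.Smooth K Q] [IsDomain Q] (hC : Function.Surjective (algebraMap Q C)) {g : Q}
    (hg : g ≠ 0) (hker : RingHom.ker (algebraMap Q C) = Ideal.span {g}) (q : Ideal C) [q.IsPrime]
    [Algebra K k] (ψ : C →ₐ[K] k) (hψ : RingHom.ker ψ = q) :
    Algebra.IsSmoothAt K q ↔
      ∃ φ : Q →ₐ[K] DualNumber k, (∀ a, (φ a).fst = ψ (algebraMap Q C a)) ∧ φ g ≠ 0 := by
  set q' := q.comap (algebraMap Q C) with hq'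
  let P := Localization.AtPrime q'
  let S := Localization.AtPrime q
  let algPS : Algebra P S := (Localization.localRingHom q' q (algebraMap Q C) rfl).toAlgebra
  have hψu (y : q.primeCompl) : IsUnit (ψ y) := by
    rw [isUnit_iff_ne_zero]
    exact fun h => y.2 (hψ.le h)
  let algSk : Algebra S k := (IsLocalization.lift (M := q.primeCompl) (g := (ψ : C →+* k))
    hψu).toAlgebra
  let algPk : Algebra P k := ((algebraMap S k).comp (algebraMap P S)).toAlgebra
  have : IsScalarTower P S k := IsScalarTower.of_algebraMap_eq fun _ => rfl
  have hPS (a : Q) : algebraMap P S (algebraMap Q P a) = algebraMap C S (algebraMap Q C a) :=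
    Localization.localRingHom_to_map _ _ _ _ a
  have hSk (c : C) : algebraMap S k (algebraMap C S c) = ψ c :=
    IsLocalization.lift_eq (M := q.primeCompl) hψu c
  have : IsScalarTower K P S := IsScalarTower.of_algebraMap_eq fun a => by
    rw [IsScalarTower.algebraMap_apply K Q P, hPS, ← IsScalarTower.algebraMap_apply K Q C,
      ← IsScalarTower.algebraMap_apply K C S]
  have : IsScalarTower K P k := IsScalarTower.of_algebraMap_eq fun a => by
    rw [IsScalarTower.algebraMap_apply K Q P, IsScalarTower.algebraMap_apply P S k, hPS, hSk,
      ← IsScalarTower.algebraMap_apply K Q C, AlgHom.commutes]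
  have : Module.Free P Ω[P⁄K] := Module.free_of_flat_of_isLocalRing
  have hmap : Submonoid.map (algebraMap Q C) q'.primeCompl = q.primeCompl := by
    ext c
    constructor
    · rintro ⟨a, ha, rfl⟩
      exact ha
    · intro hc
      obtain ⟨a, rfl⟩ := hC c
      exact ⟨a, hc, rfl⟩
  have hS : Function.Surjective (algebraMap P S) := by
    have : IsLocalization (Submonoid.map (algebraMap Q C) q'.primeCompl) S := by
      rw [hmap]; infer_instance
    exact IsLocalization.map_surjective_of_surjective q'.primeCompl P S hC
  have hkerS : RingHom.ker (algebraMap P S) = Ideal.span {algebraMap Q P g} := by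
    have := IsLocalization.ker_map (S := P) S (algebraMap Q C) hmap
    rw [hker, Ideal.map_span, Set.image_singleton] at this
    exact this
  have hinj : Function.Injective (algebraMap Q P) :=
    IsLocalization.injective P (Ideal.primeCompl_le_nonZeroDivisors q')
  have : IsDomain P := IsLocalization.isDomain_of_le_nonZeroDivisors (M := q'.primeCompl) P
    (Ideal.primeCompl_le_nonZeroDivisors q')
  have hgP : algebraMap Q P g ≠ 0 := by simpa using hinj.ne hg
  have hPk (a : Q) : algebraMap P k (algebraMap Q P a) = ψ (algebraMap Q C a) := by
    rw [IsScalarTower.algebraMap_apply P S k, hPS, hSk]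
  have hgk : algebraMap P k (algebraMap Q P g) = 0 := by
    have : algebraMap Q C g = 0 := by
      rw [← RingHom.mem_ker, hker]; exact Ideal.mem_span_singleton_self g
    rw [hPk, this, map_zero]
  have hmax : maximalIdeal S ≤ RingHom.ker (algebraMap S k) := by
    rw [← Localization.AtPrime.map_eq_maximalIdeal, Ideal.map_le_iff_le_comap]
    intro c hc
    rw [Ideal.mem_comap, RingHom.mem_ker, hSk]
    exact hψ.ge hc
  rw [Algebra.IsSmoothAt, formallySmooth_iff_one_tmul_D_ne_zero hS hgP hkerS hmax,
    ← exists_dualNumber_iff _ hgk]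
  constructor
  · rintro ⟨φ, hφ, h⟩
    exact ⟨φ.comp (IsScalarTower.toAlgHom K Q P), fun a => (hφ _).trans (hPk a), h⟩
  · rintro ⟨φ, hφ, h⟩
    -- A dual number with nonzero first component is a unit, so tangent vectors extend from `Q` to
    -- its localization.
    have hu (y : q'.primeCompl) : IsUnit (φ y) := by
      rw [TrivSqZeroExt.isUnit_iff_isUnit_fst, hφ, isUnit_iff_ne_zero]
      exact fun h => y.2 (hψ.le h)
    refine ⟨IsLocalization.liftAlgHom (M := q'.primeCompl) (f := φ) hu, fun a => ?_, ?_⟩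
    · have : (TrivSqZeroExt.fstHom K k k).comp
          (IsLocalization.liftAlgHom (M := q'.primeCompl) (S := P) (f := φ) hu) =
          IsScalarTower.toAlgHom K P k := by
        refine IsLocalization.algHom_ext q'.primeCompl (AlgHom.ext fun a => ?_)
        refine Eq.trans (congrArg TrivSqZeroExt.fst ?_) ((hφ a).trans (hPk a).symm)
        exact IsLocalization.lift_eq (M := q'.primeCompl) (S := P) (g := (φ : Q →+* DualNumber k))
          hu a
      exact DFunLike.congr_fun this a
    · simpa using h

theorem isSmoothAt_iff_exists_dualNumber_of_algHom {K Q C k : Type*} [CommRing K] [CommRing Q]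
    [CommRing C] [Field k] [Algebra K Q] [Algebra K C] [Algebra.Smooth K Q] [IsDomain Q]
    (θ : Q →ₐ[K] C) (hC : Function.Surjective θ) {g : Q} (hg : g ≠ 0)
    (hker : RingHom.ker θ = Ideal.span {g}) (q : Ideal C) [q.IsPrime]
    [Algebra K k] (ψ : C →ₐ[K] k) (hψ : RingHom.ker ψ = q) :
    Algebra.IsSmoothAt K q ↔
      ∃ φ : Q →ₐ[K] DualNumber k, (∀ a, (φ a).fst = ψ (θ a)) ∧ φ g ≠ 0 := by
  let := θ.toAlgebra
  have : IsScalarTower K Q C := IsScalarTower.of_algebraMap_eq fun c => (θ.commutes c).symm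
  exact isSmoothAt_iff_exists_dualNumber hC hg hker q ψ hψ

end Tangent

/-! ### The standard charts of the Weierstrass cubic -/

namespace WeierstrassScheme

open MvPolynomial HomogeneousLocalization

variable {A : Type u} [CommRing A] (W : WeierstrassCurve A)

attribute [local instance] MvPolynomial.gradedAlgebra

/-- The class of a homogeneous coordinate. -/
def coordVar (j : Fin 3) : MvPolynomial (Fin 3) A ⧸ cubicIdeal W :=
  Ideal.Quotient.mk _ (X j)

theorem coordVar_mem (j : Fin 3) : coordVar W j ∈ grading W 1 :=
  ⟨X j, isHomogeneous_X A j, rfl⟩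

/-- The coordinate ring of the standard open set `D₊(X_j)`. -/
abbrev ChartRing (j : Fin 3) : Type u := Away (grading W) (coordVar W j)

/-- The structure homomorphism of the chart ring. -/
def chartBase (j : Fin 3) : A →+* ChartRing W j :=
  (fromZeroRingHom (grading W) _).comp (algebraMap A (grading W 0))

/-- The quotient `X_l / X_j` of homogeneous coordinates. -/
def chartVar (j l : Fin 3) : ChartRing W j :=
  Away.mk (grading W) (coordVar_mem W j) 1 (coordVar W l) (by simpa using coordVar_mem W l)

theorem val_chartBase (j : Fin 3) (a : A) : (chartBase W j a).val =
    algebraMap _ (Localization.Away (coordVar W j)) (Ideal.Quotient.mk (cubicIdeal W) (C a)) :=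
  Localization.mk_one_eq_algebraMap _

theorem val_chartVar (j l : Fin 3) :
    algebraMap _ (Localization.Away (coordVar W j)) (coordVar W j) * (chartVar W j l).val =
    algebraMap _ (Localization.Away (coordVar W j)) (coordVar W l) := by
  rw [chartVar, Away.val_mk, Localization.mk_eq_mk', mul_comm]
  simp

/-- The evaluation at the point `(X_l / X_j)`. -/
def chartEval (j : Fin 3) : MvPolynomial (Fin 3) A →+* ChartRing W j :=
  eval₂Hom (chartBase W j) (chartVar W j)

/-- This is `X_j^n · N(X/X_j) = N(X)` for a form of degree `n`, verified monomial by monomial. It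
transports computations in the chart to the homogeneous coordinate ring. -/
theorem val_chartEval (j : Fin 3) {N : MvPolynomial (Fin 3) A} {n : ℕ} (hN : N.IsHomogeneous n) :
    algebraMap _ (Localization.Away (coordVar W j)) (coordVar W j) ^ n * (chartEval W j N).val =
      algebraMap _ (Localization.Away (coordVar W j)) (Ideal.Quotient.mk (cubicIdeal W) N) := by
  set L := Localization.Away (coordVar W j)
  let b : MvPolynomial (Fin 3) A →+* L := (algebraMap (ChartRing W j) L).comp (chartEval W j)
  let a : MvPolynomial (Fin 3) A →+* L := (algebraMap _ L).comp (Ideal.Quotient.mk (cubicIdeal W))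
  change algebraMap _ L (coordVar W j) ^ n * b N = a N
  have hC (c : A) : b (C c) = a (C c) := by
    simp only [a, b, RingHom.comp_apply, chartEval, coe_eval₂Hom, eval₂_C]
    exact val_chartBase W j c
  have hX (l : Fin 3) : algebraMap _ L (coordVar W j) * b (X l) = a (X l) := by
    simp only [a, b, RingHom.comp_apply, chartEval, coe_eval₂Hom, eval₂_X]
    exact val_chartVar W j l
  rw [N.as_sum, map_sum, map_sum, Finset.mul_sum]
  refine Finset.sum_congr rfl fun d hd => ?_
  have hdeg : ∑ l : Fin 3, d l = n := by
    have := hN (mem_support_iff.mp hd)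
    rw [Finsupp.weight_apply, Finsupp.sum_fintype _ _ (by simp)] at this
    simpa using this
  rw [monomial_eq, map_mul, map_mul, hC, Finsupp.prod_fintype _ _ (by simp), map_prod, map_prod,
    ← hdeg, ← Finset.prod_pow_eq_pow_sum, mul_left_comm, ← Finset.prod_mul_distrib]
  simp only [map_pow, ← mul_pow, hX]

theorem isUnit_coordVar (j : Fin 3) :
    IsUnit (algebraMap _ (Localization.Away (coordVar W j)) (coordVar W j)) :=
  IsLocalization.Away.algebraMap_isUnit _

theorem chartEval_surjective (j : Fin 3) : Function.Surjective (chartEval W j) := by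
  intro z
  obtain ⟨n, x, hx, rfl⟩ := Away.mk_surjective (grading W) (coordVar_mem W j) z
  obtain ⟨N, hN, hNx⟩ := id hx
  refine ⟨N, val_injective _ ?_⟩
  apply ((isUnit_coordVar W j).pow n).mul_left_cancel
  rw [val_chartEval W j (n := n) (by simpa using hN), Away.val_mk, Localization.mk_eq_mk',
    mul_comm, ← map_pow]
  have := IsLocalization.mk'_spec (Localization.Away (coordVar W j))
    x (⟨coordVar W j ^ n, n, rfl⟩ : Submonoid.powers (coordVar W j))
  rw [this]
  exact congrArg _ hNx

theorem chartVar_self (j : Fin 3) : chartVar W j j = 1 := by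
  refine val_injective _ ?_
  apply (isUnit_coordVar W j).mul_left_cancel
  rw [val_chartVar, val_one, mul_one]

theorem chartEval_polynomial (j : Fin 3) :
    chartEval W j (WeierstrassCurve.Projective.polynomial W) = 0 := by
  refine val_injective _ ?_
  apply ((isUnit_coordVar W j).pow 3).mul_left_cancel
  rw [val_chartEval W j (isHomogeneous_polynomial W), val_zero, mul_zero,
    (Ideal.Quotient.eq_zero_iff_mem (I := cubicIdeal W)).mpr (Ideal.mem_span_singleton_self _),
    map_zero]

section Lift

variable {T : Type*} [CommRing T] (φ : A →+* T) (v : Fin 3 → T)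
  (h0 : eval₂ φ v (WeierstrassCurve.Projective.polynomial W) = 0)

/-- The evaluation of the homogeneous coordinate ring at a zero of the cubic form. -/
def quotEval : MvPolynomial (Fin 3) A ⧸ cubicIdeal W →+* T :=
  Ideal.Quotient.lift (cubicIdeal W) (eval₂Hom φ v) (fun a ha => by
    obtain ⟨b, rfl⟩ := Ideal.mem_span_singleton'.mp ha
    simp [h0])

variable (j : Fin 3)

theorem isUnit_quotEval (hv : v j = 1) : IsUnit (quotEval W φ v h0 (coordVar W j)) := by
  have : quotEval W φ v h0 (coordVar W j) = v j := by simp [quotEval, coordVar]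
  rw [this, hv]
  exact isUnit_one

/-- A homomorphism out of the chart ring, given by a zero of the cubic form with a coordinate
equal to `1`. -/
def chartLift (hv : v j = 1) : ChartRing W j →+* T :=
  (IsLocalization.Away.lift (S := Localization.Away (coordVar W j)) (coordVar W j)
    (isUnit_quotEval W φ v h0 j hv)).comp (algebraMap _ (Localization.Away (coordVar W j)))

theorem chartLift_chartEval (hv : v j = 1) (N : MvPolynomial (Fin 3) A) :
    chartLift W φ v h0 j hv (chartEval W j N) = eval₂ φ v N := by
  suffices h : (chartLift W φ v h0 j hv).comp (chartEval W j) = eval₂Hom φ v from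
    DFunLike.congr_fun h N
  have key (n : ℕ) (N : MvPolynomial (Fin 3) A) (hN : N.IsHomogeneous n) :
      chartLift W φ v h0 j hv (chartEval W j N) = eval₂ φ v N := by
    have h1 := congrArg (IsLocalization.Away.lift (S := Localization.Away (coordVar W j))
      (coordVar W j) (isUnit_quotEval W φ v h0 j hv)) (val_chartEval W j hN)
    rw [map_mul, map_pow, IsLocalization.Away.lift_eq, IsLocalization.Away.lift_eq] at h1
    have h2 : quotEval W φ v h0 (coordVar W j) = 1 := by simp [quotEval, coordVar, hv]
    rw [h2, one_pow, one_mul] at h1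
    exact h1.trans (by simp [quotEval])
  refine ringHom_ext (fun a => ?_) fun l => ?_
  · exact key 0 _ (isHomogeneous_C _ a)
  · exact key 1 _ (isHomogeneous_X _ l)

end Lift

end WeierstrassScheme

namespace WeierstrassScheme

open MvPolynomial HomogeneousLocalization

attribute [local instance] MvPolynomial.gradedAlgebra

section Criterion

variable {K A : Type u} [CommRing K] [CommRing A] [Algebra K A] (W : WeierstrassCurve A)

/-- The chart ring as an algebra over a base ring of the coefficient ring. -/
abbrev chartAlgebra (j : Fin 3) : Algebra K (ChartRing W j) :=
  ((chartBase W j).comp (algebraMap K A)).toAlgebra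

attribute [local instance] chartAlgebra

theorem algebraMap_chartRing (j : Fin 3) (c : K) :
    algebraMap K (ChartRing W j) c = chartBase W j (algebraMap K A c) := rfl

theorem eval₂_polynomial {T : Type*} [CommRing T] (φ : A →+* T) (v : Fin 3 → T) :
    eval₂ φ v (WeierstrassCurve.Projective.polynomial W) =
      v 1 ^ 2 * v 2 + φ W.a₁ * v 0 * v 1 * v 2 + φ W.a₃ * v 1 * v 2 ^ 2 -
      (v 0 ^ 3 + φ W.a₂ * v 0 ^ 2 * v 2 + φ W.a₄ * v 0 * v 2 ^ 2 + φ W.a₆ * v 2 ^ 3) := by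
  simp [WeierstrassCurve.Projective.polynomial, eval₂_sub]

/-- The tangent vector criterion for the smoothness of the Weierstrass cubic, in the chart
`D₊(X_j)`, with affine coordinates `X_{u 0} / X_j` and `X_{u 1} / X_j`. -/
theorem isSmoothAt_chartRing_iff_aux [IsDomain A] [Algebra.Smooth K A] (j : Fin 3)
    (u : Fin 2 → Fin 3) (v : Fin 3 → MvPolynomial (Fin 2) A) (hvj : v j = 1)
    (hvu : ∀ i, v (u i) = X i) (hu : ∀ l, l = j ∨ ∃ i, l = u i)
    (hF : eval₂ C v (WeierstrassCurve.Projective.polynomial W) ≠ 0)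
    {k : Type*} [Field k] [Algebra K k] (ψ : ChartRing W j →ₐ[K] k) (q : Ideal (ChartRing W j))
    [q.IsPrime] (hq : RingHom.ker ψ = q) :
    Algebra.IsSmoothAt K q ↔ ∃ (φ : A →ₐ[K] DualNumber k) (w : Fin 3 → DualNumber k),
      (∀ a, (φ a).fst = ψ (chartBase W j a)) ∧ w j = 1 ∧
      (∀ l, (w l).fst = ψ (chartVar W j l)) ∧
      eval₂ φ.toRingHom w (WeierstrassCurve.Projective.polynomial W) ≠ 0 := by
  let θ : MvPolynomial (Fin 2) A →+* ChartRing W j :=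
    eval₂Hom (chartBase W j) fun i => chartVar W j (u i)
  have hv (l : Fin 3) : θ (v l) = chartVar W j l := by
    rcases hu l with rfl | ⟨i, rfl⟩
    · rw [hvj, map_one, chartVar_self]
    · simp [hvu, θ]
  have hθ (N : MvPolynomial (Fin 3) A) : θ (eval₂ C v N) = chartEval W j N := by
    suffices h : θ.comp (eval₂Hom C v) = chartEval W j from DFunLike.congr_fun h N
    refine ringHom_ext (fun a => ?_) fun l => ?_
    · simp [θ, chartEval]
    · simp [hv, chartEval]
  let θ' : MvPolynomial (Fin 2) A →ₐ[K] ChartRing W j :=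
    { toRingHom := θ
      commutes' := fun c => by
        change θ (C (algebraMap K A c)) = _
        simp [θ, algebraMap_chartRing] }
  have hsurj : Function.Surjective θ' := by
    intro z
    obtain ⟨N, rfl⟩ := chartEval_surjective W j z
    exact ⟨_, hθ N⟩
  have hker : RingHom.ker θ' =
      Ideal.span {eval₂ C v (WeierstrassCurve.Projective.polynomial W)} := by
    refine le_antisymm (fun h hh => ?_) ?_
    -- The dehomogenised cubic vanishes in `A[X, Y]/I`, so the chart ring maps back there. The
    -- composite with `θ` is the quotient map, whence the kernel of `θ` lies in `I`.
    · set I := Ideal.span {eval₂ C v (WeierstrassCurve.Projective.polynomial W)}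
      have h0 : eval₂ ((Ideal.Quotient.mk I).comp C) (fun l => Ideal.Quotient.mk I (v l))
          (WeierstrassCurve.Projective.polynomial W) = 0 := by
        rw [← Ideal.Quotient.eq_zero_iff_mem.mpr (Ideal.mem_span_singleton_self _),
          MvPolynomial.hom_eval₂]
      have hcomp : (chartLift W _ _ h0 j (by simp [hvj])).comp θ = Ideal.Quotient.mk I := by
        refine ringHom_ext (fun a => ?_) fun i => ?_
        · have := chartLift_chartEval W _ _ h0 j (by simp [hvj]) (C a)
          rw [← hθ] at this
          simpa using this
        · have := chartLift_chartEval W _ _ h0 j (by simp [hvj]) (X (u i))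
          rw [← hθ] at this
          simpa [hvu] using this
      rw [← Ideal.Quotient.eq_zero_iff_mem, ← hcomp, RingHom.comp_apply,
        show θ h = 0 from hh, map_zero]
    · rw [Ideal.span_singleton_le_iff_mem, RingHom.mem_ker]
      exact (hθ _).trans (chartEval_polynomial W j)
  have : Algebra.Smooth A (MvPolynomial (Fin 2) A) := ⟨inferInstance, inferInstance⟩
  have : Algebra.Smooth K (MvPolynomial (Fin 2) A) := Algebra.Smooth.comp K A _
  rw [isSmoothAt_iff_exists_dualNumber_of_algHom θ' hsurj hF hker q ψ hq]
  constructor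
  · rintro ⟨φ, hφ, h⟩
    refine ⟨φ.comp (IsScalarTower.toAlgHom K A _), fun l => φ (v l), fun a => ?_, ?_,
      fun l => ?_, ?_⟩
    · refine (hφ _).trans (congrArg ψ ?_)
      change θ (C a) = _
      simp [θ]
    · simp only [hvj, map_one]
    · exact (hφ _).trans (congrArg ψ (hv l))
    · convert h using 1
      refine Eq.trans ?_ (MvPolynomial.hom_eval₂ _ C φ.toRingHom v).symm
      rfl
  · rintro ⟨φ, w, hφ, hwj, hw, h⟩
    let Φ : MvPolynomial (Fin 2) A →ₐ[K] DualNumber k :=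
      { toRingHom := eval₂Hom φ.toRingHom fun i => w (u i)
        commutes' := fun c => by
          change eval₂ φ.toRingHom (fun i => w (u i)) (C (algebraMap K A c)) = _
          simp }
    have hΦC (a : A) : Φ (C a) = φ a := eval₂_C _ _ _
    have hΦX (i) : Φ (X i) = w (u i) := eval₂_X _ _ _
    have hΦv (l) : Φ (v l) = w l := by
      rcases hu l with rfl | ⟨i, rfl⟩
      · rw [hvj, map_one, hwj]
      · rw [hvu, hΦX]
    refine ⟨Φ, fun a => ?_, ?_⟩
    · suffices H : ((TrivSqZeroExt.fstHom K k k).comp Φ).toRingHom =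
          ψ.toRingHom.comp θ from DFunLike.congr_fun H a
      refine ringHom_ext (fun a => ?_) fun i => ?_
      · change (Φ (C a)).fst = ψ (θ (C a))
        rw [hΦC, hφ]
        simp [θ]
      · change (Φ (X i)).fst = ψ (θ (X i))
        rw [hΦX, hw]
        simp [θ]
    · convert h using 1
      refine (MvPolynomial.hom_eval₂ _ C Φ.toRingHom v).trans ?_
      congr 1
      · ext a : 1
        exact hΦC a
      · exact funext hΦv

variable [IsDomain A] [Algebra.Smooth K A] {k : Type*} [Field k] [Algebra K k]

theorem isSmoothAt_chartRing_iff (j : Fin 3) (hj : j = 1 ∨ j = 2) (ψ : ChartRing W j →ₐ[K] k)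
    (q : Ideal (ChartRing W j)) [q.IsPrime] (hq : RingHom.ker ψ = q) :
    Algebra.IsSmoothAt K q ↔ ∃ (φ : A →ₐ[K] DualNumber k) (w : Fin 3 → DualNumber k),
      (∀ a, (φ a).fst = ψ (chartBase W j a)) ∧ w j = 1 ∧
      (∀ l, (w l).fst = ψ (chartVar W j l)) ∧
      eval₂ φ.toRingHom w (WeierstrassCurve.Projective.polynomial W) ≠ 0 := by
  rcases hj with rfl | rfl
  · refine isSmoothAt_chartRing_iff_aux W 1 ![0, 2] ![X 0, 1, X 1] rfl
      (fun i => by fin_cases i <;> rfl) (by decide) (fun h => ?_) ψ q hq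
    -- At `X = 1`, `Z = 0` the dehomogenised cubic takes the value `-1`.
    have := congrArg (eval ![1, 0]) h
    rw [eval₂_polynomial] at this
    simp at this
  · refine isSmoothAt_chartRing_iff_aux W 2 ![0, 1] ![X 0, X 1, 1] rfl
      (fun i => by fin_cases i <;> rfl) (by decide) (fun h => ?_) ψ q hq
    rw [eval₂_polynomial] at h
    -- At `X = 0` the dehomogenised cubic is monic of degree 2 in `Y`.
    have := congrArg (fun f => (aeval ![0, Polynomial.X] f : Polynomial A).coeff 2) h
    simp at this

end Criterion

end WeierstrassScheme

/-! ### Smoothness above a point in terms of `IsSingularModSq` -/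

section Tangent

open IsLocalRing TensorProduct KaehlerDifferential

/-- Since `B` and its residue field are formally smooth over `K`, `𝔪/𝔪²` injects into the
differentials at the closed point. An element of `𝔪` outside `𝔪²` thus has nonzero differential
there. -/
theorem exists_dualNumber_of_notMem_sq {K B : Type*} [CommRing K] [CommRing B] [IsLocalRing B]
    [Algebra K B] [Algebra.FormallySmooth K B] [Algebra.FormallySmooth K (ResidueField B)] {h : B}
    (hm : h ∈ maximalIdeal B) (h2 : h ∉ maximalIdeal B ^ 2) :
    ∃ ρ : B →ₐ[K] DualNumber (ResidueField B), (∀ b, (ρ b).fst = residue B b) ∧ ρ h ≠ 0 := by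
  have hsurj : Function.Surjective (algebraMap B (ResidueField B)) := residue_surjective
  have hker : RingHom.ker (algebraMap B (ResidueField B)) = maximalIdeal B := ker_residue
  have hinj := (Algebra.FormallySmooth.kerCotangentToTensor_injective_iff (R := K) hsurj).mpr
    inferInstance
  have hk : h ∈ RingHom.ker (algebraMap B (ResidueField B)) := hker.ge hm
  refine (exists_dualNumber_iff h hk).mpr fun h0 => h2 ?_
  have : Ideal.toCotangent _ (⟨h, hk⟩ : RingHom.ker (algebraMap B (ResidueField B))) = 0 := by
    apply hinj
    rw [kerCotangentToTensor_toCotangent, map_zero]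
    exact h0
  rw [Ideal.toCotangent_eq_zero] at this
  exact hker ▸ (show h ∈ RingHom.ker (algebraMap B (ResidueField B)) ^ 2 from this)

end Tangent

namespace WeierstrassScheme

open MvPolynomial HomogeneousLocalization IsLocalRing

attribute [local instance] MvPolynomial.gradedAlgebra chartAlgebra

theorem affineForm_chartVar {A : Type u} [CommRing A] (W : WeierstrassCurve A) (T : Type*)
    [CommRing T] (ψ : ChartRing W 2 →+* T) :
    (W.map (ψ.comp (chartBase W 2))).affineForm (ψ (chartVar W 2 0)) (ψ (chartVar W 2 1)) = 0 := by
  have := congrArg ψ (chartEval_polynomial W 2)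
  rw [chartEval, coe_eval₂Hom, eval₂_polynomial] at this
  simpa [chartVar_self, WeierstrassCurve.affineForm] using this

section

variable {K A : Type u} [CommRing K] [CommRing A] [Algebra K A] [IsDomain A] [Algebra.Smooth K A]
  (W : WeierstrassCurve A)

/-- The structure homomorphism of the chart ring, as an algebra homomorphism. -/
def chartBaseAlg (j : Fin 3) : A →ₐ[K] ChartRing W j :=
  { chartBase W j with commutes' := fun _ => rfl }

/-- At `Z = 0` in the chart `Y = 1` the cubic forces `X = 0`, and the term `Y²Z` has derivative `1`
in `Z`. The tangent vector `(0, 1, ε)`, constant along the base, is therefore not tangent to the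
cubic. -/
theorem isSmoothAt_infinity {k : Type*} [Field k] [Algebra K k] (ψ : ChartRing W 1 →ₐ[K] k)
    (q : Ideal (ChartRing W 1)) [q.IsPrime] (hq : RingHom.ker ψ = q)
    (hz : ψ (chartVar W 1 2) = 0) : Algebra.IsSmoothAt K q := by
  have hx : ψ (chartVar W 1 0) = 0 := by
    have := congrArg ψ (chartEval_polynomial W 1)
    rw [chartEval, coe_eval₂Hom, eval₂_polynomial] at this
    simpa [hz] using this
  rw [isSmoothAt_chartRing_iff W 1 (Or.inl rfl) ψ q hq]
  refine ⟨(TrivSqZeroExt.inlAlgHom K k k).comp (ψ.comp (chartBaseAlg W 1)),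
    ![0, 1, DualNumber.eps], fun a => rfl, rfl, fun l => ?_, fun h => ?_⟩
  · fin_cases l
    · simp [hx]
    · simp [chartVar_self]
    · simp [hz]
  · rw [eval₂_polynomial] at h
    have := congrArg TrivSqZeroExt.snd h
    simp [pow_succ] at this

theorem isSmoothAt_affine_iff {k : Type*} [Field k] [Algebra K k] (ψ : ChartRing W 2 →ₐ[K] k)
    (q : Ideal (ChartRing W 2)) [q.IsPrime] (hq : RingHom.ker ψ = q) :
    Algebra.IsSmoothAt K q ↔ ∃ (φ : A →ₐ[K] DualNumber k) (x y : DualNumber k),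
      (∀ a, (φ a).fst = ψ (chartBase W 2 a)) ∧ x.fst = ψ (chartVar W 2 0) ∧
      y.fst = ψ (chartVar W 2 1) ∧ (W.map φ.toRingHom).affineForm x y ≠ 0 := by
  rw [isSmoothAt_chartRing_iff W 2 (Or.inr rfl) ψ q hq]
  constructor
  · rintro ⟨φ, w, hφ, h1, hw, h⟩
    refine ⟨φ, w 0, w 1, hφ, hw 0, hw 1, ?_⟩
    rw [eval₂_polynomial] at h
    simpa [h1, WeierstrassCurve.affineForm] using h
  · rintro ⟨φ, x, y, hφ, hx, hy, h⟩
    refine ⟨φ, ![x, y, 1], hφ, rfl, fun l => ?_, ?_⟩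
    · fin_cases l
      · exact hx
      · exact hy
      · simp [chartVar_self]
    · rw [eval₂_polynomial]
      simpa [WeierstrassCurve.affineForm] using h

variable {B : Type*} [CommRing B] [IsLocalRing B] [Algebra K B] [Algebra A B] [IsScalarTower K A B]

/-- At a point singular in its fibre, rationality gives a lift `(x, y)` to `B`, and the value there
lies outside the square of the maximal ideal, so a tangent vector of `B` detects it. At any other
point a vertical tangent vector suffices. -/
theorem isSmoothAt_of_not_isSingularModSq [Algebra.FormallySmooth K B]
    [Algebra.FormallySmooth K (ResidueField B)] {p : ℕ} [Fact p.Prime] [CharP (ResidueField B) p]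
    [PerfectRing (ResidueField B) p] (hW : W.IsNormalForm p)
    (hns : ¬ (W.map (algebraMap A B)).IsSingularModSq) {k : Type*} [Field k] [Algebra K k]
    (ψ : ChartRing W 2 →ₐ[K] k) (q : Ideal (ChartRing W 2)) [q.IsPrime] (hq : RingHom.ker ψ = q)
    (χ : ResidueField B →+* k)
    (hχ : ∀ a, ψ (chartBase W 2 a) = χ (residue B (algebraMap A B a))) :
    Algebra.IsSmoothAt K q := by
  rw [isSmoothAt_affine_iff W ψ q hq]
  set x₀ := ψ (chartVar W 2 0)
  set y₀ := ψ (chartVar W 2 1)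
  have hWk : W.map (ψ.toRingHom.comp (chartBase W 2)) =
      ((W.map (algebraMap A B)).map (residue B)).map χ := by
    rw [WeierstrassCurve.map_map, WeierstrassCurve.map_map]
    congr 1
    ext a
    exact hχ a
  have h0 : (((W.map (algebraMap A B)).map (residue B)).map χ).affineForm x₀ y₀ = 0 := by
    rw [← hWk]
    exact affineForm_chartVar W k ψ.toRingHom
  by_cases hs : (((W.map (algebraMap A B)).map (residue B)).map χ).affineFormX x₀ y₀ = 0 ∧
      (((W.map (algebraMap A B)).map (residue B)).map χ).affineFormY x₀ y₀ = 0
  · have : CharP k p := charP_of_injective_ringHom χ.injective p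
    obtain ⟨⟨x₁, hx₁⟩, ⟨y₁, hy₁⟩⟩ := WeierstrassCurve.singular_point_mem_range (p := p) χ
      ((hW.map (algebraMap A B)).map (residue B)) h0 hs.1 hs.2
    obtain ⟨x, rfl⟩ := residue_surjective x₁
    obtain ⟨y, rfl⟩ := residue_surjective y₁
    rw [← hx₁, ← hy₁] at h0 hs
    simp only [WeierstrassCurve.affineForm_map, WeierstrassCurve.affineFormX_map,
      WeierstrassCurve.affineFormY_map, map_eq_zero, residue_eq_zero_iff] at h0 hs
    have h2 : (W.map (algebraMap A B)).affineForm x y ∉ maximalIdeal B ^ 2 :=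
      fun h2 => hns ⟨x, y, h2, hs⟩
    obtain ⟨ρ, hρ, hne⟩ := exists_dualNumber_of_notMem_sq (K := K) h0 h2
    have hχK (c : K) : χ (algebraMap K (ResidueField B) c) = algebraMap K k c := by
      rw [← ψ.commutes, algebraMap_chartRing, hχ, ← IsScalarTower.algebraMap_apply]
      rfl
    -- Extension of scalars of dual numbers along `χ`. It is injective, so the tangent vector still
    -- detects the equation over `k`.
    let E : DualNumber (ResidueField B) →+* DualNumber k :=
      { toFun := fun z => (χ z.fst, χ z.snd)
        map_one' := TrivSqZeroExt.ext (map_one χ) (map_zero χ)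
        map_zero' := TrivSqZeroExt.ext (map_zero χ) (map_zero χ)
        map_add' := fun z w => TrivSqZeroExt.ext (map_add χ _ _) (map_add χ _ _)
        map_mul' := fun z w => TrivSqZeroExt.ext (map_mul χ _ _) (by
          refine Eq.trans (b := χ (z.fst * w.snd + z.snd * w.fst)) rfl ?_
          simp only [map_add, map_mul]
          rfl) }
    have hE (z) : E z = 0 → z = 0 := fun hz => by
      refine TrivSqZeroExt.ext (χ.injective ?_) (χ.injective ?_)
      · exact (congrArg TrivSqZeroExt.fst hz).trans (map_zero χ).symm
      · exact (congrArg TrivSqZeroExt.snd hz).trans (map_zero χ).symm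
    let φ : A →ₐ[K] DualNumber k :=
      { toRingHom := (E.comp ρ.toRingHom).comp (algebraMap A B)
        commutes' := fun c => by
          change E (ρ (algebraMap A B (algebraMap K A c))) = _
          rw [← IsScalarTower.algebraMap_apply, ρ.commutes]
          refine TrivSqZeroExt.ext (hχK c) (map_zero χ) }
    refine ⟨φ, E (ρ x), E (ρ y), fun a => ?_, ?_, ?_, fun h => hne (hE _ ?_)⟩
    · exact (congrArg χ (hρ _)).trans (hχ a).symm
    · exact (congrArg χ (hρ _)).trans hx₁
    · exact (congrArg χ (hρ _)).trans hy₁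
    · have := WeierstrassCurve.affineForm_map (W.map (algebraMap A B)) (E.comp ρ.toRingHom) x y
      rw [WeierstrassCurve.map_map] at this
      exact this.symm.trans h
  -- A vertical direction `(s, t)` along which the derivative of the equation is nonzero.
  · obtain ⟨s, t, hst⟩ : ∃ s t : k,
        (((W.map (algebraMap A B)).map (residue B)).map χ).affineFormX x₀ y₀ * s +
        (((W.map (algebraMap A B)).map (residue B)).map χ).affineFormY x₀ y₀ * t ≠ 0 := by
      rw [not_and_or] at hs
      rcases hs with hs | hs
      · exact ⟨1, 0, by simpa using hs⟩
      · exact ⟨0, 1, by simpa using hs⟩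
    refine ⟨(TrivSqZeroExt.inlAlgHom K k k).comp (ψ.comp (chartBaseAlg W 2)),
      TrivSqZeroExt.inl x₀ + TrivSqZeroExt.inr s, TrivSqZeroExt.inl y₀ + TrivSqZeroExt.inr t,
      fun a => rfl, by simp, by simp, fun h => hst ?_⟩
    have hmap : W.map ((TrivSqZeroExt.inlAlgHom K k k).comp
        (ψ.comp (chartBaseAlg W 2))).toRingHom =
        (((W.map (algebraMap A B)).map (residue B)).map χ).map (TrivSqZeroExt.inlHom k k) := by
      rw [← hWk, WeierstrassCurve.map_map]
      rfl
    rw [hmap, WeierstrassCurve.affineForm_add] at h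
    have e1 := WeierstrassCurve.affineForm_map
      (((W.map (algebraMap A B)).map (residue B)).map χ) (TrivSqZeroExt.inlHom k k) x₀ y₀
    have e2 := WeierstrassCurve.affineFormX_map
      (((W.map (algebraMap A B)).map (residue B)).map χ) (TrivSqZeroExt.inlHom k k) x₀ y₀
    have e3 := WeierstrassCurve.affineFormY_map
      (((W.map (algebraMap A B)).map (residue B)).map χ) (TrivSqZeroExt.inlHom k k) x₀ y₀
    simp only [TrivSqZeroExt.inlHom_apply] at e1 e2 e3
    rw [e1, e2, e3] at h
    have := congrArg TrivSqZeroExt.snd h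
    rw [mul_comm _ s, mul_comm _ t]
    simpa [pow_two, mul_assoc] using this

/-- The bad point is the reduction of `(x, y)`. A tangent vector there extends from `A` to the
localization `B` and kills the square of the maximal ideal, hence the value of the equation. The
derivatives become multiples of `ε`, as do the displacements of the coordinates, so every term of
the Taylor expansion vanishes. -/
theorem exists_not_isSmoothAt_of_isSingularModSq
    [IsLocalization.AtPrime B ((maximalIdeal B).comap (algebraMap A B))]
    (hs : (W.map (algebraMap A B)).IsSingularModSq) :
    ∃ (ψ : ChartRing W 2 →ₐ[K] ResidueField B) (q : Ideal (ChartRing W 2)) (_ : q.IsPrime),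
      RingHom.ker ψ = q ∧ (∀ a, ψ (chartBase W 2 a) = residue B (algebraMap A B a)) ∧
      ¬ Algebra.IsSmoothAt K q := by
  obtain ⟨x, y, h, hx, hy⟩ := hs
  have hm := Ideal.pow_le_self (I := maximalIdeal B) two_ne_zero h
  have h0 : eval₂ ((residue B).comp (algebraMap A B)) ![residue B x, residue B y, 1]
      (WeierstrassCurve.Projective.polynomial W) = 0 := by
    rw [eval₂_polynomial]
    rw [← residue_eq_zero_iff] at hm
    simpa [WeierstrassCurve.affineForm] using hm
  have hb (a : A) : chartLift W _ _ h0 2 rfl (chartBase W 2 a) = residue B (algebraMap A B a) := by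
    have := chartLift_chartEval W _ _ h0 2 rfl (C a)
    simpa [chartEval] using this
  have hvar (l : Fin 3) : chartLift W _ _ h0 2 rfl (chartVar W 2 l) =
      ![residue B x, residue B y, 1] l := by
    have := chartLift_chartEval W _ _ h0 2 rfl (X l)
    simpa [chartEval] using this
  let ψ : ChartRing W 2 →ₐ[K] ResidueField B :=
    { toRingHom := chartLift W _ _ h0 2 rfl
      commutes' := fun c => by
        change chartLift W _ _ h0 2 rfl (chartBase W 2 (algebraMap K A c)) = _
        rw [hb, ← IsScalarTower.algebraMap_apply]
        rfl }
  have hprime : (RingHom.ker ψ).IsPrime := RingHom.ker_isPrime ψ.toRingHom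
  refine ⟨ψ, _, hprime, rfl, hb, fun hsm => ?_⟩
  obtain ⟨φ, x', y', hφ, hx', hy', hne⟩ := (isSmoothAt_affine_iff W ψ _ rfl).mp hsm
  replace hφ (a : A) : (φ a).fst = residue B (algebraMap A B a) := (hφ a).trans (hb a)
  have hu (a : ((maximalIdeal B).comap (algebraMap A B)).primeCompl) : IsUnit (φ.toRingHom a) := by
    refine TrivSqZeroExt.isUnit_iff_isUnit_fst.mpr ?_
    change IsUnit (φ a).fst
    rw [hφ, isUnit_iff_ne_zero, Ne, residue_eq_zero_iff]
    exact a.2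
  let Φ : B →+* DualNumber (ResidueField B) :=
    IsLocalization.lift (M := ((maximalIdeal B).comap (algebraMap A B)).primeCompl) hu
  have hΦA (a : A) : Φ (algebraMap A B a) = φ a := IsLocalization.lift_eq _ _
  have hΦ (b : B) : (Φ b).fst = residue B b := by
    suffices H : (TrivSqZeroExt.fstHom (ResidueField B) (ResidueField B)
        (ResidueField B)).toRingHom.comp Φ = residue B from DFunLike.congr_fun H b
    refine IsLocalization.ringHom_ext ((maximalIdeal B).comap (algebraMap A B)).primeCompl ?_
    ext a
    exact (congrArg TrivSqZeroExt.fst (hΦA a)).trans (hφ a)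
  have hmap : W.map φ.toRingHom = (W.map (algebraMap A B)).map Φ := by
    rw [WeierstrassCurve.map_map]
    congr 1
    ext a : 1
    exact (hΦA a).symm
  have hΦm (b : B) (hb : b ∈ maximalIdeal B) : ∃ c, Φ b = TrivSqZeroExt.inr c := by
    refine ⟨(Φ b).snd, TrivSqZeroExt.ext ?_ rfl⟩
    rw [hΦ, (residue_eq_zero_iff b).mpr hb]
    rfl
  have hzero (c d : ResidueField B) : (TrivSqZeroExt.inr c : DualNumber (ResidueField B)) *
    TrivSqZeroExt.inr d = 0 := TrivSqZeroExt.inr_mul_inr _ _ _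
  have hΦ2 : Φ ((W.map (algebraMap A B)).affineForm x y) = 0 := by
    have : maximalIdeal B ^ 2 ≤ RingHom.ker Φ := by
      rw [pow_two, Ideal.mul_le]
      intro r hr s hs
      obtain ⟨c, hc⟩ := hΦm r hr
      obtain ⟨d, hd⟩ := hΦm s hs
      rw [RingHom.mem_ker, map_mul, hc, hd, hzero]
    exact this h
  obtain ⟨s, hs⟩ : ∃ s, x' = Φ x + TrivSqZeroExt.inr s := by
    refine ⟨x'.snd - (Φ x).snd, TrivSqZeroExt.ext ?_ (by simp)⟩
    simpa [hΦ] using hx'.trans (hvar 0)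
  obtain ⟨t, ht⟩ : ∃ t, y' = Φ y + TrivSqZeroExt.inr t := by
    refine ⟨y'.snd - (Φ y).snd, TrivSqZeroExt.ext ?_ (by simp)⟩
    simpa [hΦ] using hy'.trans (hvar 1)
  apply hne
  obtain ⟨c, hc⟩ := hΦm _ hx
  obtain ⟨d, hd⟩ := hΦm _ hy
  rw [hmap, hs, ht, WeierstrassCurve.affineForm_add, WeierstrassCurve.affineForm_map,
    WeierstrassCurve.affineFormX_map, WeierstrassCurve.affineFormY_map, hc, hd, hΦ2]
  simp only [pow_two, mul_assoc, hzero, mul_zero, add_zero, sub_zero]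

end

end WeierstrassScheme

/-! ### From smoothness in affine charts to the projective model -/

theorem isSmoothAt_iff_of_isOpenImmersion {K C : Type u} [CommRing K] [CommRing C] [Algebra K C]
    [Algebra.FinitePresentation K C] {X : Scheme.{u}} (i : Spec (.of C) ⟶ X) [IsOpenImmersion i]
    (g : X ⟶ Spec (.of K)) (hg : i ≫ g = Spec.map (CommRingCat.ofHom (algebraMap K C)))
    (p : PrimeSpectrum C) : IsSmoothAt g (i p) ↔ Algebra.IsSmoothAt K p.asIdeal := by
  have hcomp (h : C) : Spec.map (CommRingCat.ofHom (algebraMap K (Localization.Away h))) =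
      Spec.map (CommRingCat.ofHom (algebraMap C (Localization.Away h))) ≫ i ≫ g := by
    rw [hg, ← Spec.map_comp, ← CommRingCat.ofHom_comp, ← IsScalarTower.algebraMap_eq]
  have himm (h : C) :
      IsOpenImmersion (Spec.map (CommRingCat.ofHom (algebraMap C (Localization.Away h)))) :=
    inferInstance
  have hrange (h : C) : Set.range
      (Spec.map (CommRingCat.ofHom (algebraMap C (Localization.Away h)))) =
      (PrimeSpectrum.basicOpen h : Set (PrimeSpectrum C)) :=
    PrimeSpectrum.localization_away_comap_range _ h
  have hsm (h : C) : Smooth (Spec.map (CommRingCat.ofHom (algebraMap K (Localization.Away h)))) ↔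
      Algebra.Smooth K (Localization.Away h) := by
    rw [HasRingHomProperty.Spec_iff (P := @Smooth)]
    exact RingHom.smooth_algebraMap
  constructor
  · rintro ⟨U, hpU, hU⟩
    obtain ⟨_, ⟨_, ⟨h, rfl⟩, rfl⟩, hph, hhU⟩ :=
      PrimeSpectrum.isBasis_basic_opens.exists_subset_of_mem_open
        (show p ∈ ((i ⁻¹ᵁ U).1 : Set (PrimeSpectrum C)) from hpU) (i ⁻¹ᵁ U).2
    refine Algebra.basicOpen_subset_smoothLocus_iff_smooth.mpr ?_ hph
    rw [← hsm, hcomp]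
    let j := Spec.map (CommRingCat.ofHom (algebraMap C (Localization.Away h))) ≫ i
    have hj : Set.range j ⊆ Set.range U.ι := by
      rw [Scheme.Opens.range_ι]
      rintro _ ⟨z, rfl⟩
      exact hhU ((hrange h).le ⟨z, rfl⟩)
    have : IsOpenImmersion (IsOpenImmersion.lift U.ι j hj) := by
      have : IsOpenImmersion (IsOpenImmersion.lift U.ι j hj ≫ U.ι) := by
        rw [IsOpenImmersion.lift_fac]
        infer_instance
      exact IsOpenImmersion.of_comp _ U.ι
    change Smooth (j ≫ g)
    rw [← IsOpenImmersion.lift_fac U.ι j hj, Category.assoc]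
    infer_instance
  · intro hp
    obtain ⟨h, hph, hh⟩ := Algebra.IsSmoothAt.exists_notMem_smooth K p.asIdeal
    let j := Spec.map (CommRingCat.ofHom (algebraMap C (Localization.Away h))) ≫ i
    refine ⟨j.opensRange, ?_, ?_⟩
    · obtain ⟨z, hz⟩ := (hrange h).ge hph
      exact ⟨z, congrArg i hz⟩
    · rw [← hsm, hcomp] at hh
      have : j.opensRange.ι ≫ g = j.isoOpensRange.inv ≫ j ≫ g := by
        rw [← Category.assoc, Scheme.Hom.isoOpensRange_inv_comp]
      rw [this]
      have : Smooth (j ≫ g) := by simpa only [j, Category.assoc] using hh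
      infer_instance

namespace WeierstrassScheme

open MvPolynomial HomogeneousLocalization IsLocalRing

attribute [local instance] MvPolynomial.gradedAlgebra chartAlgebra

section

variable {A : Type u} [CommRing A] (W : WeierstrassCurve A)

/-- The open immersion of the chart `D₊(X_j)`. -/
def chartι (j : Fin 3) : Spec (.of (ChartRing W j)) ⟶ hypersurface W :=
  Proj.awayι (grading W) (coordVar W j) (coordVar_mem W j) one_pos

instance (j : Fin 3) : IsOpenImmersion (chartι W j) :=
  inferInstanceAs (IsOpenImmersion (Proj.awayι _ _ _ _))

theorem chartι_toSpec (j : Fin 3) :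
    chartι W j ≫ toSpec W = Spec.map (CommRingCat.ofHom (chartBase W j)) := by
  refine (Proj.awayι_toSpecZero_assoc (grading W) (coordVar W j) (coordVar_mem W j) one_pos
    (Spec.map (CommRingCat.ofHom (algebraMap A (grading W 0))))).trans ?_
  rw [← Spec.map_comp]
  rfl

theorem mem_range_chartι (j : Fin 3) (w : hypersurface W) :
    w ∈ Set.range (chartι W j) ↔
      coordVar W j ∉ ProjectiveSpectrum.asHomogeneousIdeal (𝒜 := grading W) w := by
  have := Proj.opensRange_awayι (grading W) (coordVar W j) (coordVar_mem W j) one_pos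
  change w ∈ (Proj.awayι (grading W) (coordVar W j) (coordVar_mem W j) one_pos).opensRange ↔ _
  rw [this]
  rfl

theorem span_coordVar_of_mem {n : ℕ} (hn : 0 < n) {z : MvPolynomial (Fin 3) A ⧸ cubicIdeal W}
    (hz : z ∈ grading W n) : z ∈ Ideal.span (Set.range (coordVar W)) := by
  obtain ⟨N, hN, rfl⟩ := hz
  have : N ∈ Ideal.span (Set.range (X : Fin 3 → MvPolynomial (Fin 3) A)) := by
    rw [← Set.image_univ, mem_ideal_span_X_image]
    intro m hm
    by_contra! h
    have h0 : m = 0 := Finsupp.ext fun i => by simpa using h i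
    have := hN (mem_support_iff.mp hm)
    rw [h0] at this
    simp at this
    omega
  have := Ideal.mem_map_of_mem (Ideal.Quotient.mk (cubicIdeal W)) this
  rw [Ideal.map_span, ← Set.range_comp] at this
  exact this

theorem coordVar_cube_mem (J : Ideal (MvPolynomial (Fin 3) A ⧸ cubicIdeal W))
    (h : coordVar W 2 ∈ J) : coordVar W 0 ^ 3 ∈ J := by
  have h0 : Ideal.Quotient.mk (cubicIdeal W) (WeierstrassCurve.Projective.polynomial W) = 0 :=
    Ideal.Quotient.eq_zero_iff_mem.mpr (Ideal.mem_span_singleton_self _)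
  simp only [WeierstrassCurve.Projective.polynomial, map_sub, map_add, map_mul, map_pow] at h0
  have : coordVar W 0 ^ 3 = coordVar W 2 * (coordVar W 1 ^ 2 +
      Ideal.Quotient.mk (cubicIdeal W) (C W.a₁) * coordVar W 0 * coordVar W 1 +
      Ideal.Quotient.mk (cubicIdeal W) (C W.a₃) * coordVar W 1 * coordVar W 2 -
      Ideal.Quotient.mk (cubicIdeal W) (C W.a₂) * coordVar W 0 ^ 2 -
      Ideal.Quotient.mk (cubicIdeal W) (C W.a₄) * coordVar W 0 * coordVar W 2 -
      Ideal.Quotient.mk (cubicIdeal W) (C W.a₆) * coordVar W 2 ^ 2) := by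
    simp only [coordVar]
    linear_combination -h0
  rw [this]
  exact J.mul_mem_right _ h

/-- Where `Z` vanishes, the cubic makes `X³` and hence `X` vanish. The coordinates have no common
zero, so `Y` does not vanish: the charts `Z ≠ 0` and `Y ≠ 0` cover. -/
theorem mem_range_chartι_one {w : hypersurface W} (h : w ∉ Set.range (chartι W 2)) :
    w ∈ Set.range (chartι W 1) := by
  rw [mem_range_chartι, not_not] at h
  rw [mem_range_chartι]
  intro h1
  let w' : ProjectiveSpectrum (grading W) := w
  have h0 : coordVar W 0 ∈ w'.asHomogeneousIdeal.toIdeal :=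
    w'.isPrime.mem_of_pow_mem 3 (coordVar_cube_mem W _ h)
  have hsp : Ideal.span (Set.range (coordVar W)) ≤ w'.asHomogeneousIdeal.toIdeal := by
    rw [Ideal.span_le]
    rintro _ ⟨j, rfl⟩
    fin_cases j
    exacts [h0, h1, h]
  have htop := Proj.iSup_basicOpen_eq_top (grading W) (coordVar W) (by
    classical
    intro z hz
    rw [← DirectSum.sum_support_decompose (grading W) z]
    refine Ideal.sum_mem _ fun n hn => ?_
    rcases Nat.eq_zero_or_pos n with rfl | hn'
    · have := (HomogeneousIdeal.mem_irrelevant_iff _ _).mp hz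
      rw [GradedRing.proj_apply] at this
      rw [this]
      exact Ideal.zero_mem _
    · exact span_coordVar_of_mem W hn' (SetLike.coe_mem _))
  obtain ⟨j, hj⟩ := Opens.mem_iSup.mp
    (htop.ge (show w' ∈ (⊤ : (Proj (grading W)).Opens) from trivial))
  exact hj (hsp (Ideal.subset_span ⟨j, rfl⟩))

theorem chartVar_mem_of_notMem_range {q : PrimeSpectrum (ChartRing W 1)}
    (h : chartι W 1 q ∉ Set.range (chartι W 2)) : chartVar W 1 2 ∈ q.asIdeal := by
  have hpre := Proj.awayι_preimage_basicOpen (grading W) (coordVar_mem W 1) one_pos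
    (coordVar_mem W 2) one_pos
  by_contra hq
  apply h
  rw [mem_range_chartι]
  have : q ∈ PrimeSpectrum.basicOpen
      (Away.isLocalizationElem (coordVar_mem W 1) (coordVar_mem W 2)) := by
    rw [PrimeSpectrum.mem_basicOpen]
    convert hq
    exact val_injective _ (by simp [Away.isLocalizationElem, chartVar, Away.val_mk])
  exact hpre.ge this

instance finitePresentation_chartRing {K : Type u} [CommRing K] [IsNoetherianRing K] [Algebra K A]
    [Algebra.FiniteType K A] (j : Fin 3) : Algebra.FinitePresentation K (ChartRing W j) := by
  have : Algebra.FiniteType K (ChartRing W j) :=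
    Algebra.FiniteType.of_surjective
      ({ chartEval W j with
        commutes' := fun c => by
          change chartEval W j (C (algebraMap K A c)) = _
          simp [chartEval]
          rfl } : MvPolynomial (Fin 3) A →ₐ[K] ChartRing W j) (chartEval_surjective W j)
  exact Algebra.FinitePresentation.of_finiteType.mp this

end

variable {K A : Type u} [Field K] [PerfectField K] [CommRing A] [Algebra K A] [IsDomain A]
  [Algebra.Smooth K A] (W : WeierstrassCurve A) {B : Type u} [CommRing B] [IsLocalRing B]
  [Algebra A B]

/-- A bad lift produces a non-smooth point in the chart `Z ≠ 0`; without one, every point of that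
chart above `𝔭` is smooth. The remaining points lie at infinity, where smoothness is automatic.
Finiteness of the residue field supplies the perfectness needed for rationality of singular points.
-/
theorem forall_isSmoothAt_toSpec_iff (𝔭 : PrimeSpectrum A) [IsLocalization.AtPrime B 𝔭.asIdeal]
    {p : ℕ} [Fact p.Prime] [CharP K p] [Finite (ResidueField B)] (hW : W.IsNormalForm p) :
    (∀ w, toSpec W w = 𝔭 →
      IsSmoothAt (toSpec W ≫ Spec.map (CommRingCat.ofHom (algebraMap K A))) w) ↔
    ¬ (W.map (algebraMap A B)).IsSingularModSq := by
  let _ : Algebra K B := ((algebraMap A B).comp (algebraMap K A)).toAlgebra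
  have : IsScalarTower K A B := IsScalarTower.of_algebraMap_eq fun _ => rfl
  have : Algebra.FormallySmooth A B := .of_isLocalization 𝔭.asIdeal.primeCompl
  have : Algebra.FormallySmooth K B := .comp K A B
  have : Algebra.EssFiniteType A B := .of_isLocalization _ 𝔭.asIdeal.primeCompl
  have : Algebra.EssFiniteType K B := .comp K A B
  have : Algebra.EssFiniteType K (ResidueField B) := inferInstance
  have : Algebra.FormallySmooth K (ResidueField B) := inferInstance
  have : CharP (ResidueField B) p :=
    charP_of_injective_ringHom (algebraMap K (ResidueField B)).injective p
  have : ExpChar (ResidueField B) p := .prime Fact.out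
  have : PerfectRing (ResidueField B) p := inferInstance
  have hcomap : (maximalIdeal B).comap (algebraMap A B) = 𝔭.asIdeal :=
    IsLocalization.AtPrime.under_maximalIdeal B 𝔭.asIdeal
  have hchart (j : Fin 3) : chartι W j ≫ toSpec W ≫ Spec.map (CommRingCat.ofHom (algebraMap K A)) =
      Spec.map (CommRingCat.ofHom (algebraMap K (ChartRing W j))) := by
    rw [← Category.assoc, chartι_toSpec, ← Spec.map_comp]
    rfl
  have hover (j : Fin 3) (q : PrimeSpectrum (ChartRing W j)) : toSpec W (chartι W j q) =
      PrimeSpectrum.comap (chartBase W j) q := by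
    refine (Scheme.Hom.comp_apply (chartι W j) (toSpec W) q).symm.trans ?_
    rw [chartι_toSpec]
    rfl
  constructor
  · intro h hs
    have : IsLocalization.AtPrime B ((maximalIdeal B).comap (algebraMap A B)) := by
      simpa only [hcomap]
    obtain ⟨ψ, q, hq, hψ, hψA, hns⟩ := exists_not_isSmoothAt_of_isSingularModSq (K := K) W hs
    refine hns ((isSmoothAt_iff_of_isOpenImmersion (chartι W 2) _ (hchart 2) ⟨q, hq⟩).mp (h _ ?_))
    rw [hover]
    refine PrimeSpectrum.ext (Ideal.ext fun a => ?_)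
    rw [← hcomap]
    change chartBase W 2 a ∈ q ↔ algebraMap A B a ∈ maximalIdeal B
    rw [← hψ, ← residue_eq_zero_iff, ← hψA]
    rfl
  · intro hns w hw
    by_cases hw2 : w ∈ Set.range (chartι W 2)
    · obtain ⟨q, rfl⟩ := hw2
      let q' : PrimeSpectrum (ChartRing W 2) := q
      refine (isSmoothAt_iff_of_isOpenImmersion (chartι W 2) _ (hchart 2) q').mpr ?_
      replace hw := (hover 2 q').symm.trans hw
      let ψ : ChartRing W 2 →ₐ[K] q'.asIdeal.ResidueField := IsScalarTower.toAlgHom K _ _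
      have hψ : RingHom.ker ψ = q'.asIdeal := Ideal.ker_algebraMap_residueField q'.asIdeal
      have hmem (a : A) : ψ (chartBase W 2 a) = 0 ↔ a ∈ 𝔭.asIdeal := by
        rw [← RingHom.mem_ker, hψ, ← hw]
        rfl
      have hunit (a : 𝔭.asIdeal.primeCompl) : IsUnit ((ψ.toRingHom.comp (chartBase W 2)) a) := by
        rw [isUnit_iff_ne_zero]
        exact fun h0 => a.2 ((hmem a).mp h0)
      let Φ : B →+* q'.asIdeal.ResidueField := IsLocalization.lift hunit
      have hΦ (a : A) : Φ (algebraMap A B a) = ψ (chartBase W 2 a) := IsLocalization.lift_eq _ _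
      -- The kernel of `A → κ(q')` is exactly `𝔭`, so `Φ` is local and induces the map of residue
      -- fields needed for the criterion.
      have : IsLocalHom Φ := by
        refine ⟨fun b hb => ?_⟩
        obtain ⟨a, s, rfl⟩ := IsLocalization.exists_mk'_eq 𝔭.asIdeal.primeCompl b
        rw [IsLocalization.AtPrime.isUnit_mk'_iff B 𝔭.asIdeal]
        intro ha
        have h0 : Φ (IsLocalization.mk' B a s) * Φ (algebraMap A B s) = 0 := by
          rw [← map_mul, IsLocalization.mk'_spec, hΦ, (hmem a).mpr ha]
        exact hunit s |>.ne_zero ((hΦ s).symm.trans ((mul_eq_zero.mp h0).resolve_left hb.ne_zero))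
      exact isSmoothAt_of_not_isSingularModSq W (p := p) hW hns ψ q'.asIdeal hψ
        (ResidueField.lift Φ) (fun a => (hΦ a).symm)
    · obtain ⟨q, rfl⟩ := mem_range_chartι_one W hw2
      let q' : PrimeSpectrum (ChartRing W 1) := q
      refine (isSmoothAt_iff_of_isOpenImmersion (chartι W 1) _ (hchart 1) q').mpr ?_
      let ψ : ChartRing W 1 →ₐ[K] q'.asIdeal.ResidueField := IsScalarTower.toAlgHom K _ _
      have hψ : RingHom.ker ψ = q'.asIdeal := Ideal.ker_algebraMap_residueField q'.asIdeal
      refine isSmoothAt_infinity W ψ q'.asIdeal hψ ?_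
      rw [← RingHom.mem_ker, hψ]
      exact chartVar_mem_of_notMem_range W hw2

end WeierstrassScheme

/-! ### The criterion at a point of the base variety -/

section Above

variable {K : Type u} [Field K] [PerfectField K] {V : Scheme.{u}} [IsIntegral V]
  (f : V ⟶ Spec (.of K)) [Smooth f]

theorem forall_isSmoothAt_iff {U : V.Opens} (hU : IsAffineOpen U) {P : V} (hP : P ∈ U) {p : ℕ}
    [Fact p.Prime] [CharP K p] [Finite (IsLocalRing.ResidueField (V.presheaf.stalk P))]
    (W : WeierstrassCurve Γ(V, U)) (hW : W.IsNormalForm p) :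
    (∀ w, (WeierstrassScheme.toSpec W ≫ hU.fromSpec) w = P →
      IsSmoothAt ((WeierstrassScheme.toSpec W ≫ hU.fromSpec) ≫ f) w) ↔
    ¬ (W.map (V.presheaf.germ U P hP).hom).IsSingularModSq := by
  let φ := Spec.preimage (hU.fromSpec ≫ f)
  have hφ : Spec.map φ = hU.fromSpec ≫ f := Spec.map_preimage _
  have hsm : Smooth (Spec.map φ) := by
    rw [hφ]
    infer_instance
  let _ : Algebra K Γ(V, U) := φ.hom.toAlgebra
  have : Algebra.Smooth K Γ(V, U) :=
    RingHom.smooth_algebraMap.mp ((HasRingHomProperty.Spec_iff (P := @Smooth)).mp hsm)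
  have : Nonempty U := ⟨⟨P, hP⟩⟩
  let _ : Algebra Γ(V, U) (V.presheaf.stalk P) := (V.presheaf.germ U P hP).hom.toAlgebra
  have : IsLocalization.AtPrime (V.presheaf.stalk P) (hU.primeIdealOf ⟨P, hP⟩).asIdeal :=
    hU.isLocalization_stalk ⟨P, hP⟩
  have key := WeierstrassScheme.forall_isSmoothAt_toSpec_iff (K := K)
    (B := V.presheaf.stalk P) W (hU.primeIdealOf ⟨P, hP⟩) hW
  have hφ' : Spec.map (CommRingCat.ofHom (algebraMap K Γ(V, U))) = hU.fromSpec ≫ f := hφ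
  rw [hφ'] at key
  refine Iff.trans (forall_congr' fun w => ?_) key
  rw [Category.assoc, Scheme.Hom.comp_apply]
  have : hU.fromSpec (WeierstrassScheme.toSpec W w) = P ↔
      WeierstrassScheme.toSpec W w = hU.primeIdealOf ⟨P, hP⟩ := by
    refine Iff.trans ?_ hU.fromSpec.isOpenEmbedding.injective.eq_iff
    exact iff_of_eq (congrArg _ (hU.fromSpec_primeIdealOf ⟨P, hP⟩).symm)
  rw [this]

end Above

/-! ### Local rings inside the function field, and cocycles of rational functions -/

section FunctionField

variable {V : Scheme.{u}} [IsIntegral V]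

/-- The local ring at `x`, as a subring of the function field. -/
def stalkSubring (x : V) : Subring V.functionField :=
  (algebraMap (V.presheaf.stalk x) V.functionField).range

/-- The units of the local ring at `x`, as elements of the function field. -/
def stalkUnits (x : V) : Submonoid V.functionField :=
  (IsUnit.submonoid (V.presheaf.stalk x)).map (algebraMap (V.presheaf.stalk x) V.functionField)

theorem stalkUnits_le (x : V) {g : V.functionField} (h : g ∈ stalkUnits x) :
    g ∈ stalkSubring x := by
  obtain ⟨c, -, rfl⟩ := h
  exact ⟨c, rfl⟩

theorem stalkUnits_ne_zero (x : V) {g : V.functionField} (h : g ∈ stalkUnits x) : g ≠ 0 := by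
  obtain ⟨c, hc, rfl⟩ := h
  exact (IsUnit.map (algebraMap (V.presheaf.stalk x) V.functionField) hc).ne_zero

theorem stalkUnits_inv (x : V) {g : V.functionField} (h : g ∈ stalkUnits x) :
    g⁻¹ ∈ stalkUnits x := by
  have h0 := stalkUnits_ne_zero x h
  obtain ⟨_, ⟨c, rfl⟩, rfl⟩ := h
  refine ⟨↑c⁻¹, c⁻¹.isUnit, ?_⟩
  refine eq_inv_of_mul_eq_one_left ?_
  rw [← map_mul, Units.inv_mul, map_one]

theorem algebraMap_mem_stalkUnits_iff (x : V) (c : V.presheaf.stalk x) :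
    algebraMap _ V.functionField c ∈ stalkUnits x ↔ IsUnit c := by
  refine ⟨?_, fun h => ⟨c, h, rfl⟩⟩
  rintro ⟨d, hd, h⟩
  rwa [← IsFractionRing.injective (V.presheaf.stalk x) V.functionField h]

theorem germToFunctionField_mem {U : V.Opens} [Nonempty U] {x : V} (hx : x ∈ U) (c : Γ(V, U)) :
    V.germToFunctionField U c ∈ stalkSubring x :=
  ⟨V.presheaf.germ U x hx c, V.algebraMap_germ_eq_germToFunctionField hx c⟩

theorem germToFunctionField_mem_stalkUnits_iff {U : V.Opens} [Nonempty U] {x : V} (hx : x ∈ U)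
    (c : Γ(V, U)) : V.germToFunctionField U c ∈ stalkUnits x ↔ x ∈ V.basicOpen c := by
  rw [V.mem_basicOpen c x hx, ← algebraMap_mem_stalkUnits_iff,
    V.algebraMap_germ_eq_germToFunctionField hx c]

theorem genericPoint_mem (U : V.Opens) [h : Nonempty U] : genericPoint V ∈ U :=
  ((genericPoint_spec V).mem_open_set_iff U.isOpen).mpr (by simpa using h)

instance nonempty_inf (U U' : V.Opens) [Nonempty U] [Nonempty U'] : Nonempty (U ⊓ U' : V.Opens) :=
  ⟨⟨genericPoint V, genericPoint_mem U, genericPoint_mem U'⟩⟩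

theorem germToFunctionField_map {U U' : V.Opens} [Nonempty U] [Nonempty U'] (h : U' ≤ U)
    (c : Γ(V, U)) : V.germToFunctionField U' (V.presheaf.map (homOfLE h).op c) =
      V.germToFunctionField U c :=
  V.presheaf.germ_res_apply (homOfLE h) _ _ c

theorem exists_section_of_mem_stalkSubring {x : V} {g : V.functionField}
    (hg : g ∈ stalkSubring x) : ∃ (U : V.Opens) (_ : x ∈ U) (_ : Nonempty U) (c : Γ(V, U)),
      V.germToFunctionField U c = g := by
  obtain ⟨b, rfl⟩ := hg
  obtain ⟨U, hU, c, rfl⟩ := V.presheaf.exists_germ_eq b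
  have : Nonempty U := ⟨⟨x, hU⟩⟩
  exact ⟨U, hU, this, c, (V.algebraMap_germ_eq_germToFunctionField hU c).symm⟩

/-- On an integral scheme, functions on `U` are the intersection of the local rings: local
representatives agree on overlaps because they agree in the function field, and hence glue. -/
theorem exists_section_of_forall_mem {U : V.Opens} [Nonempty U] {g : V.functionField}
    (hg : ∀ x ∈ U, g ∈ stalkSubring x) : ∃ c : Γ(V, U), V.germToFunctionField U c = g := by
  have (x : U) : ∃ (U' : V.Opens) (_ : x.1 ∈ U') (_ : U' ≤ U) (_ : Nonempty U') (c : Γ(V, U')),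
      V.germToFunctionField U' c = g := by
    obtain ⟨U', hx, hne, c, hc⟩ := exists_section_of_mem_stalkSubring (hg x x.2)
    exact ⟨U' ⊓ U, ⟨hx, x.2⟩, inf_le_right, inferInstance,
      V.presheaf.map (homOfLE inf_le_left).op c, by rw [germToFunctionField_map, hc]⟩
  choose W hxW hWU hWne c hc using this
  obtain ⟨s, hs, -⟩ := V.sheaf.existsUnique_gluing' W U (fun x => homOfLE (hWU x))
    (fun x hx => Opens.mem_iSup.mpr ⟨⟨x, hx⟩, hxW _⟩) c (by
      intro x y
      have : Nonempty (W x ⊓ W y : V.Opens) := inferInstance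
      apply V.germToFunctionField_injective (W x ⊓ W y)
      refine (germToFunctionField_map inf_le_left (c x)).trans ?_
      refine Eq.trans ?_ (germToFunctionField_map inf_le_right (c y)).symm
      rw [hc, hc])
  refine ⟨s, ?_⟩
  obtain ⟨x⟩ := ‹Nonempty U›
  have := hWne x
  have h1 := germToFunctionField_map (hWU x) s
  rw [← h1, ← hc x]
  exact congrArg _ (hs x)

/-- Local generators of an invertible subsheaf of the constant sheaf of rational functions. -/
structure IsCocycle (t : V → V.functionField) : Prop where
  ne_zero : ∀ x, t x ≠ 0
  locally_const : ∀ x, ∃ U : V.Opens, x ∈ U ∧ ∀ y ∈ U, t x / t y ∈ stalkUnits y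

/-- The sections of the `n`-th power of the invertible sheaf `x ↦ 𝒪_x · (t x)⁻¹`. -/
def cocycleSections (t : V → V.functionField) (n : ℕ) : AddSubgroup V.functionField where
  carrier := {φ | ∀ x, t x ^ n * φ ∈ stalkSubring x}
  zero_mem' x := by simp [zero_mem]
  add_mem' hφ hψ x := by
    rw [mul_add]
    exact add_mem (hφ x) (hψ x)
  neg_mem' hφ x := by
    rw [mul_neg]
    exact neg_mem (hφ x)

end FunctionField

/-! ### Frames of a line bundle -/

section Frames

variable {V : Scheme.{u}} {L : V.Modules}

theorem IsFrame.map {U U' : V.Opens} {e : Γ(L, U)} (he : IsFrame L e) (h : U' ≤ U) :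
    IsFrame L (L.presheaf.map (homOfLE h).op e) := by
  intro U'' h'
  convert he U'' (h'.trans h) using 3
  rw [← ConcreteCategory.comp_apply, ← Functor.map_comp]
  rfl

theorem presheaf_map_map {U U' U'' : V.Opens} (h : U' ≤ U) (h' : U'' ≤ U') (e : Γ(L, U)) :
    L.presheaf.map (homOfLE h').op (L.presheaf.map (homOfLE h).op e) =
      L.presheaf.map (homOfLE (h'.trans h)).op e := by
  rw [← ConcreteCategory.comp_apply, ← Functor.map_comp]
  rfl

theorem presheaf_map_self {U : V.Opens} (e : Γ(L, U)) :
    L.presheaf.map (homOfLE (le_refl U)).op e = e := by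
  have : (homOfLE (le_refl U)).op = 𝟙 _ := rfl
  rw [this, CategoryTheory.Functor.map_id]
  rfl

theorem IsFrame.bijective {U : V.Opens} {e : Γ(L, U)} (he : IsFrame L e) :
    Function.Bijective fun r : Γ(V, U) => r • e := by
  have := he U le_rfl
  rwa [presheaf_map_self] at this

theorem IsFrame.exists_isUnit {U : V.Opens} {e e' : Γ(L, U)} (he : IsFrame L e)
    (he' : IsFrame L e') : ∃ r : Γ(V, U), IsUnit r ∧ e' = r • e := by
  obtain ⟨r, hr⟩ := he.bijective.2 e'
  obtain ⟨r', hr'⟩ := he'.bijective.2 e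
  refine ⟨r, IsUnit.of_mul_eq_one r' ?_, hr.symm⟩
  apply he.bijective.1
  dsimp only at hr hr' ⊢
  rw [mul_comm, mul_smul, hr, hr', one_smul]

theorem map_smul_map {U₀ U : V.Opens} {e₀ : Γ(L, U₀)} {e : Γ(L, U)} {W W' : V.Opens}
    (hW : W ≤ U₀) (h : W ≤ U) (h' : W' ≤ W) {r : Γ(V, W)}
    (hr : L.presheaf.map (homOfLE hW).op e₀ = r • L.presheaf.map (homOfLE h).op e) :
    L.presheaf.map (homOfLE (h'.trans hW)).op e₀ =
      V.presheaf.map (homOfLE h').op r • L.presheaf.map (homOfLE (h'.trans h)).op e := by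
  rw [← presheaf_map_map hW h', hr, Scheme.Modules.map_smul, presheaf_map_map]

end Frames

/-! ### Sections of powers of a line bundle as rational functions -/

section Transition

variable {V : Scheme.{u}} [IsIntegral V] {L : V.Modules}

/-- `t` is the germ at the generic point of the function `r` with `e₀ = r • e`. -/
def IsTransition {U₀ U : V.Opens} (e₀ : Γ(L, U₀)) (e : Γ(L, U)) (t : V.functionField) : Prop :=
  ∃ (W : V.Opens) (_ : Nonempty W) (h₀ : W ≤ U₀) (h : W ≤ U) (r : Γ(V, W)),
    L.presheaf.map (homOfLE h₀).op e₀ = r • L.presheaf.map (homOfLE h).op e ∧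
      V.germToFunctionField W r = t

variable {U₀ U : V.Opens} {e₀ : Γ(L, U₀)} {e : Γ(L, U)}

theorem exists_isTransition [Nonempty U₀] [Nonempty U] (he : IsFrame L e) :
    ∃ t, IsTransition e₀ e t := by
  obtain ⟨r, hr⟩ := (he (U₀ ⊓ U) inf_le_right).2 (L.presheaf.map (homOfLE inf_le_left).op e₀)
  exact ⟨_, U₀ ⊓ U, inferInstance, inf_le_left, inf_le_right, r, hr.symm, rfl⟩

theorem IsTransition.unique (he : IsFrame L e) {t t' : V.functionField} (h : IsTransition e₀ e t)
    (h' : IsTransition e₀ e t') : t = t' := by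
  obtain ⟨W, _, hW₀, hW, r, hr, rfl⟩ := h
  obtain ⟨W', _, hW₀', hW', r', hr', rfl⟩ := h'
  rw [← germToFunctionField_map (inf_le_left (a := W) (b := W')) r,
    ← germToFunctionField_map (inf_le_right (a := W) (b := W')) r']
  congr 1
  apply (he (W ⊓ W') (inf_le_left.trans hW)).1
  have h1 := map_smul_map hW₀ hW (inf_le_left (a := W) (b := W')) hr
  have h2 := map_smul_map hW₀' hW' (inf_le_right (a := W) (b := W')) hr'
  exact h1.symm.trans h2

theorem IsTransition.map {t : V.functionField} (h : IsTransition e₀ e t) {U' : V.Opens}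
    [Nonempty U'] (hU' : U' ≤ U) : IsTransition e₀ (L.presheaf.map (homOfLE hU').op e) t := by
  obtain ⟨W, _, hW₀, hW, r, hr, rfl⟩ := h
  refine ⟨W ⊓ U', inferInstance, inf_le_left.trans hW₀, inf_le_right,
    V.presheaf.map (homOfLE inf_le_left).op r, ?_, germToFunctionField_map _ r⟩
  rw [presheaf_map_map]
  exact map_smul_map hW₀ hW inf_le_left hr

theorem IsTransition.of_smul [Nonempty U] {t : V.functionField} {u : Γ(V, U)}
    (h : IsTransition e₀ (u • e) t) : IsTransition e₀ e (t * V.germToFunctionField U u) := by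
  obtain ⟨W, _, hW₀, hW, r, hr, rfl⟩ := h
  refine ⟨W, inferInstance, hW₀, hW, r * V.presheaf.map (homOfLE hW).op u, ?_, ?_⟩
  · rw [hr, Scheme.Modules.map_smul, mul_smul]
  · rw [map_mul, germToFunctionField_map]

theorem IsTransition.ne_zero (he₀ : IsFrame L e₀) (he : IsFrame L e) {t : V.functionField}
    (h : IsTransition e₀ e t) : t ≠ 0 := by
  obtain ⟨W, _, hW₀, hW, r, hr, rfl⟩ := h
  obtain ⟨r', hu, hr'⟩ := (he.map hW).exists_isUnit (he₀.map hW₀)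
  have : r = r' := (he.map hW).bijective.1 (hr.symm.trans hr')
  rw [this]
  exact (hu.map (V.germToFunctionField W).hom).ne_zero

theorem IsTransition.div_mem_stalkUnits {U' : V.Opens} {e' : Γ(L, U')} (he : IsFrame L e)
    (he' : IsFrame L e') (he₀ : IsFrame L e₀) {t t' : V.functionField} (h : IsTransition e₀ e t)
    (h' : IsTransition e₀ e' t') {x : V} (hx : x ∈ U) (hx' : x ∈ U') :
    t / t' ∈ stalkUnits x := by
  have : Nonempty U := ⟨⟨x, hx⟩⟩
  have : Nonempty U' := ⟨⟨x, hx'⟩⟩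
  obtain ⟨u, hu, heq⟩ := (he.map (inf_le_left (a := U) (b := U'))).exists_isUnit
    (he'.map (inf_le_right (a := U) (b := U')))
  have h1 := h.map (inf_le_left (a := U) (b := U'))
  have h2 := h'.map (inf_le_right (a := U) (b := U'))
  rw [heq] at h2
  rw [h1.unique (he.map _) h2.of_smul, mul_div_cancel_left₀ _ (h'.ne_zero he₀ he'),
    germToFunctionField_mem_stalkUnits_iff (show x ∈ U ⊓ U' from ⟨hx, hx'⟩),
    Scheme.basicOpen_of_isUnit _ hu]
  exact ⟨hx, hx'⟩

/-- If `e₀ = t • e`, then `f₀ e₀^n = (t^n f₀) e^n`. Hence a section is determined by its coordinate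
in one frame. -/
theorem PowSection.coord_eq_of_isTransition [Nonempty U₀] [Nonempty U] {n : ℕ} (s : PowSection L n)
    (he₀ : IsFrame L e₀) (he : IsFrame L e) {t : V.functionField} (h : IsTransition e₀ e t) :
    V.germToFunctionField U (s.coord e he) = t ^ n * V.germToFunctionField U₀ (s.coord e₀ he₀) := by
  obtain ⟨W, _, hW₀, hW, r, hr, rfl⟩ := h
  have key : s.coord _ (he.map hW) = r ^ n * s.coord _ (he₀.map hW₀) := by
    have := s.coord_smul _ (he.map hW) r (by rw [← hr]; exact he₀.map hW₀)
    rw [this]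
    congr 2
    exact hr.symm
  rw [s.map_coord hW e he, s.map_coord hW₀ e₀ he₀] at key
  have := congrArg (V.germToFunctionField W) key
  rwa [map_mul, map_pow, germToFunctionField_map, germToFunctionField_map] at this

/-- The section of the power of a line bundle with given value in the function field. -/
def PowSection.ofFunction {n : ℕ} (τ : ∀ {U : V.Opens} (e : Γ(L, U)), IsFrame L e → V.functionField)
    (hτ : ∀ {U : V.Opens} (e : Γ(L, U)) (he : IsFrame L e), Nonempty U →
      IsTransition e₀ e (τ e he)) (φ : V.functionField)
    (hφ : ∀ {U : V.Opens} [Nonempty U] (e : Γ(L, U)) (he : IsFrame L e),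
      ∃ c : Γ(V, U), V.germToFunctionField U c = τ e he ^ n * φ) : PowSection L n where
  coord {U} e he := open Classical in
    if h : Nonempty U then (hφ e he).choose else 0
  map_coord {U U'} h e he he' := by
    by_cases h' : Nonempty U'
    · have h'' : Nonempty U := ⟨⟨_, h (genericPoint_mem U')⟩⟩
      rw [dif_pos h', dif_pos h'']
      apply V.germToFunctionField_injective U'
      rw [germToFunctionField_map, (hφ e he).choose_spec, (hφ _ he').choose_spec,
        (hτ _ he' h').unique he' ((hτ e he h'').map h)]
    · rw [not_nonempty_iff] at h'
      have : U' = ⊥ := by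
        ext x
        exact ⟨fun hx => (h'.false ⟨x, hx⟩).elim, fun hx => hx.elim⟩
      subst this
      exact Subsingleton.elim _ _
  coord_smul {U} e he u he' := by
    by_cases h : Nonempty U
    · rw [dif_pos h, dif_pos h]
      apply V.germToFunctionField_injective U
      rw [map_mul, map_pow, (hφ e he).choose_spec, (hφ _ he').choose_spec,
        (hτ e he h).unique he ((hτ _ he' h).of_smul)]
      ring
    · rw [dif_neg h, dif_neg h, mul_zero]

theorem PowSection.germ_ofFunction {n : ℕ}
    (τ : ∀ {U : V.Opens} (e : Γ(L, U)), IsFrame L e → V.functionField)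
    (hτ : ∀ {U : V.Opens} (e : Γ(L, U)) (he : IsFrame L e), Nonempty U →
      IsTransition e₀ e (τ e he)) (φ : V.functionField)
    (hφ : ∀ {U : V.Opens} [Nonempty U] (e : Γ(L, U)) (he : IsFrame L e),
      ∃ c : Γ(V, U), V.germToFunctionField U c = τ e he ^ n * φ) [Nonempty U]
      (e : Γ(L, U)) (he : IsFrame L e) : V.germToFunctionField U
        ((PowSection.ofFunction τ hτ φ hφ).coord e he) = τ e he ^ n * φ := by
  have : (PowSection.ofFunction τ hτ φ hφ).coord e he = (hφ e he).choose := dif_pos ‹_›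
  rw [this, (hφ e he).choose_spec]

theorem isTransition_self [Nonempty U₀] : IsTransition e₀ e₀ 1 :=
  ⟨U₀, inferInstance, le_rfl, le_rfl, 1, by rw [one_smul], map_one _⟩

/-- The maps `ι n` identify the sections of the powers of `L` with the sections of the powers of
the invertible sheaf with local generators `t`. -/
structure IsEncoding (t : V → V.functionField) (ι : ∀ n, PowSection L n → V.functionField) :
    Prop where
  isCocycle : IsCocycle t
  injective : ∀ n, Function.Injective (ι n)
  range_eq : ∀ n, Set.range (ι n) = cocycleSections t n
  map_zero : ∀ n, ι n 0 = 0
  exists_unit : ∀ (U : V.Opens) (e : Γ(L, U)) (he : IsFrame L e) (x : V) (hx : x ∈ U),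
    ∃ u : (V.presheaf.stalk x)ˣ, ∀ n (s : PowSection L n),
      algebraMap _ V.functionField (V.presheaf.germ U x hx (s.coord e he)) =
        algebraMap _ V.functionField (u : V.presheaf.stalk x) ^ n * (t x ^ n * ι n s)

/-- Fix a frame `e₀` near the generic point and a frame `e_x` near each `x`. A section is recorded
by its coordinate `φ` in `e₀`, and `t x` is defined by `e₀ = t x • e_x`. The coordinate in `e_x` is
`(t x)^n φ`, so `φ` comes from a global section exactly when all these are regular. Any other frame
at `x` differs from `e_x` by a unit, whence `exists_unit`. -/
theorem exists_isEncoding (hL : IsLineBundle L) :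
    ∃ (t : V → V.functionField) (ι : ∀ n, PowSection L n → V.functionField),
      IsEncoding t ι := by
  classical
  obtain ⟨U₀, e₀, hU₀, he₀⟩ := hL (genericPoint V)
  have : Nonempty U₀ := ⟨⟨_, hU₀⟩⟩
  let τ : ∀ {U : V.Opens} (e : Γ(L, U)), IsFrame L e → V.functionField := fun {U} e he =>
    if h : Nonempty U then (exists_isTransition (e₀ := e₀) he).choose else 1
  have hτ : ∀ {U : V.Opens} (e : Γ(L, U)) (he : IsFrame L e), Nonempty U →
      IsTransition e₀ e (τ e he) := fun {U} e he h => by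
    have : τ e he = (exists_isTransition (e₀ := e₀) he).choose := dif_pos h
    rw [this]
    exact (exists_isTransition (e₀ := e₀) he).choose_spec
  choose Ux ex hxU hex using hL
  have hne (x : V) : Nonempty (Ux x) := ⟨⟨x, hxU x⟩⟩
  have hunit {U : V.Opens} (e : Γ(L, U)) (he : IsFrame L e) (x : V) (hx : x ∈ U) :
      τ e he / τ (ex x) (hex x) ∈ stalkUnits x :=
    (hτ e he ⟨⟨x, hx⟩⟩).div_mem_stalkUnits he (hex x) he₀ (hτ _ (hex x) (hne x)) hx (hxU x)
  have hne0 (x : V) : τ (ex x) (hex x) ≠ 0 := (hτ _ (hex x) (hne x)).ne_zero he₀ (hex x)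
  have hcoord {n : ℕ} (s : PowSection L n) {U : V.Opens} [hU : Nonempty U] (e : Γ(L, U))
      (he : IsFrame L e) : V.germToFunctionField U (s.coord e he) =
        τ e he ^ n * V.germToFunctionField U₀ (s.coord e₀ he₀) :=
    s.coord_eq_of_isTransition he₀ he (hτ e he hU)
  refine ⟨fun x => τ (ex x) (hex x), fun n s => V.germToFunctionField U₀ (s.coord e₀ he₀),
    ⟨hne0, fun x => ⟨Ux x, hxU x, fun y hy => hunit _ (hex x) y hy⟩⟩, fun n s s' h => ?_,
    fun n => Set.Subset.antisymm ?_ fun φ hφ => ?_, fun n => map_zero _, fun U e he x hx => ?_⟩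
  · ext U e he
    by_cases hU : Nonempty U
    · apply V.germToFunctionField_injective U
      dsimp only at h
      rw [hcoord s e he, hcoord s' e he, h]
    · rw [not_nonempty_iff] at hU
      have : U = ⊥ := by
        ext x
        exact ⟨fun hx => (hU.false ⟨x, hx⟩).elim, fun hx => hx.elim⟩
      subst this
      exact Subsingleton.elim _ _
  · rintro _ ⟨s, rfl⟩ x
    have := hne x
    dsimp only
    rw [← hcoord s (ex x) (hex x)]
    exact germToFunctionField_mem (hxU x) _
  · have hφ' {U : V.Opens} [Nonempty U] (e : Γ(L, U)) (he : IsFrame L e) :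
        ∃ c : Γ(V, U), V.germToFunctionField U c = τ e he ^ n * φ := by
      refine exists_section_of_forall_mem fun x hx => ?_
      have := mul_mem (stalkUnits_le x (pow_mem (hunit e he x hx) n)) (hφ x)
      rwa [div_pow, ← mul_assoc, div_mul_cancel₀ _ (pow_ne_zero n (hne0 x))] at this
    refine ⟨PowSection.ofFunction τ hτ φ hφ', ?_⟩
    dsimp only
    rw [PowSection.germ_ofFunction, (hτ e₀ he₀ inferInstance).unique he₀ isTransition_self,
      one_pow, one_mul]
  · obtain ⟨_, ⟨u, rfl⟩, hu⟩ := hunit e he x hx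
    have : Nonempty U := ⟨⟨x, hx⟩⟩
    refine ⟨u, fun n s => ?_⟩
    rw [V.algebraMap_germ_eq_germToFunctionField hx, hcoord]
    have hu' : algebraMap _ V.functionField (u : V.presheaf.stalk x) =
      τ e he / τ (ex x) (hex x) := hu
    rw [hu', ← mul_assoc, div_pow, div_mul_cancel₀ _ (pow_ne_zero n (hne0 x))]

end Transition

/-! ### The degree valuation on rational functions -/

section DegreeValuation

open MvPolynomial

variable (σ K : Type*) [Field K]

/-- The valuation `f ↦ exp (deg f)` on polynomials. -/
def degreeValuation : Valuation (MvPolynomial σ K) (WithZero (Multiplicative ℤ)) := by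
  classical
  exact
  { toFun f := if f = 0 then 0 else WithZero.exp (f.totalDegree : ℤ)
    map_zero' := if_pos rfl
    map_one' := by simp
    map_mul' f g := by
      by_cases hf : f = 0
      · simp [hf]
      by_cases hg : g = 0
      · simp [hg]
      rw [if_neg hf, if_neg hg, if_neg (mul_ne_zero hf hg), totalDegree_mul_of_isDomain hf hg,
        Nat.cast_add, WithZero.exp_add]
    map_add_le_max' f g := by
      by_cases hf : f = 0
      · simp [hf]
      by_cases hg : g = 0
      · simp [hg]
      by_cases hfg : f + g = 0
      · simp [hfg]
      rw [if_neg hf, if_neg hg, if_neg hfg]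
      rcases le_max_iff.mp (totalDegree_add f g) with h | h
      · exact le_max_of_le_left (WithZero.exp_le_exp.mpr (by exact_mod_cast h))
      · exact le_max_of_le_right (WithZero.exp_le_exp.mpr (by exact_mod_cast h)) }

variable {σ K}

theorem degreeValuation_of_ne_zero {f : MvPolynomial σ K} (hf : f ≠ 0) :
    degreeValuation σ K f = WithZero.exp (f.totalDegree : ℤ) := if_neg hf

theorem one_le_degreeValuation {f : MvPolynomial σ K} (hf : f ≠ 0) :
    1 ≤ degreeValuation σ K f := by
  rw [degreeValuation_of_ne_zero hf, ← WithZero.exp_zero, WithZero.exp_le_exp]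
  positivity

theorem totalDegree_le_of_degreeValuation_le {f : MvPolynomial σ K} {N : ℕ}
    (h : degreeValuation σ K f ≤ WithZero.exp (N : ℤ)) : f.totalDegree ≤ N := by
  by_cases hf : f = 0
  · simp [hf]
  · rw [degreeValuation_of_ne_zero hf, WithZero.exp_le_exp] at h
    exact_mod_cast h

variable (σ K) (F₀ : Type*) [Field F₀] [Algebra (MvPolynomial σ K) F₀]
  [IsFractionRing (MvPolynomial σ K) F₀]

/-- The extension of the degree valuation to rational functions. -/
def ratDegreeValuation : Valuation F₀ (WithZero (Multiplicative ℤ)) :=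
  (degreeValuation σ K).extendToLocalization (S := nonZeroDivisors (MvPolynomial σ K))
    (fun f hf h0 => by
      have := one_le_degreeValuation (nonZeroDivisors.ne_zero hf)
      rw [show degreeValuation σ K f = 0 from h0] at this
      exact absurd this (by simp)) F₀

theorem ratDegreeValuation_algebraMap (f : MvPolynomial σ K) :
    ratDegreeValuation σ K F₀ (algebraMap _ F₀ f) = degreeValuation σ K f :=
  Valuation.extendToLocalization_apply_map_apply _ _ _ _

end DegreeValuation

/-! ### Finiteness of sets of integral elements bounded at all valuations -/

section Bounded

open MvPolynomial

theorem degreeValuation_le_of_dvd {σ K : Type*} [Field K] {f g : MvPolynomial σ K} (hg : g ≠ 0)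
    (h : f ∣ g) : degreeValuation σ K f ≤ degreeValuation σ K g := by
  obtain ⟨r, rfl⟩ := h
  rw [map_mul]
  exact le_mul_of_one_le_right' (one_le_degreeValuation (right_ne_zero_of_mul hg))

theorem exists_ratDegreeValuation_le {σ K F₀ : Type*} [Field K] [Field F₀]
    [Algebra (MvPolynomial σ K) F₀] [IsFractionRing (MvPolynomial σ K) F₀] (c : F₀) :
    ∃ g : MvPolynomial σ K, g ≠ 0 ∧ ratDegreeValuation σ K F₀ c ≤ degreeValuation σ K g := by
  obtain ⟨a, s, hs, rfl⟩ := IsFractionRing.div_surjective (A := MvPolynomial σ K) c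
  by_cases ha : a = 0
  · exact ⟨1, one_ne_zero, by simp [ha]⟩
  · refine ⟨a, ha, ?_⟩
    rw [map_div₀, ratDegreeValuation_algebraMap, ratDegreeValuation_algebraMap]
    exact div_le_of_le_mul₀ zero_le zero_le
      (le_mul_of_one_le_right' (one_le_degreeValuation (nonZeroDivisors.ne_zero hs)))

variable {σ K F₀ F : Type*} [Field K] [Field F₀] [Algebra (MvPolynomial σ K) F₀]
  [IsFractionRing (MvPolynomial σ K) F₀] [Field F] [Algebra F₀ F] [Algebra.IsAlgebraic F₀ F]

/-- Dividing `u` by `H` divides the coefficient of index `i` in its monic minimal polynomial of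
degree `d` by `H^(d-i)`. If `H` has at least the degree of every coefficient, the result is integral
over the valuation ring. The free factor `h'` later allows a common denominator for several `u`. -/
theorem exists_isIntegral_div (u : F) : ∃ h : MvPolynomial σ K, h ≠ 0 ∧
    ∀ h' : MvPolynomial σ K, h' ≠ 0 → IsIntegral (ratDegreeValuation σ K F₀).valuationSubring
      (u / algebraMap F₀ F (algebraMap _ F₀ (h * h'))) := by
  let v := ratDegreeValuation σ K F₀
  choose g hg0 hg using exists_ratDegreeValuation_le (σ := σ) (K := K) (F₀ := F₀)
  have hu : IsIntegral F₀ u := Algebra.IsIntegral.isIntegral u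
  set p := minpoly F₀ u
  let h := ∏ i ∈ Finset.range p.natDegree, g (p.coeff i)
  refine ⟨h, Finset.prod_ne_zero_iff.mpr fun j _ => hg0 _, fun h' hh' => ?_⟩
  have hH0 : h * h' ≠ 0 := mul_ne_zero (Finset.prod_ne_zero_iff.mpr fun j _ => hg0 _) hh'
  set H : F₀ := algebraMap _ F₀ (h * h')
  have hvH : 1 ≤ v H := by
    rw [ratDegreeValuation_algebraMap]
    exact one_le_degreeValuation hH0
  have hcoeff (i : ℕ) (hi : i < p.natDegree) : v (p.coeff i) ≤ v H := by
    refine (hg _).trans ?_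
    rw [ratDegreeValuation_algebraMap]
    exact degreeValuation_le_of_dvd hH0
      ((Finset.dvd_prod_of_mem _ (Finset.mem_range.mpr hi)).mul_right _)
  have hmonic : (p.scaleRoots H⁻¹).Monic :=
    (Polynomial.monic_scaleRoots_iff _).mpr (minpoly.monic hu)
  have hlift : p.scaleRoots H⁻¹ ∈ Polynomial.lifts (algebraMap v.valuationSubring F₀) := by
    rw [Polynomial.lifts_iff_coeff_lifts]
    intro i
    suffices h : v ((p.scaleRoots H⁻¹).coeff i) ≤ 1 from ⟨⟨_, h⟩, rfl⟩
    rcases lt_trichotomy i p.natDegree with hi | rfl | hi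
    · obtain ⟨k, hk⟩ := Nat.exists_eq_add_of_lt hi
      rw [Polynomial.coeff_scaleRoots, map_mul, map_pow, map_inv₀,
        show p.natDegree - i = k + 1 by omega, pow_succ', ← mul_assoc]
      refine mul_le_one' ?_ (pow_le_one' (inv_le_one_of_one_le₀ hvH) k)
      exact mul_inv_le_one_of_le₀ (hcoeff i hi) zero_le
    · rw [Polynomial.coeff_scaleRoots, Nat.sub_self, pow_zero, mul_one, Polynomial.coeff_natDegree,
        (minpoly.monic hu).leadingCoeff, map_one]
    · rw [Polynomial.coeff_scaleRoots, Polynomial.coeff_eq_zero_of_natDegree_lt hi]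
      simp
  obtain ⟨q, hq, -, hqm⟩ := Polynomial.lifts_and_natDegree_eq_and_monic hlift hmonic
  refine ⟨q, hqm, ?_⟩
  have hz := Polynomial.scaleRoots_aeval_eq_zero (r := H⁻¹) (minpoly.aeval F₀ u)
  rw [← hq, Polynomial.aeval_map_algebraMap, map_inv₀, mul_comm, ← div_eq_mul_inv] at hz
  exact hz

/-- Take a common `h` such that every `u j / h` is integral over the ring of the degree valuation.
Every valuation ring of `F` above that ring contains `b / u j ^ n` for some `j`, hence `b / h^n`,
which is therefore integral. So the minimal polynomial of `b` has polynomial coefficients of bounded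
degree, and over a finite field there are finitely many such polynomials. -/
theorem finite_of_forall_valuationSubring [Finite σ] [Finite K] [FiniteDimensional F₀ F]
    [Algebra (MvPolynomial σ K) F] [IsScalarTower (MvPolynomial σ K) F₀ F]
    [Algebra K F] [IsScalarTower K (MvPolynomial σ K) F] {ι : Type*} [Finite ι] (u : ι → F) (n : ℕ)
    (hu : ∀ j, u j ≠ 0) (S : Set F) (hS : ∀ b ∈ S, IsIntegral (MvPolynomial σ K) b)
    (hval : ∀ b ∈ S, ∀ O : ValuationSubring F, (∀ c : K, algebraMap K F c ∈ O) →
      ∃ j, b / u j ^ n ∈ O) : S.Finite := by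
  classical
  cases nonempty_fintype ι
  let v := ratDegreeValuation σ K F₀
  let O := v.valuationSubring
  choose g hg0 hg using fun j => exists_isIntegral_div (σ := σ) (K := K) (F₀ := F₀) (u j)
  let h := ∏ j, g j
  have hh0 : h ≠ 0 := Finset.prod_ne_zero_iff.mpr fun j _ => hg0 j
  let c : F₀ := algebraMap (MvPolynomial σ K) F₀ h
  have hc0 : c ≠ 0 := by simpa [c] using hh0
  have hint (j : ι) : IsIntegral O (u j / algebraMap F₀ F c) := by
    have := hg j (∏ i ∈ Finset.univ.erase j, g i)
      (Finset.prod_ne_zero_iff.mpr fun j _ => hg0 j)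
    rwa [Finset.mul_prod_erase _ _ (Finset.mem_univ j)] at this
  have key (b : F) (hb : b ∈ S) : IsIntegral O (b / algebraMap F₀ F c ^ n) := by
    by_contra hb'
    have hb'' : b / algebraMap F₀ F c ^ n ∉ (integralClosure O F).toSubring := hb'
    -- An integrally closed subring of a field is an intersection of valuation rings.
    obtain ⟨w, hw, hbw⟩ := Subring.exists_le_valuationSubring_of_isIntegrallyClosedIn hb''
    have hO (x : O) : algebraMap O F x ∈ w := hw (algebraMap_mem (integralClosure O F) x)
    obtain ⟨j, hj⟩ := hval b hb w (fun a => by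
      have hO' : algebraMap (MvPolynomial σ K) F₀ (C a) ∈ O := by
        change v _ ≤ 1
        rw [ratDegreeValuation_algebraMap]
        by_cases ha : a = 0
        · simp [ha]
        · rw [degreeValuation_of_ne_zero (by simpa using ha)]
          simp
      have := hO ⟨_, hO'⟩
      change algebraMap F₀ F (algebraMap (MvPolynomial σ K) F₀ (C a)) ∈ w at this
      rwa [← IsScalarTower.algebraMap_apply, ← algebraMap_eq, ← IsScalarTower.algebraMap_apply]
        at this)
    apply hbw
    have h1 : u j / algebraMap F₀ F c ∈ w := hw (hint j)
    have := mul_mem hj (pow_mem h1 n)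
    rwa [div_pow, div_mul_div_cancel₀ (pow_ne_zero n (hu j))] at this
  let D := Module.finrank F₀ F
  -- The coefficient of index `i` for `b` is `h^(n(d-i))` times an element of valuation at most 1,
  -- where `d ≤ D`.
  let N := h.totalDegree * n * D
  have hfin : {f : MvPolynomial σ K | f.totalDegree ≤ N}.Finite := by
    have : Finite (restrictTotalDegree σ K N) := Module.finite_of_finite K
    refine Set.Finite.subset (Set.toFinite (restrictTotalDegree σ K N : Set (MvPolynomial σ K)))
      fun f hf => ?_
    exact (mem_restrictTotalDegree σ N f).mpr hf
  refine (Polynomial.bUnion_roots_finite (algebraMap (MvPolynomial σ K) F) D hfin).subset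
    fun b hb => ?_
  have hbT := hS b hb
  have e1 : minpoly F₀ b = (minpoly (MvPolynomial σ K) b).map (algebraMap _ F₀) :=
    minpoly.isIntegrallyClosed_eq_field_fractions' F₀ hbT
  set x := b / algebraMap F₀ F c ^ n
  have hx := key b hb
  have e2 : minpoly F₀ x = (minpoly O x).map (algebraMap O F₀) :=
    minpoly.isIntegrallyClosed_eq_field_fractions' F₀ hx
  have hbx : b = c ^ n • x := by
    rw [Algebra.smul_def, map_pow]
    exact (mul_div_cancel₀ b (pow_ne_zero n (by simpa using hc0))).symm
  have e3 : minpoly F₀ b = (minpoly F₀ x).scaleRoots (c ^ n) := by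
    rw [← IsIntegrallyClosed.minpoly_smul (pow_ne_zero n hc0) hx.tower_top, ← hbx]
  have hdeg : (minpoly (MvPolynomial σ K) b).natDegree ≤ D := by
    have : (minpoly F₀ b).natDegree = (minpoly (MvPolynomial σ K) b).natDegree := by
      rw [e1]
      exact (minpoly.monic hbT).natDegree_map _
    rw [← this]
    exact minpoly.natDegree_le b
  simp only [Set.mem_iUnion]
  refine ⟨minpoly (MvPolynomial σ K) b, ⟨hdeg, fun i => ?_⟩, ?_⟩
  · apply totalDegree_le_of_degreeValuation_le
    rw [← ratDegreeValuation_algebraMap σ K F₀, ← Polynomial.coeff_map, ← e1, e3,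
      Polynomial.coeff_scaleRoots, e2, Polynomial.coeff_map, map_mul, map_pow, map_pow,
      ratDegreeValuation_algebraMap, degreeValuation_of_ne_zero hh0]
    refine mul_le_of_le_one_of_le ((minpoly O x).coeff i).2 ?_
    rw [← pow_mul, ← WithZero.exp_nsmul, WithZero.exp_le_exp, nsmul_eq_mul]
    have hd : ((minpoly O x).map (algebraMap O F₀)).natDegree ≤ D := by
      rw [← e2]
      exact minpoly.natDegree_le x
    have : n * (((minpoly O x).map (algebraMap O F₀)).natDegree - i) * h.totalDegree ≤ N := by
      rw [mul_comm, ← mul_assoc]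
      exact Nat.mul_le_mul_left _ ((Nat.sub_le _ _).trans hd)
    exact_mod_cast this
  · have : (minpoly (MvPolynomial σ K) b).map (algebraMap (MvPolynomial σ K) F) ≠ 0 :=
      ((minpoly.monic hbT).map _).ne_zero
    simp [this, Polynomial.eval_map_algebraMap]

end Bounded

/-- Noether normalization makes `B` finite over a polynomial ring and `F` finite over its fraction
field. -/
theorem finite_of_forall_valuationSubring_of_finiteType {K B F : Type*} [Field K] [Finite K]
    [CommRing B] [IsDomain B] [Algebra K B] [Algebra.FiniteType K B] [Field F] [Algebra B F]
    [IsFractionRing B F] [Algebra K F] [IsScalarTower K B F] {ι : Type*} [Finite ι] (u : ι → F)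
    (n : ℕ) (hu : ∀ j, u j ≠ 0) (S : Set F) (hS : ∀ b ∈ S, b ∈ (algebraMap B F).range)
    (hval : ∀ b ∈ S, ∀ O : ValuationSubring F, (∀ c : K, algebraMap K F c ∈ O) →
      ∃ j, b / u j ^ n ∈ O) : S.Finite := by
  obtain ⟨s, g, hinj, hfin⟩ := exists_finite_inj_algHom_of_fg K B
  let T := MvPolynomial (Fin s) K
  let _ : Algebra T B := g.toRingHom.toAlgebra
  have : IsScalarTower K T B := IsScalarTower.of_algebraMap_eq fun c => (g.commutes c).symm
  let _ : Algebra T F := ((algebraMap B F).comp g.toRingHom).toAlgebra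
  have : IsScalarTower T B F := IsScalarTower.of_algebraMap_eq fun c => rfl
  have : IsScalarTower K T F := IsScalarTower.of_algebraMap_eq fun c => by
    rw [IsScalarTower.algebraMap_apply K B F, IsScalarTower.algebraMap_apply K T B,
      ← IsScalarTower.algebraMap_apply T B F]
  have : Module.Finite T B := hfin
  have : FaithfulSMul T B := (faithfulSMul_iff_algebraMap_injective T B).mpr hinj
  have : FaithfulSMul T F := (faithfulSMul_iff_algebraMap_injective T F).mpr
    ((IsFractionRing.injective B F).comp hinj)
  let _ : Algebra (FractionRing T) F := FractionRing.liftAlgebra T F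
  have : IsScalarTower T (FractionRing T) F := FractionRing.isScalarTower_liftAlgebra T F
  have : FiniteDimensional (FractionRing T) F :=
    Module.Finite.of_isLocalization T B (nonZeroDivisors T)
  refine finite_of_forall_valuationSubring (σ := Fin s) (K := K) (F₀ := FractionRing T) u n hu S
    (fun b hb => ?_) hval
  obtain ⟨c, rfl⟩ := hS b hb
  exact (Algebra.IsIntegral.isIntegral (R := T) c).algebraMap

/-! ### Finiteness of global sections on a proper variety -/

section Proper

variable {K : Type u} [Field K] {V : Scheme.{u}} [IsIntegral V] (f : V ⟶ Spec (.of K))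

/-- The embedding of the base field into the function field. -/
def baseToFunctionField : K →+* V.functionField :=
  (Spec.preimage (V.fromSpecStalk (genericPoint V) ≫ f)).hom

theorem SpecMap_baseToFunctionField :
    Spec.map (CommRingCat.ofHom (baseToFunctionField f)) =
      V.fromSpecStalk (genericPoint V) ≫ f :=
  Spec.map_preimage _

/-- By the valuative criterion the generic point extends to `Spec O → V`. Take for `x` the image of
the closed point: its local ring maps to `O` compatibly with the function field. -/
theorem exists_stalkSubring_le [UniversallyClosed f] (O : ValuationSubring V.functionField)
    (hO : ∀ c, baseToFunctionField f c ∈ O) : ∃ x : V, stalkSubring x ≤ O.toSubring := by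
  let κ : K →+* O := (baseToFunctionField f).codRestrict O hO
  let sq : ValuativeCommSq f :=
    { R := O
      K := V.functionField
      i₁ := V.fromSpecStalk (genericPoint V)
      i₂ := Spec.map (CommRingCat.ofHom κ)
      commSq := ⟨by
        rw [← Spec.map_comp]
        exact (SpecMap_baseToFunctionField f).symm⟩ }
  have hex : ValuativeCriterion.Existence f :=
    (UniversallyClosed.eq_valuativeCriterion.le _ _ f ‹_›).1
  obtain ⟨⟨l, hl, -⟩⟩ := (hex sq).exists_lift
  let l' : Spec (.of O) ⟶ V := l
  have hl' : Spec.map (CommRingCat.ofHom (algebraMap O V.functionField)) ≫ l' =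
    V.fromSpecStalk (genericPoint V) := hl
  refine ⟨l' (IsLocalRing.closedPoint O), ?_⟩
  rintro _ ⟨b, rfl⟩
  have h1 := Scheme.Spec_stalkClosedPointTo_fromSpecStalk l'
  have h2 : Spec.map (CommRingCat.ofHom (algebraMap O V.functionField)) ≫
      Spec.map (Scheme.stalkClosedPointTo l') = Spec.map (V.presheaf.stalkSpecializes
        ((genericPoint_spec V).specializes trivial)) := by
    rw [← cancel_mono (V.fromSpecStalk _), Category.assoc, h1, hl',
      Scheme.SpecMap_stalkSpecializes_fromSpecStalk]
  rw [← Spec.map_comp] at h2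
  have h3 := Spec.map_injective h2
  have h4 := congrArg (fun φ => φ.hom b) h3
  change algebraMap _ _ b ∈ O
  have h5 : algebraMap _ V.functionField b =
    algebraMap O V.functionField ((Scheme.stalkClosedPointTo l').hom b) := h4.symm
  rw [h5]
  exact SetLike.coe_mem _

variable [Finite K] {t : V → V.functionField}

/-- On an affine open near the generic point `x₀`, a section `s` becomes the regular function `(t
x₀)^n s`. A valuation ring over the base field contains the local ring of some `x`; if `x` lies in
the member of a finite cover indexed by `j`, then `(t j)^n s` is regular at `x`. Dividing by powers
of the finitely many ratios `t x₀ / t j` thus bounds the section at every valuation. -/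
theorem finite_cocycleSections (f : V ⟶ Spec (.of K)) [IsProper f] (ht : IsCocycle t) (n : ℕ) :
    (cocycleSections t n : Set V.functionField).Finite := by
  choose U hxU hU using ht.locally_const
  let x₀ := genericPoint V
  obtain ⟨_, ⟨U₀, hU₀, rfl⟩, hx₀, hU₀U⟩ :=
    V.isBasis_affineOpens.exists_subset_of_mem_open (hxU x₀) (U x₀).isOpen
  replace hU₀ : IsAffineOpen U₀ := hU₀
  have : Nonempty U₀ := ⟨⟨x₀, hx₀⟩⟩
  have : CompactSpace V := QuasiCompact.compactSpace_of_compactSpace f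
  obtain ⟨J, hJ⟩ := isCompact_univ.elim_finite_subcover (fun x => (U x : Set V))
    (fun x => (U x).isOpen) (fun x _ => Set.mem_iUnion.mpr ⟨x, hxU x⟩)
  let φ := Spec.preimage (hU₀.fromSpec ≫ f)
  have hφ : Spec.map φ = hU₀.fromSpec ≫ f := Spec.map_preimage _
  let _ : Algebra K Γ(V, U₀) := φ.hom.toAlgebra
  have hft : LocallyOfFiniteType (Spec.map φ) := by
    rw [hφ]
    infer_instance
  have : Algebra.FiniteType K Γ(V, U₀) :=
    (HasRingHomProperty.Spec_iff (P := @LocallyOfFiniteType)).mp hft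
  have : IsFractionRing Γ(V, U₀) V.functionField :=
    functionField_isFractionRing_of_isAffineOpen V U₀ hU₀
  let _ : Algebra K V.functionField := (baseToFunctionField f).toAlgebra
  have : IsScalarTower K Γ(V, U₀) V.functionField := by
    refine IsScalarTower.of_algebraMap_eq' ?_
    have : CommRingCat.ofHom (baseToFunctionField f) = φ ≫ V.germToFunctionField U₀ := by
      apply Spec.map_injective
      rw [SpecMap_baseToFunctionField, Spec.map_comp, hφ,
        ← hU₀.fromSpecStalk_eq_fromSpecStalk hx₀, IsAffineOpen.fromSpecStalk, Category.assoc]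
    exact congrArg CommRingCat.Hom.hom this
  have hinj : Function.Injective fun φ : V.functionField => t x₀ ^ n * φ :=
    mul_right_injective₀ (pow_ne_zero n (ht.ne_zero x₀))
  refine Set.Finite.of_finite_image ?_ hinj.injOn
  refine finite_of_forall_valuationSubring_of_finiteType (K := K) (B := Γ(V, U₀))
    (fun j : J => t x₀ / t j) n (fun j => div_ne_zero (ht.ne_zero _) (ht.ne_zero _)) _ ?_ ?_
  · rintro _ ⟨s, hs, rfl⟩
    refine exists_section_of_forall_mem fun y hy => ?_
    have := mul_mem (stalkUnits_le y (pow_mem (hU x₀ y (hU₀U hy)) n)) (hs y)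
    rwa [div_pow, ← mul_assoc, div_mul_cancel₀ _ (pow_ne_zero n (ht.ne_zero y))] at this
  · rintro _ ⟨s, hs, rfl⟩ O hO
    obtain ⟨x, hx⟩ := exists_stalkSubring_le f O hO
    obtain ⟨j, hjJ, hj⟩ : ∃ j ∈ J, x ∈ U j := by
      simpa using hJ (Set.mem_univ x)
    refine ⟨⟨j, hjJ⟩, ?_⟩
    have h1 := mul_mem (stalkUnits_le x (pow_mem (hU j x hj) n)) (hs x)
    rw [div_pow, ← mul_assoc, div_mul_cancel₀ _ (pow_ne_zero n (ht.ne_zero x))] at h1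
    have h2 := hx h1
    have h3 := pow_ne_zero n (ht.ne_zero x₀)
    have h4 : t x₀ ^ n * s / (t x₀ / t j) ^ n = t j ^ n * s := by
      rw [div_pow, div_div_eq_mul_div, mul_assoc, mul_div_cancel_left₀ _ h3, mul_comm]
    exact h4 ▸ h2

end Proper

/-! ### Approximation of germs modulo the square of the maximal ideal -/

theorem exists_algebraMap_sub_mem_sq {A B : Type*} [CommRing A] [CommRing B] [IsLocalRing B]
    [Algebra A B] (𝔭 : Ideal A) [h𝔭 : 𝔭.IsMaximal] [IsLocalization.AtPrime B 𝔭] (b : B) :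
    ∃ a : A, algebraMap A B a - b ∈ IsLocalRing.maximalIdeal B ^ 2 := by
  obtain ⟨a, s, rfl⟩ := IsLocalization.exists_mk'_eq 𝔭.primeCompl b
  obtain ⟨r, hr⟩ := h𝔭.exists_inv s.2
  obtain ⟨m, hm, hrm⟩ := hr
  -- One Newton step: if `r` inverts `s` modulo `𝔭` and `m = 1 - rs`, then `r(2 - sr)s = 1 - m²`.
  refine ⟨a * (r * (2 - s * r)), ?_⟩
  have hmB : algebraMap A B m ∈ IsLocalRing.maximalIdeal B :=
    (IsLocalization.AtPrime.to_map_mem_maximal_iff B 𝔭 m).mpr hm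
  have hm2 : algebraMap A B m ^ 2 ∈ IsLocalRing.maximalIdeal B ^ 2 := Ideal.pow_mem_pow hmB 2
  have hrm' : algebraMap A B m = 1 - algebraMap A B r * algebraMap A B s := by
    rw [← map_mul, ← map_one (algebraMap A B), ← hrm, map_add]
    ring
  have hb : IsLocalization.mk' B a s * algebraMap A B s = algebraMap A B a :=
    IsLocalization.mk'_spec B a s
  have : algebraMap A B (a * (r * (2 - s * r))) - IsLocalization.mk' B a s =
      - (IsLocalization.mk' B a s * algebraMap A B m ^ 2) := by
    rw [hrm']
    simp only [map_mul, map_sub, map_ofNat, ← hb]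
    ring
  rw [this]
  exact neg_mem (Ideal.mul_mem_left _ _ hm2)

theorem exists_section_sub_mem_sq {V : Scheme.{u}} {U : V.Opens} (hU : IsAffineOpen U) {P : V}
    (hPU : P ∈ U) (hP : IsClosed {P}) (b : V.presheaf.stalk P) : ∃ a : Γ(V, U),
      V.presheaf.germ U P hPU a - b ∈ IsLocalRing.maximalIdeal (V.presheaf.stalk P) ^ 2 := by
  let _ : Algebra Γ(V, U) (V.presheaf.stalk P) := (V.presheaf.germ U P hPU).hom.toAlgebra
  have : IsLocalization.AtPrime (V.presheaf.stalk P) (hU.primeIdealOf ⟨P, hPU⟩).asIdeal :=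
    hU.isLocalization_stalk ⟨P, hPU⟩
  have : (hU.primeIdealOf ⟨P, hPU⟩).asIdeal.IsMaximal :=
    hU.primeIdealOf_isMaximal_of_isClosed ⟨P, hPU⟩ hP
  exact exists_algebraMap_sub_mem_sq (hU.primeIdealOf ⟨P, hPU⟩).asIdeal b

/-! ### Sections with prescribed first-order expansions -/

section Ample

variable {V : Scheme.{u}} [IsIntegral V] {t : V → V.functionField}

theorem IsCocycle.pow_mul_mem_iff (ht : IsCocycle t) {x y : V} (h : t x / t y ∈ stalkUnits y)
    (n : ℕ) (g : V.functionField) :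
    t x ^ n * g ∈ stalkSubring y ↔ t y ^ n * g ∈ stalkSubring y := by
  have h0 := pow_ne_zero n (ht.ne_zero y)
  have hx0 := pow_ne_zero n (ht.ne_zero x)
  constructor
  · intro hg
    have := mul_mem (stalkUnits_le y (pow_mem (stalkUnits_inv y h) n)) hg
    rwa [inv_div, div_pow, ← mul_assoc, div_mul_cancel₀ _ hx0] at this
  · intro hg
    have := mul_mem (stalkUnits_le y (pow_mem h n)) hg
    rwa [div_pow, ← mul_assoc, div_mul_cancel₀ _ h0] at this

theorem IsCocycle.pow_mul_mem_stalkUnits_iff (ht : IsCocycle t) {x y : V}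
    (h : t x / t y ∈ stalkUnits y) (n : ℕ) (g : V.functionField) :
    t x ^ n * g ∈ stalkUnits y ↔ t y ^ n * g ∈ stalkUnits y := by
  have h0 := pow_ne_zero n (ht.ne_zero y)
  have hx0 := pow_ne_zero n (ht.ne_zero x)
  constructor
  · intro hg
    have := mul_mem (pow_mem (stalkUnits_inv y h) n) hg
    rwa [inv_div, div_pow, ← mul_assoc, div_mul_cancel₀ _ hx0] at this
  · intro hg
    have := mul_mem (pow_mem h n) hg
    rwa [div_pow, ← mul_assoc, div_mul_cancel₀ _ h0] at this

/-- A function regular where `s` does not vanish lies, on an affine trivialising neighbourhood, in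
the localization at the local equation of `s`; a power of `s` clears its denominator. -/
theorem exists_forall_pow_mul_mem_stalkSubring (ht : IsCocycle t) {a d : ℕ} {s g : V.functionField}
    (hs0 : s ≠ 0) (hs : s ∈ cocycleSections t d)
    (hg : ∀ y, t y ^ d * s ∈ stalkUnits y → t y ^ a * g ∈ stalkSubring y) (x : V) :
    ∃ (U : V.Opens) (k : ℕ), x ∈ U ∧
      ∀ y ∈ U, t y ^ (a + k * d) * (s ^ k * g) ∈ stalkSubring y := by
  obtain ⟨U', hxU', hU'⟩ := ht.locally_const x
  obtain ⟨_, ⟨U, hU, rfl⟩, hxU, hUU'⟩ :=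
    V.isBasis_affineOpens.exists_subset_of_mem_open hxU' U'.isOpen
  replace hU : IsAffineOpen U := hU
  have : Nonempty U := ⟨⟨x, hxU⟩⟩
  have hunit (y : V) (hy : y ∈ U) : t x / t y ∈ stalkUnits y := hU' y (hUU' hy)
  obtain ⟨c, hc⟩ := exists_section_of_forall_mem (U := U) (g := t x ^ d * s) fun y hy =>
    (ht.pow_mul_mem_iff (hunit y hy) d s).mpr (hs y)
  have hc0 : V.germToFunctionField U c ≠ 0 := by
    rw [hc]
    exact mul_ne_zero (pow_ne_zero d (ht.ne_zero x)) hs0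
  have hne : Nonempty (V.basicOpen c) := by
    refine ⟨⟨genericPoint V, ?_⟩⟩
    rw [V.mem_basicOpen c _ (genericPoint_mem U)]
    exact isUnit_iff_ne_zero.mpr hc0
  obtain ⟨h, hh⟩ := exists_section_of_forall_mem (U := V.basicOpen c) (g := t x ^ a * g)
    fun y hy => by
      have hyU : y ∈ U := V.basicOpen_le c hy
      rw [ht.pow_mul_mem_iff (hunit y hyU)]
      apply hg
      rwa [← ht.pow_mul_mem_stalkUnits_iff (hunit y hyU), ← hc,
        germToFunctionField_mem_stalkUnits_iff hyU]
  have := hU.isLocalization_basicOpen c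
  obtain ⟨k, b, hb⟩ := IsLocalization.Away.surj c h
  refine ⟨U, k, hxU, fun y hy => ?_⟩
  rw [← ht.pow_mul_mem_iff (hunit y hy)]
  have hb' := congrArg (V.germToFunctionField (V.basicOpen c)) hb
  have hres (z : Γ(V, U)) : V.germToFunctionField (V.basicOpen c)
    (algebraMap Γ(V, U) Γ(V, V.basicOpen c) z) = V.germToFunctionField U z :=
    germToFunctionField_map (V.basicOpen_le c) z
  rw [map_mul, map_pow, hres, hres, hh, hc] at hb'
  convert germToFunctionField_mem hy b using 1
  rw [← hb']
  ring

theorem exists_pow_mul_mem_cocycleSections [CompactSpace V] (ht : IsCocycle t) {a d : ℕ}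
    {s g : V.functionField} (hs0 : s ≠ 0) (hs : s ∈ cocycleSections t d)
    (hg : ∀ y, t y ^ d * s ∈ stalkUnits y → t y ^ a * g ∈ stalkSubring y) :
    ∃ k₀, ∀ k, k₀ ≤ k → s ^ k * g ∈ cocycleSections t (a + k * d) := by
  choose U k hxU hU using exists_forall_pow_mul_mem_stalkSubring ht hs0 hs hg
  obtain ⟨J, hJ⟩ := isCompact_univ.elim_finite_subcover (fun x => (U x : Set V))
    (fun x => (U x).isOpen) (fun x _ => Set.mem_iUnion.mpr ⟨x, hxU x⟩)
  refine ⟨J.sup k, fun k' hk' x => ?_⟩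
  obtain ⟨j, hjJ, hj⟩ : ∃ j ∈ J, x ∈ U j := by
    simpa using hJ (Set.mem_univ x)
  obtain ⟨i, rfl⟩ := Nat.exists_eq_add_of_le ((Finset.le_sup hjJ).trans hk')
  have := mul_mem (pow_mem (hs x) i) (hU j x hj)
  convert this using 1
  ring

/-- Ampleness of the invertible sheaf with local generators `t`. -/
def IsAmpleCocycle (t : V → V.functionField) : Prop :=
  ∀ x : V, ∃ (n : ℕ) (s : V.functionField) (U : V.Opens), 1 ≤ n ∧ s ∈ cocycleSections t n ∧
    x ∈ U ∧ IsAffineOpen U ∧ ∀ y, y ∈ U ↔ t y ^ n * s ∈ stalkUnits y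

theorem mul_mem_stalkUnits_iff {x : V} {g h : V.functionField} (hg : g ∈ stalkSubring x)
    (hh : h ∈ stalkSubring x) : g * h ∈ stalkUnits x ↔ g ∈ stalkUnits x ∧ h ∈ stalkUnits x := by
  obtain ⟨a, rfl⟩ := hg
  obtain ⟨b, rfl⟩ := hh
  rw [← map_mul, algebraMap_mem_stalkUnits_iff, algebraMap_mem_stalkUnits_iff,
    algebraMap_mem_stalkUnits_iff, IsUnit.mul_iff]

/-- Choose a principal open `D(g)` inside `U` in the affine nonvanishing locus of `s`. A power of
`s` times `g` is a global section, and one further factor `s` makes it vanish off that locus, so its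
nonvanishing set is `D(g)` exactly. -/
theorem IsAmpleCocycle.exists_le [CompactSpace V] (hA : IsAmpleCocycle t) (ht : IsCocycle t)
    {x : V} {U : V.Opens} (hxU : x ∈ U) : ∃ (n : ℕ) (s : V.functionField) (U' : V.Opens), 1 ≤ n ∧
      s ∈ cocycleSections t n ∧ x ∈ U' ∧ U' ≤ U ∧ IsAffineOpen U' ∧
      ∀ y, y ∈ U' ↔ t y ^ n * s ∈ stalkUnits y := by
  obtain ⟨d, s, U₁, hd, hs, hxU₁, hU₁, hsU₁⟩ := hA x
  have : Nonempty U₁ := ⟨⟨x, hxU₁⟩⟩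
  obtain ⟨g, hgU, hxg⟩ := hU₁.exists_basicOpen_le ⟨x, hxU⟩ hxU₁
  have hs0 : s ≠ 0 := right_ne_zero_of_mul (stalkUnits_ne_zero x ((hsU₁ x).mp hxU₁))
  obtain ⟨k, hk⟩ := exists_pow_mul_mem_cocycleSections (a := 0) (g := V.germToFunctionField U₁ g)
    ht hs0 hs fun y hy => by
      rw [pow_zero, one_mul]
      exact germToFunctionField_mem ((hsU₁ y).mpr hy) g
  refine ⟨(k + 1) * d, s ^ (k + 1) * V.germToFunctionField U₁ g, V.basicOpen g,
    Nat.one_le_iff_ne_zero.mpr (by positivity), ?_, hxg, hgU, hU₁.basicOpen g, fun y => ?_⟩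
  · simpa using hk (k + 1) (Nat.le_succ k)
  · have h1 : t y ^ ((k + 1) * d) * (s ^ (k + 1) * V.germToFunctionField U₁ g) =
        (t y ^ d * s) * (t y ^ (0 + k * d) * (s ^ k * V.germToFunctionField U₁ g)) := by
      ring
    by_cases hy : y ∈ U₁
    · have h2 : t y ^ ((k + 1) * d) * (s ^ (k + 1) * V.germToFunctionField U₁ g) =
        (t y ^ d * s) ^ (k + 1) * V.germToFunctionField U₁ g := by ring
      rw [h2, mul_mem_stalkUnits_iff (pow_mem (hs y) _) (germToFunctionField_mem hy g),
        germToFunctionField_mem_stalkUnits_iff hy]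
      exact ⟨fun h => ⟨pow_mem ((hsU₁ y).mp hy) _, h⟩, fun h => h.2⟩
    · rw [h1, mul_mem_stalkUnits_iff (hs y) (hk k le_rfl y), ← hsU₁]
      exact ⟨fun h => (hy (V.basicOpen_le g h)).elim, fun h => (hy h.1).elim⟩

theorem exists_germ_mem_maximalIdeal {x : V} {g : V.functionField} (hg : g ∈ stalkSubring x)
    (hu : g ∉ stalkUnits x) : ∃ b ∈ IsLocalRing.maximalIdeal (V.presheaf.stalk x),
      algebraMap _ V.functionField b = g := by
  obtain ⟨b, rfl⟩ := hg
  rw [algebraMap_mem_stalkUnits_iff] at hu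
  exact ⟨b, hu, rfl⟩

/-- Take `s` of degree `d`, nonzero at `P` and vanishing at the other points of `Z`. Functions on
its affine nonvanishing locus realise every class at `P`; multiplied by high powers of `s` they
become global sections, and two extra factors `s` give vanishing to second order elsewhere. The
degree modulo `d` is absorbed in `g`. -/
theorem IsAmpleCocycle.exists_section_single [CompactSpace V] (hA : IsAmpleCocycle t)
    (ht : IsCocycle t) {Z : Set V} (hZ : Z.Finite) (hZc : ∀ Q ∈ Z, IsClosed {Q}) {P : V}
    (hP : P ∈ Z) [Finite (V.presheaf.stalk P ⧸
      IsLocalRing.maximalIdeal (V.presheaf.stalk P) ^ 2)] :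
    ∃ n₀ : ℕ, ∀ n, n₀ ≤ n → ∀ c : V.presheaf.stalk P, ∃ φ ∈ cocycleSections t n,
      (∃ b, algebraMap _ V.functionField b = t P ^ n * φ ∧
        b - c ∈ IsLocalRing.maximalIdeal (V.presheaf.stalk P) ^ 2) ∧
      ∀ Q ∈ Z, Q ≠ P → ∃ b ∈ IsLocalRing.maximalIdeal (V.presheaf.stalk Q) ^ 2,
        algebraMap _ V.functionField b = t Q ^ n * φ := by
  obtain ⟨U₁, hPU₁, hU₁⟩ := ht.locally_const P
  have hZ' : IsClosed (Z \ {P}) := by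
    have : Z \ {P} = ⋃ Q ∈ Z \ {P}, {Q} := (Set.biUnion_of_singleton _).symm
    rw [this]
    exact (hZ.subset Set.sdiff_subset).isClosed_biUnion fun Q hQ => hZc Q hQ.1
  let U₂ : V.Opens := ⟨(Z \ {P})ᶜ, hZ'.isOpen_compl⟩
  obtain ⟨d, s, U, hd, hs, hPU, hUle, hU, hsU⟩ :=
    hA.exists_le ht (U := U₁ ⊓ U₂) (x := P) ⟨hPU₁, fun h => h.2 rfl⟩
  have : Nonempty U := ⟨⟨P, hPU⟩⟩
  have hs0 : s ≠ 0 := right_ne_zero_of_mul (stalkUnits_ne_zero P ((hsU P).mp hPU))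
  obtain ⟨w, hw, hws⟩ := (hsU P).mp hPU
  replace hws : algebraMap _ V.functionField w = t P ^ d * s := hws
  obtain ⟨w, rfl⟩ := hw
  have hsec (c : V.presheaf.stalk P ⧸ IsLocalRing.maximalIdeal (V.presheaf.stalk P) ^ 2) :
      ∃ a : Γ(V, U), Ideal.Quotient.mk _ (V.presheaf.germ U P hPU a) = c := by
    obtain ⟨b, rfl⟩ := Ideal.Quotient.mk_surjective c
    obtain ⟨a, ha⟩ := exists_section_sub_mem_sq hU hPU (hZc P hP) b
    exact ⟨a, Ideal.Quotient.eq.mpr ha⟩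
  choose e he using hsec
  let g (a : ℕ) (c : V.presheaf.stalk P ⧸ IsLocalRing.maximalIdeal (V.presheaf.stalk P) ^ 2) :
    V.functionField := (t P ^ a)⁻¹ * V.germToFunctionField U (e c)
  have hgP (a : ℕ) (c) : t P ^ a * g a c = V.germToFunctionField U (e c) :=
    mul_inv_cancel_left₀ (pow_ne_zero a (ht.ne_zero P)) _
  choose k hk using fun (a : Fin d) c => exists_pow_mul_mem_cocycleSections (a := a) (g := g a c)
    ht hs0 hs fun y hy => by
      have hyU := (hsU y).mpr hy
      rw [← ht.pow_mul_mem_iff (hU₁ y (hUle hyU).1), hgP]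
      exact germToFunctionField_mem hyU _
  cases nonempty_fintype (V.presheaf.stalk P ⧸
    IsLocalRing.maximalIdeal (V.presheaf.stalk P) ^ 2)
  -- A uniform exponent exists because there are finitely many degrees modulo `d` and finitely many
  -- classes at `P`.
  let k₀ := Finset.univ.sup fun p : Fin d × _ => k p.1 p.2
  have hk₀ (a c) : k a c ≤ k₀ :=
    Finset.le_sup (f := fun p : Fin d × _ => k p.1 p.2) (Finset.mem_univ (a, c))
  refine ⟨d * (k₀ + 2), fun n hn c => ?_⟩
  let a : Fin d := ⟨n % d, Nat.mod_lt n hd⟩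
  obtain ⟨j, hj⟩ : ∃ j, n / d = k₀ + j + 2 := by
    have : k₀ + 2 ≤ n / d := (Nat.le_div_iff_mul_le hd).mpr (by rwa [mul_comm])
    exact ⟨n / d - (k₀ + 2), by omega⟩
  have hnd : n = (a : ℕ) + (k₀ + j + 2) * d := by
    rw [← hj, mul_comm]
    exact (Nat.mod_add_div n d).symm
  -- The target is divided beforehand by the value at `P` of the power of `s` that will multiply it.
  let c' := Ideal.Quotient.mk (IsLocalRing.maximalIdeal (V.presheaf.stalk P) ^ 2)
    (c * ↑(w⁻¹ ^ (k₀ + j + 2)))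
  refine ⟨s ^ (k₀ + j + 2) * g a c', ?_, ⟨w ^ (k₀ + j + 2) * V.presheaf.germ U P hPU (e c'),
    ?_, ?_⟩, fun Q hQ hQP => ?_⟩
  · rw [hnd]
    exact hk a c' _ ((hk₀ a c').trans (by omega))
  · rw [map_mul, map_pow, hws, V.algebraMap_germ_eq_germToFunctionField hPU, ← hgP a c', hnd]
    ring
  · rw [← Ideal.Quotient.eq, map_mul, he, ← map_mul]
    congr 1
    rw [mul_left_comm, ← Units.val_pow_eq_pow_val, ← Units.val_mul, inv_pow, mul_inv_cancel,
      Units.val_one, mul_one]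
  · have hQU : Q ∉ U := fun h => (hUle h).2 ⟨hQ, hQP⟩
    rw [hsU] at hQU
    obtain ⟨b, hb, hbs⟩ := exists_germ_mem_maximalIdeal (hs Q) hQU
    obtain ⟨b', hb'⟩ := hk a c' (k₀ + j) ((hk₀ a c').trans (by omega)) Q
    refine ⟨b ^ 2 * b', Ideal.mul_mem_right _ _ (Ideal.pow_mem_pow hb 2), ?_⟩
    rw [map_mul, map_pow, hbs, hb', hnd]
    ring

/-- Add up the sections for the single points: at each point the others contribute zero modulo the
square of the maximal ideal. -/
theorem IsAmpleCocycle.exists_section [CompactSpace V] (hA : IsAmpleCocycle t)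
    (ht : IsCocycle t) {Z : Set V} (hZ : Z.Finite) (hZc : ∀ Q ∈ Z, IsClosed {Q})
    (hfin : ∀ Q ∈ Z, Finite (V.presheaf.stalk Q ⧸
      IsLocalRing.maximalIdeal (V.presheaf.stalk Q) ^ 2)) :
    ∃ n₀ : ℕ, ∀ n, n₀ ≤ n → ∀ c : ∀ P : V, V.presheaf.stalk P, ∃ φ ∈ cocycleSections t n,
      ∀ P ∈ Z, ∃ b, algebraMap _ V.functionField b = t P ^ n * φ ∧
        b - c P ∈ IsLocalRing.maximalIdeal (V.presheaf.stalk P) ^ 2 := by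
  classical
  have hsingle (P : Z) := by
    have := hfin P P.2
    exact hA.exists_section_single ht hZ hZc P.2
  choose n₀ hn₀ using hsingle
  have := hZ.fintype
  refine ⟨Finset.univ.sup n₀, fun n hn c => ?_⟩
  choose φ hφ hφP hφQ using fun P : Z =>
    hn₀ P n ((Finset.le_sup (Finset.mem_univ P)).trans hn) (c P)
  refine ⟨∑ P, φ P, sum_mem fun P _ => hφ P, fun P hP => ?_⟩
  obtain ⟨b, hb, hbc⟩ := hφP ⟨P, hP⟩
  choose b' hb' hb'φ using fun Q : Z => fun h : (⟨P, hP⟩ : Z) ≠ Q =>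
    hφQ Q P hP fun h' => h (Subtype.ext h')
  let B : Z → V.presheaf.stalk P := fun Q => if h : (⟨P, hP⟩ : Z) ≠ Q then b' Q h else 0
  refine ⟨b + ∑ Q, B Q, ?_, ?_⟩
  · rw [map_add, map_sum, hb, Finset.mul_sum, ← Finset.add_sum_erase _ _
      (Finset.mem_univ (⟨P, hP⟩ : Z)), ← Finset.add_sum_erase _ (fun Q => t P ^ n * φ Q)
      (Finset.mem_univ (⟨P, hP⟩ : Z))]
    have : B ⟨P, hP⟩ = 0 := dif_neg fun h => h rfl
    rw [this, map_zero, zero_add]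
    congr 1
    refine Finset.sum_congr rfl fun Q hQ => ?_
    have hne : (⟨P, hP⟩ : Z) ≠ Q := (Finset.ne_of_mem_erase hQ).symm
    have : B Q = b' Q hne := dif_pos hne
    rw [this, hb'φ]
  · rw [add_sub_right_comm]
    refine add_mem hbc (sum_mem fun Q _ => ?_)
    by_cases h : (⟨P, hP⟩ : Z) ≠ Q
    · have : B Q = b' Q h := dif_pos h
      rw [this]
      exact hb' Q h
    · have : B Q = 0 := dif_neg h
      rw [this]
      exact zero_mem _

end Ample

/-! ### Size of truncated local rings, and finitely many points of small degree -/

section Cardinality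

open IsLocalRing TensorProduct KaehlerDifferential

theorem card_quotient_sq {B : Type*} [CommRing B] (I : Ideal B) :
    Nat.card (B ⧸ I ^ 2) = Nat.card (B ⧸ I) * Nat.card I.Cotangent := by
  have h1 := AddSubgroup.card_eq_card_quotient_mul_card_addSubgroup
    (Submodule.toAddSubgroup I.cotangentIdeal)
  rw [h1]
  congr 1
  · exact Nat.card_congr I.quotCotangent.toEquiv
  · exact Nat.card_congr I.cotangentEquivIdeal.symm.toEquiv

theorem residueField_algebraMap_surjective {A B : Type*} [CommRing A] [CommRing B] [IsLocalRing B]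
    [Algebra A B] (𝔭 : Ideal A) [h𝔭 : 𝔭.IsMaximal] [IsLocalization.AtPrime B 𝔭] :
    Function.Surjective ((residue B).comp (algebraMap A B)) := by
  intro z
  obtain ⟨b, rfl⟩ := residue_surjective z
  obtain ⟨a, ha⟩ := exists_algebraMap_sub_mem_sq 𝔭 b
  refine ⟨a, ?_⟩
  rw [RingHom.comp_apply, ← sub_eq_zero, ← map_sub, residue_eq_zero_iff]
  exact Ideal.pow_le_self two_ne_zero ha

variable {K A B : Type*} [Field K] [CommRing A] [Algebra K A]
  [CommRing B] [IsLocalRing B] [Algebra A B] [Algebra K B] [IsScalarTower K A B]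

theorem finite_residueField_of_isMaximal [Algebra.FiniteType K A] (𝔭 : Ideal A) [𝔭.IsMaximal]
    [IsLocalization.AtPrime B 𝔭] : Module.Finite K (ResidueField B) := by
  have : Algebra.FiniteType K (ResidueField B) :=
    Algebra.FiniteType.of_surjective (IsScalarTower.toAlgHom K A (ResidueField B))
      (residueField_algebraMap_surjective (B := B) 𝔭)
  exact finite_of_finite_type_of_isJacobsonRing K (ResidueField B)

variable [Finite K]

/-- The residue field is étale over the finite field `K`, so `𝔪/𝔪²` is isomorphic to the
differentials at the point, of dimension `m`. Together with `B/𝔪` this gives `m + 1` factors of the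
size of the residue field. -/
theorem card_quotient_maximalIdeal_sq (m : ℕ) [Algebra.IsStandardSmoothOfRelativeDimension m K A]
    (𝔭 : Ideal A) [𝔭.IsMaximal] [IsLocalization.AtPrime B 𝔭] :
    Nat.card (B ⧸ maximalIdeal B ^ 2) =
      Nat.card K ^ ((m + 1) * Module.finrank K (ResidueField B)) := by
  have : Algebra.IsStandardSmooth K A :=
    Algebra.IsStandardSmoothOfRelativeDimension.isStandardSmooth m
  have : Module.Finite K (ResidueField B) := finite_residueField_of_isMaximal 𝔭
  have : Nontrivial A := (algebraMap A B).domain_nontrivial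
  have : Algebra.FormallyEtale A B := .of_isLocalization 𝔭.primeCompl
  have : Algebra.FormallySmooth K B := .comp K A B
  have hΩ := tensorKaehlerEquivOfFormallyEtale K A B
  have : Module.Free B Ω[B⁄K] := .of_equiv hΩ
  have : Module.Finite B Ω[B⁄K] := .equiv hΩ
  have hrank : Module.finrank B Ω[B⁄K] = m := by
    rw [← hΩ.finrank_eq, Module.finrank_baseChange, Module.finrank,
      Algebra.IsStandardSmoothOfRelativeDimension.rank_kaehlerDifferential m, Cardinal.toNat_natCast]
  have hsurj : Function.Surjective (algebraMap B (ResidueField B)) := residue_surjective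
  have : Algebra.FormallyEtale K (ResidueField B) := .of_isSeparable K (ResidueField B)
  have hinj := (Algebra.FormallySmooth.kerCotangentToTensor_injective_iff (R := K) hsurj).mpr
    inferInstance
  have hex := exact_kerCotangentToTensor_mapBaseChange K B (ResidueField B) hsurj
  have : Subsingleton Ω[ResidueField B⁄K] := inferInstance
  have hbij : Function.Bijective (kerCotangentToTensor K B (ResidueField B)) :=
    ⟨hinj, fun z => (hex z).mp (Subsingleton.elim _ _)⟩
  have hcot : Nat.card (maximalIdeal B).Cotangent = Nat.card (ResidueField B) ^ m := by
    have h1 := Nat.card_congr (Equiv.ofBijective _ hbij)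
    rw [show RingHom.ker (algebraMap B (ResidueField B)) = maximalIdeal B from ker_residue] at h1
    rw [h1, Module.natCard_eq_pow_finrank (K := ResidueField B), Module.finrank_baseChange, hrank]
  have hres : Nat.card (ResidueField B) = Nat.card K ^ Module.finrank K (ResidueField B) :=
    Module.natCard_eq_pow_finrank
  rw [card_quotient_sq, hcot, show Nat.card (B ⧸ maximalIdeal B) = Nat.card (ResidueField B) from
    rfl, hres]
  ring

/-- Such a prime is the kernel of a map to the algebraic closure with values in `S`. The map is
determined by the images of finitely many generators, and `S` is finite. -/
theorem finite_setOf_exists_ker_eq [Algebra.FiniteType K A] (r : ℕ) :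
    {𝔭 : PrimeSpectrum A | ∃ (κ : Type u) (_ : Field κ) (_ : Algebra K κ) (g : A →ₐ[K] κ),
      Module.Finite K κ ∧ Module.finrank K κ < r ∧ RingHom.ker g = 𝔭.asIdeal}.Finite := by
  obtain ⟨n, π, hπ⟩ := Algebra.FiniteType.iff_quotient_mvPolynomial''.mp ‹Algebra.FiniteType K A›
  let L := AlgebraicClosure K
  -- The union of the subfields of size `q^d`, `1 ≤ d < r`, cut out by Frobenius.
  let S : Set L := ⋃ d ∈ Finset.Ico 1 r, {z : L | z ^ (Nat.card K ^ d) = z}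
  have hS : S.Finite := by
    refine Set.Finite.biUnion (Finset.finite_toSet _) fun d hd => ?_
    have h2 : 1 < Nat.card K ^ d :=
      Nat.one_lt_pow (by have := (Finset.mem_Ico.mp hd).1; omega) Finite.one_lt_card
    have hne : (Polynomial.X ^ (Nat.card K ^ d) - Polynomial.X : Polynomial L) ≠ 0 :=
      FiniteField.X_pow_card_sub_X_ne_zero L h2
    refine (Polynomial.rootSet_finite (Polynomial.X ^ (Nat.card K ^ d) - Polynomial.X :
      Polynomial L) L).subset fun z hz => ?_
    rw [Polynomial.mem_rootSet]
    exact ⟨hne, by simpa [sub_eq_zero] using hz⟩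
  have key (𝔭 : PrimeSpectrum A) (h𝔭 : ∃ (κ : Type u) (_ : Field κ) (_ : Algebra K κ)
      (g : A →ₐ[K] κ), Module.Finite K κ ∧ Module.finrank K κ < r ∧ RingHom.ker g = 𝔭.asIdeal) :
      ∃ g : A →ₐ[K] L, (∀ a, g a ∈ S) ∧ RingHom.ker g = 𝔭.asIdeal := by
    obtain ⟨κ, _, _, g, hfin, hr, hg⟩ := h𝔭
    have : Finite κ := Module.finite_of_finite K
    cases nonempty_fintype κ
    let σ : κ →ₐ[K] L := IsAlgClosed.lift
    refine ⟨σ.comp g, fun a => ?_, ?_⟩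
    · refine Set.mem_biUnion (x := Module.finrank K κ)
        (Finset.mem_coe.mpr (Finset.mem_Ico.mpr ⟨Module.finrank_pos, hr⟩)) ?_
      change σ (g a) ^ _ = σ (g a)
      rw [← map_pow, ← Module.natCard_eq_pow_finrank, Nat.card_eq_fintype_card,
        FiniteField.pow_card]
    · rw [← hg]
      ext a
      simp [RingHom.mem_ker]
  refine Set.Finite.of_finite_image (f := fun 𝔭 => open Classical in
    if h : ∃ g : A →ₐ[K] L, (∀ a, g a ∈ S) ∧ RingHom.ker g = 𝔭.asIdeal then
      fun i => h.choose (π (MvPolynomial.X i)) else fun _ => 0) ?_ ?_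
  · refine (Set.Finite.pi (t := fun _ : Fin n => S) fun _ => hS).subset ?_
    rintro _ ⟨𝔭, h𝔭, rfl⟩ i -
    have h := key 𝔭 h𝔭
    simp only [dif_pos h]
    exact h.choose_spec.1 _
  · intro 𝔭 h𝔭 𝔮 h𝔮 heq
    have h1 := key 𝔭 h𝔭
    have h2 := key 𝔮 h𝔮
    simp only [dif_pos h1, dif_pos h2] at heq
    have h3 : h1.choose.comp π = h2.choose.comp π :=
      MvPolynomial.algHom_ext fun i => congrFun heq i
    have h4 : h1.choose = h2.choose := by
      ext a
      obtain ⟨b, rfl⟩ := hπ a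
      exact DFunLike.congr_fun h3 b
    refine PrimeSpectrum.ext ?_
    rw [← h1.choose_spec.2, ← h2.choose_spec.2, h4]

end Cardinality

/-! ### Closed points, their degrees and their local rings -/

section ClosedPoints

variable {K : Type u} [Field K] {V : Scheme.{u}} (f : V ⟶ Spec (.of K))

/-- The structure of `K`-algebra on the sections of a `K`-scheme over an open set. -/
def baseToSections (U : V.Opens) : K →+* Γ(V, U) :=
  ((Scheme.ΓSpecIso (.of K)).inv ≫ f.appLE ⊤ U le_top).hom

theorem baseToSections_evaluation {U : V.Opens} {P : V} (hP : P ∈ U) :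
    (V.evaluation U P hP).hom.comp (baseToSections f U) =
      ((Scheme.ΓSpecIso (.of K)).inv ≫ (Spec (.of K)).Γevaluation (f P) ≫
        f.residueFieldMap P).hom := by
  have h : f.appLE ⊤ U le_top ≫ V.evaluation U P hP =
      (Spec (.of K)).Γevaluation (f P) ≫ f.residueFieldMap P := by
    rw [Scheme.Γevaluation_naturality]
    simp only [Scheme.Hom.appLE, Category.assoc, Scheme.evaluation,
      TopCat.Presheaf.germ_res_assoc]
    rfl
  rw [← h]
  rfl

theorem bijective_Γevaluation (x : Spec (.of K)) :
    Function.Bijective ((Scheme.ΓSpecIso (.of K)).inv ≫ (Spec (.of K)).Γevaluation x) := by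
  have h := Scheme.Spec.algebraMap_residueFieldIso_inv (.of K) x
  have h' : (Scheme.ΓSpecIso (.of K)).inv ≫ (Spec (.of K)).Γevaluation x =
    (Scheme.ΓSpecIso (.of K)).inv ≫ (Spec (.of K)).presheaf.germ ⊤ x trivial ≫
      (Spec (.of K)).residue x := rfl
  rw [h', ← h]
  have hx : x.asIdeal.IsMaximal := by
    have : x.asIdeal = ⊥ := (Ideal.eq_bot_or_top _).resolve_right x.2.ne_top
    rw [this]
    exact Ideal.bot_isMaximal
  have h1 : Function.Bijective (algebraMap K x.asIdeal.ResidueField) :=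
    ⟨RingHom.injective _, Ideal.algebraMap_residueField_surjective x.asIdeal⟩
  exact (ConcreteCategory.bijective_of_isIso (Scheme.Spec.residueFieldIso (.of K) x).inv).comp h1

theorem residueDegree_eq_finrank {U : V.Opens} {P : V} (hP : P ∈ U) :
    let _ : Algebra K (V.residueField P) :=
      ((V.evaluation U P hP).hom.comp (baseToSections f U)).toAlgebra
    f.residueDegree P = Module.finrank K (V.residueField P) := by
  intro _
  let _ := (f.residueFieldMap P).hom.toAlgebra
  refine (Algebra.finrank_eq_of_equiv_equiv
    (RingEquiv.ofBijective _ (bijective_Γevaluation (f P))) (RingEquiv.refl _) ?_).symm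
  exact (baseToSections_evaluation f hP).symm

theorem baseToSections_finiteType [LocallyOfFiniteType f] {U : V.Opens} (hU : IsAffineOpen U) :
    (baseToSections f U).FiniteType := by
  have h := f.finiteType_appLE (isAffineOpen_top _) hU le_top
  exact RingHom.FiniteType.comp h (RingHom.FiniteType.of_surjective _
    (ConcreteCategory.bijective_of_isIso (Scheme.ΓSpecIso (.of K)).inv).2)

theorem exists_isStandardSmoothOfRelativeDimension_baseToSections (m : ℕ)
    [SmoothOfRelativeDimension m f] (P : V) : ∃ U : V.Opens, IsAffineOpen U ∧ P ∈ U ∧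
      (baseToSections f U).IsStandardSmoothOfRelativeDimension m := by
  obtain ⟨U₀, -, U, hU, hP, e, h⟩ :=
    SmoothOfRelativeDimension.exists_isStandardSmoothOfRelativeDimension (n := m) (f := f) P
  obtain rfl : U₀ = ⊤ := by
    refine top_le_iff.mp fun x _ => ?_
    have : Subsingleton (Spec (.of K)) := inferInstanceAs (Subsingleton (PrimeSpectrum K))
    rw [Subsingleton.elim x (f P)]
    exact e hP
  exact ⟨U, hU, hP, RingHom.isStandardSmoothOfRelativeDimension_respectsIso.2 _
    (Scheme.ΓSpecIso (.of K)).symm.commRingCatIsoToRingEquiv h⟩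

theorem finite_residueField [Finite K] [LocallyOfFiniteType f] {P : V} (hP : IsClosed {P}) :
    Finite (IsLocalRing.ResidueField (V.presheaf.stalk P)) := by
  obtain ⟨U, hU, hPU, -⟩ := exists_isAffineOpen_mem_and_subset (x := P) (U := ⊤) trivial
  let _ : Algebra K Γ(V, U) := (baseToSections f U).toAlgebra
  let _ : Algebra Γ(V, U) (V.presheaf.stalk P) := (V.presheaf.germ U P hPU).hom.toAlgebra
  let _ : Algebra K (V.presheaf.stalk P) :=
    ((V.presheaf.germ U P hPU).hom.comp (baseToSections f U)).toAlgebra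
  have : IsScalarTower K Γ(V, U) (V.presheaf.stalk P) := .of_algebraMap_eq fun _ => rfl
  have : IsLocalization.AtPrime (V.presheaf.stalk P) (hU.primeIdealOf ⟨P, hPU⟩).asIdeal :=
    hU.isLocalization_stalk ⟨P, hPU⟩
  have : (hU.primeIdealOf ⟨P, hPU⟩).asIdeal.IsMaximal :=
    hU.primeIdealOf_isMaximal_of_isClosed ⟨P, hPU⟩ hP
  have : Algebra.FiniteType K Γ(V, U) := baseToSections_finiteType f hU
  have : Module.Finite K (IsLocalRing.ResidueField (V.presheaf.stalk P)) :=
    finite_residueField_of_isMaximal (hU.primeIdealOf ⟨P, hPU⟩).asIdeal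
  exact Module.finite_of_finite K

theorem card_stalk_quotient_maximalIdeal_sq [Finite K] (m : ℕ) [SmoothOfRelativeDimension m f]
    {P : V} (hP : IsClosed {P}) :
    Nat.card (V.presheaf.stalk P ⧸ IsLocalRing.maximalIdeal (V.presheaf.stalk P) ^ 2) =
      Nat.card K ^ ((m + 1) * f.residueDegree P) := by
  obtain ⟨U, hU, hPU, h⟩ := exists_isStandardSmoothOfRelativeDimension_baseToSections f m P
  let _ : Algebra K Γ(V, U) := (baseToSections f U).toAlgebra
  let _ : Algebra Γ(V, U) (V.presheaf.stalk P) := (V.presheaf.germ U P hPU).hom.toAlgebra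
  let _ : Algebra K (V.presheaf.stalk P) :=
    ((V.presheaf.germ U P hPU).hom.comp (baseToSections f U)).toAlgebra
  have : IsScalarTower K Γ(V, U) (V.presheaf.stalk P) := .of_algebraMap_eq fun _ => rfl
  have : IsLocalization.AtPrime (V.presheaf.stalk P) (hU.primeIdealOf ⟨P, hPU⟩).asIdeal :=
    hU.isLocalization_stalk ⟨P, hPU⟩
  have : (hU.primeIdealOf ⟨P, hPU⟩).asIdeal.IsMaximal :=
    hU.primeIdealOf_isMaximal_of_isClosed ⟨P, hPU⟩ hP
  have : Algebra.IsStandardSmoothOfRelativeDimension m K Γ(V, U) := h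
  rw [card_quotient_maximalIdeal_sq (K := K) m (hU.primeIdealOf ⟨P, hPU⟩).asIdeal,
    residueDegree_eq_finrank f hPU]
  rfl

theorem finite_closedPointsLT [Finite K] [LocallyOfFiniteType f] [CompactSpace V] (r : ℕ) :
    (closedPointsLT f r).Finite := by
  have hcov : ∀ x : V, ∃ U : V.Opens, IsAffineOpen U ∧ x ∈ U := fun x => by
    obtain ⟨U, hU, hx, -⟩ := exists_isAffineOpen_mem_and_subset (x := x) (U := ⊤) trivial
    exact ⟨U, hU, hx⟩
  choose U hU hxU using hcov
  obtain ⟨J, hJ⟩ := CompactSpace.elim_nhds_subcover (fun x => (U x : Set V))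
    fun x => (U x).2.mem_nhds (hxU x)
  refine (J.finite_toSet.biUnion (t := fun x => closedPointsLT f r ∩ U x) fun x _ => ?_).subset
    fun P hP => ?_
  · let _ : Algebra K Γ(V, U x) := (baseToSections f (U x)).toAlgebra
    have : Algebra.FiniteType K Γ(V, U x) := baseToSections_finiteType f (hU x)
    refine ((finite_setOf_exists_ker_eq (K := K) (A := Γ(V, U x)) r).image
      (hU x).fromSpec).subset ?_
    rintro P ⟨⟨hP, hr⟩, hPU⟩
    refine ⟨(hU x).primeIdealOf ⟨P, hPU⟩, ?_, (hU x).fromSpec_primeIdealOf ⟨P, hPU⟩⟩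
    let _ : Algebra K (V.residueField P) :=
      ((V.evaluation (U x) P hPU).hom.comp (baseToSections f (U x))).toAlgebra
    have : Finite (V.residueField P) := finite_residueField f hP
    refine ⟨V.residueField P, inferInstance, inferInstance,
      { (V.evaluation (U x) P hPU).hom with commutes' := fun _ => rfl }, inferInstance, ?_, ?_⟩
    · rwa [← residueDegree_eq_finrank f hPU]
    · ext a
      let _ : Algebra Γ(V, U x) (V.presheaf.stalk P) :=
        (V.presheaf.germ (U x) P hPU).hom.toAlgebra
      have : IsLocalization.AtPrime (V.presheaf.stalk P)
          ((hU x).primeIdealOf ⟨P, hPU⟩).asIdeal := (hU x).isLocalization_stalk ⟨P, hPU⟩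
      rw [← IsLocalization.AtPrime.to_map_mem_maximal_iff (V.presheaf.stalk P)
        ((hU x).primeIdealOf ⟨P, hPU⟩).asIdeal]
      exact IsLocalRing.residue_eq_zero_iff _
  · obtain ⟨x, hx, hPx⟩ := Set.mem_iUnion₂.mp (hJ.ge (Set.mem_univ P))
    exact Set.mem_biUnion hx ⟨hP, hPx⟩

end ClosedPoints

/-! ### Smoothness above a point in terms of rational coefficients -/

section Encoding

section

variable {V : Scheme.{u}} {L : V.Modules}

theorem IsLineBundle.exists_affine_frame (hL : IsLineBundle L) (x : V) :
    ∃ (U : V.Opens) (e : Γ(L, U)), IsAffineOpen U ∧ x ∈ U ∧ IsFrame L e := by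
  obtain ⟨U, e, hx, he⟩ := hL x
  obtain ⟨U', hU', hx', hle⟩ := exists_isAffineOpen_mem_and_subset hx
  exact ⟨U', _, hU', hx', he.map hle⟩

theorem WeierstrassTuple.IsNormal.isNormalForm_curve {k p : ℕ} {a : WeierstrassTuple L k}
    (ha : a.IsNormal p) {U : V.Opens} (e : Γ(L, U)) (he : IsFrame L e) :
    (a.curve e he).IsNormalForm p := by
  have h0 {n : ℕ} {s : PowSection L n} (hs : s = 0) : s.coord e he = 0 := by
    rw [hs]
    rfl
  exact ⟨fun h => h0 (ha.1 h), fun h => ⟨h0 (ha.2.1 h).1, h0 (ha.2.1 h).2⟩,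
    fun h => ⟨h0 (ha.2.2 h).1, h0 (ha.2.2 h).2.1, h0 (ha.2.2 h).2.2⟩⟩

end

variable {V : Scheme.{u}} [IsIntegral V] {L : V.Modules} {t : V → V.functionField}
  {ι : ∀ n, PowSection L n → V.functionField}

theorem IsEncoding.mem_cocycleSections (h : IsEncoding t ι) {n : ℕ} (s : PowSection L n) :
    ι n s ∈ cocycleSections t n := by
  have : ι n s ∈ Set.range (ι n) := ⟨s, rfl⟩
  rwa [h.range_eq] at this

theorem IsEncoding.mem_basicOpen_iff (h : IsEncoding t ι) {n : ℕ} (s : PowSection L n)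
    {U : V.Opens} (e : Γ(L, U)) (he : IsFrame L e) {x : V} (hx : x ∈ U) :
    x ∈ V.basicOpen (s.coord e he) ↔ t x ^ n * ι n s ∈ stalkUnits x := by
  obtain ⟨u, hu⟩ := h.exists_unit U e he x hx
  have hu' := pow_mem ((algebraMap_mem_stalkUnits_iff x (u : V.presheaf.stalk x)).mpr u.isUnit) n
  rw [V.mem_basicOpen _ x hx, ← algebraMap_mem_stalkUnits_iff, hu,
    mul_mem_stalkUnits_iff (stalkUnits_le x hu') (h.mem_cocycleSections s x)]
  exact and_iff_right hu'

theorem IsEncoding.mem_nonvanishing_iff (h : IsEncoding t ι) (hL : IsLineBundle L) {n : ℕ}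
    (s : PowSection L n) (x : V) :
    x ∈ s.nonvanishing ↔ t x ^ n * ι n s ∈ stalkUnits x := by
  constructor
  · intro hx
    simp only [PowSection.nonvanishing, Opens.mem_iSup] at hx
    obtain ⟨U, e, he, hx⟩ := hx
    exact (h.mem_basicOpen_iff s e he (V.basicOpen_le _ hx)).mp hx
  · intro hx
    obtain ⟨U, e, hxU, he⟩ := hL x
    simp only [PowSection.nonvanishing, Opens.mem_iSup]
    exact ⟨U, e, he, (h.mem_basicOpen_iff s e he hxU).mpr hx⟩

theorem IsEncoding.isAmpleCocycle (h : IsEncoding t ι) (hL : IsLineBundle L) (hA : IsAmple L) :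
    IsAmpleCocycle t := by
  intro x
  obtain ⟨n, s, hn, hx, hs⟩ := hA x
  exact ⟨n, ι n s, s.nonvanishing, hn, h.mem_cocycleSections s, hx, hs,
    h.mem_nonvanishing_iff hL s⟩

variable {K : Type u} [Field K] [Finite K] (f : V ⟶ Spec (.of K)) [Smooth f]

/-- In any frame at `P` the coefficients differ from those of `W` by powers of one unit, so
`IsSingularModSq.scale`, applied to the `k`-th power of the unit and of its inverse, identifies the
conditions for all frames. -/
theorem IsEncoding.isSmoothAbove_iff (h : IsEncoding t ι) (hL : IsLineBundle L) {p k : ℕ}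
    [Fact p.Prime] [CharP K p] {a : WeierstrassTuple L k} (ha : a.IsNormal p) {P : V}
    (hP : IsClosed {P}) (W : WeierstrassCurve (V.presheaf.stalk P))
    (h₁ : algebraMap _ V.functionField W.a₁ = t P ^ k * ι _ a.a₁)
    (h₂ : algebraMap _ V.functionField W.a₂ = t P ^ (2 * k) * ι _ a.a₂)
    (h₃ : algebraMap _ V.functionField W.a₃ = t P ^ (3 * k) * ι _ a.a₃)
    (h₄ : algebraMap _ V.functionField W.a₄ = t P ^ (4 * k) * ι _ a.a₄)
    (h₆ : algebraMap _ V.functionField W.a₆ = t P ^ (6 * k) * ι _ a.a₆) :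
    a.IsSmoothAbove f P ↔ ¬ W.IsSingularModSq := by
  have := finite_residueField f hP
  have hinj := IsFractionRing.injective (V.presheaf.stalk P) V.functionField
  have key {U : V.Opens} (e : Γ(L, U)) (he : IsFrame L e) (hPU : P ∈ U) :
      ((a.curve e he).map (V.presheaf.germ U P hPU).hom).IsSingularModSq ↔
        W.IsSingularModSq := by
    obtain ⟨u, hu⟩ := h.exists_unit U e he P hPU
    have hu' {n : ℕ} (s : PowSection L n) (w : V.presheaf.stalk P)
        (hw : algebraMap _ V.functionField w = t P ^ n * ι n s) :
        V.presheaf.germ U P hPU (s.coord e he) = (u : V.presheaf.stalk P) ^ n * w := by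
      apply hinj
      rw [hu, map_mul, map_pow, hw]
    have hu'' {n : ℕ} (s : PowSection L n) (w : V.presheaf.stalk P)
        (hw : algebraMap _ V.functionField w = t P ^ n * ι n s) :
        w = ((u⁻¹ : (V.presheaf.stalk P)ˣ) : V.presheaf.stalk P) ^ n *
          V.presheaf.germ U P hPU (s.coord e he) := by
      rw [hu' s w hw, ← mul_assoc, ← mul_pow, Units.inv_mul, one_pow, one_mul]
    have hpow (v : V.presheaf.stalk P) (i : ℕ) : (v ^ k) ^ i = v ^ (i * k) := by
      rw [← pow_mul, mul_comm]
    constructor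
    · intro hs
      refine hs.scale (((u⁻¹ : (V.presheaf.stalk P)ˣ) : V.presheaf.stalk P) ^ k) ?_ ?_ ?_ ?_ ?_
      · exact hu'' _ _ h₁
      · exact (hu'' _ _ h₂).trans (by rw [hpow]; rfl)
      · exact (hu'' _ _ h₃).trans (by rw [hpow]; rfl)
      · exact (hu'' _ _ h₄).trans (by rw [hpow]; rfl)
      · exact (hu'' _ _ h₆).trans (by rw [hpow]; rfl)
    · intro hs
      refine hs.scale ((u : V.presheaf.stalk P) ^ k) ?_ ?_ ?_ ?_ ?_
      · exact hu' _ _ h₁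
      · exact (hu' _ _ h₂).trans (by rw [hpow])
      · exact (hu' _ _ h₃).trans (by rw [hpow])
      · exact (hu' _ _ h₄).trans (by rw [hpow])
      · exact (hu' _ _ h₆).trans (by rw [hpow])
  constructor
  · intro hs
    obtain ⟨U, e, hU, hPU, he⟩ := hL.exists_affine_frame P
    rw [← key e he hPU]
    exact (forall_isSmoothAt_iff f hU hPU _ (ha.isNormalForm_curve e he)).mp (hs U hU e he)
  · intro hW U hU e he w hw
    have hPU : P ∈ U := by
      rw [← hw]
      have : hU.fromSpec (WeierstrassScheme.toSpec (a.curve e he) w) ∈ Set.range hU.fromSpec :=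
        ⟨_, rfl⟩
      rwa [hU.range_fromSpec] at this
    rw [← key e he hPU] at hW
    exact (forall_isSmoothAt_iff f hU hPU _ (ha.isNormalForm_curve e he)).mpr hW w hw

end Encoding

/-! ### Counting tuples of sections by their reductions -/

section Counting

/-- The nonempty fibres of `ρ` are cosets of its kernel; a choice of preimages turns this into a
bijection. -/
theorem card_setOf_apply_eq_mul_card_ker {A C : Type*} [AddCommGroup A] [AddCommGroup C]
    (ρ : A →+ C) (T : C → Prop) :
    Nat.card {a // T (ρ a)} = Nat.card {c // c ∈ ρ.range ∧ T c} * Nat.card ρ.ker := by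
  rw [← Nat.card_prod]
  have hs (c : {c // c ∈ ρ.range ∧ T c}) : ∃ a, ρ a = c := c.2.1
  choose s hs using hs
  have hT (a : {a // T (ρ a)}) : ρ a ∈ ρ.range ∧ T (ρ a) := ⟨⟨a, rfl⟩, a.2⟩
  refine Nat.card_congr
    { toFun := fun a => (⟨ρ a, hT a⟩, ⟨a - s ⟨ρ a, hT a⟩, ?_⟩)
      invFun := fun c => ⟨s c.1 + c.2, ?_⟩
      left_inv := fun a => Subtype.ext (add_sub_cancel _ _)
      right_inv := fun c => ?_ }
  · rw [AddMonoidHom.mem_ker, map_sub, hs, sub_self]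
  · rw [map_add, hs, AddMonoidHom.mem_ker.mp c.2.2, add_zero]
    exact c.1.2.2
  · have h1 : ρ (s c.1 + c.2) = c.1 := by
      rw [map_add, hs, AddMonoidHom.mem_ker.mp c.2.2, add_zero]
    refine Prod.ext (Subtype.ext h1) (Subtype.ext ?_)
    simp [h1]

/-- Weierstrass equations as tuples of coefficients. -/
def WeierstrassCurve.ofTuple {R : Type*} (c : R × R × R × R × R) : WeierstrassCurve R :=
  ⟨c.1, c.2.1, c.2.2.1, c.2.2.2.1, c.2.2.2.2⟩

theorem WeierstrassCurve.bijective_ofTuple {R : Type*} :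
    Function.Bijective (WeierstrassCurve.ofTuple (R := R)) :=
  Function.bijective_iff_has_inverse.mpr
    ⟨fun W => (W.a₁, W.a₂, W.a₃, W.a₄, W.a₆), fun _ => rfl, fun _ => rfl⟩

section LocalRing

open IsLocalRing

variable {B : Type*} [CommRing B] [IsLocalRing B]

instance isLocalRing_quotient_sq : IsLocalRing (B ⧸ maximalIdeal B ^ 2) :=
  have : Nontrivial (B ⧸ maximalIdeal B ^ 2) := Ideal.Quotient.nontrivial_iff.mpr fun h =>
    (maximalIdeal.isMaximal B).ne_top (top_le_iff.mp (h.ge.trans (Ideal.pow_le_self two_ne_zero)))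
  .of_surjective' (Ideal.Quotient.mk _) Ideal.Quotient.mk_surjective

theorem maximalIdeal_quotient_sq_sq : maximalIdeal (B ⧸ maximalIdeal B ^ 2) ^ 2 = ⊥ := by
  have hloc : IsLocalHom (Ideal.Quotient.mk (maximalIdeal B ^ 2)) :=
    Ideal.Quotient.mk_surjective.isLocalHom
  have : maximalIdeal (B ⧸ maximalIdeal B ^ 2) =
      (maximalIdeal B).map (Ideal.Quotient.mk (maximalIdeal B ^ 2)) := by
    refine le_antisymm (fun b hb => ?_) (Ideal.map_le_iff_le_comap.mpr
      fun x hx => ?_)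
    on_goal 2 => simpa [mem_maximalIdeal, mem_nonunits_iff] using hx
    obtain ⟨x, rfl⟩ := Ideal.Quotient.mk_surjective b
    refine Ideal.mem_map_of_mem _ ?_
    simpa [mem_maximalIdeal, mem_nonunits_iff] using hb
  rw [this, ← Ideal.map_pow, Ideal.map_quotient_self]

theorem WeierstrassCurve.card_nonsingular {R : Type*} [CommRing R] [IsLocalRing R] [Finite R]
    {p : ℕ} [Fact p.Prime] [CharP R p] (h2 : maximalIdeal R ^ 2 = ⊥) :
    (Nat.card {W : WeierstrassCurve R // W.IsNormalForm p ∧ ¬ W.IsSingularModSq} : ℝ) =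
      Nat.card {W : WeierstrassCurve R // W.IsNormalForm p} * (1 - (Nat.card R : ℝ)⁻¹) := by
  have h := card_singular_mul_card (R := R) (p := p) h2
  have hsum : Nat.card {W : WeierstrassCurve R // W.IsNormalForm p ∧ W.IsSingularModSq} +
      Nat.card {W : WeierstrassCurve R // W.IsNormalForm p ∧ ¬ W.IsSingularModSq} =
      Nat.card {W : WeierstrassCurve R // W.IsNormalForm p} := by
    classical
    rw [← Nat.card_sum]
    refine Nat.card_congr (Equiv.trans (Equiv.sumCongr
      (Equiv.subtypeSubtypeEquivSubtypeInter _ IsSingularModSq).symm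
      (Equiv.subtypeSubtypeEquivSubtypeInter _ fun W : WeierstrassCurve R =>
        ¬ W.IsSingularModSq).symm)
      (Equiv.sumCompl fun W : {W : WeierstrassCurve R // W.IsNormalForm p} =>
        W.1.IsSingularModSq))
  have hR : (Nat.card R : ℝ) ≠ 0 := by exact_mod_cast Nat.card_pos.ne'
  rw [← hsum] at h ⊢
  push_cast at h ⊢
  field_simp
  have h' : (Nat.card {W : WeierstrassCurve R // W.IsNormalForm p ∧ W.IsSingularModSq} : ℝ) *
      Nat.card R = Nat.card {W : WeierstrassCurve R // W.IsNormalForm p ∧ W.IsSingularModSq} +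
      Nat.card {W : WeierstrassCurve R // W.IsNormalForm p ∧ ¬ W.IsSingularModSq} := by
    exact_mod_cast h
  linear_combination -h'

end LocalRing

section Sections

variable {V : Scheme.{u}} [IsIntegral V] (t : V → V.functionField)

theorem exists_algebraMap_eq {t : V → V.functionField} {n : ℕ} (P : V)
    (φ : cocycleSections t n) :
    ∃ b : V.presheaf.stalk P, algebraMap _ V.functionField b = t P ^ n * φ := φ.2 P

/-- The truncated local ring at a point. -/
abbrev StalkModSq (P : V) : Type u :=
  V.presheaf.stalk P ⧸ IsLocalRing.maximalIdeal (V.presheaf.stalk P) ^ 2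

/-- The first order Taylor expansion at `P`, as an additive map on sections. -/
def reduction (n : ℕ) (P : V) : cocycleSections t n →+ StalkModSq P :=
  AddMonoidHom.mk' (fun φ => Ideal.Quotient.mk _ (exists_algebraMap_eq P φ).choose) fun φ ψ => by
    rw [← map_add]
    congr 1
    apply IsFractionRing.injective (V.presheaf.stalk P) V.functionField
    rw [map_add, (exists_algebraMap_eq P _).choose_spec, (exists_algebraMap_eq P _).choose_spec,
      (exists_algebraMap_eq P _).choose_spec, AddSubgroup.coe_add, mul_add]

variable {t} in
theorem reduction_eq {n : ℕ} {P : V} {φ : cocycleSections t n} {b : V.presheaf.stalk P}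
    (hb : algebraMap _ V.functionField b = t P ^ n * φ) :
    reduction t n P φ = Ideal.Quotient.mk _ b := by
  change Ideal.Quotient.mk _ _ = _
  congr 1
  apply IsFractionRing.injective (V.presheaf.stalk P) V.functionField
  rw [hb, (exists_algebraMap_eq P _).choose_spec]

/-- Tuples of sections in normal form. -/
def normalSections (p k : ℕ) : AddSubgroup (cocycleSections t k × cocycleSections t (2 * k) ×
    cocycleSections t (3 * k) × cocycleSections t (4 * k) × cocycleSections t (6 * k)) where
  carrier := {a | (p = 2 → a.2.1 = 0) ∧ (p = 3 → a.1 = 0 ∧ a.2.2.1 = 0) ∧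
    (3 < p → a.1 = 0 ∧ a.2.1 = 0 ∧ a.2.2.1 = 0)}
  zero_mem' := by simp
  add_mem' := by
    rintro a b ⟨h1, h2, h3⟩ ⟨h1', h2', h3'⟩
    refine ⟨fun h => ?_, fun h => ?_, fun h => ?_⟩
    · simp [h1 h, h1' h]
    · simp [h2 h, h2' h]
    · simp [h3 h, h3' h]
  neg_mem' := by
    rintro a ⟨h1, h2, h3⟩
    refine ⟨fun h => ?_, fun h => ?_, fun h => ?_⟩
    · simp [h1 h]
    · simp [h2 h]
    · simp [h3 h]

/-- The coefficients of the Weierstrass equations over the truncated local rings at the points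
of `Z`. -/
def reductionTuple (p k : ℕ) (Z : Set V) : normalSections t p k →+ ∀ P : Z,
    StalkModSq P.1 × StalkModSq P.1 × StalkModSq P.1 × StalkModSq P.1 × StalkModSq P.1 :=
  AddMonoidHom.pi fun P => ((reduction t k P.1).prodMap ((reduction t (2 * k) P.1).prodMap
    ((reduction t (3 * k) P.1).prodMap ((reduction t (4 * k) P.1).prodMap
      (reduction t (6 * k) P.1))))).comp (normalSections t p k).subtype

variable {t}

/-- The coefficients are lifted one at a time. A coefficient that the normal form forces to vanish
is lifted by zero, so the lifted tuple is again in normal form. -/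
theorem mem_range_reductionTuple_iff {Z : Set V} {n₀ : ℕ}
    (hn₀ : ∀ n, n₀ ≤ n → ∀ c : ∀ P : V, V.presheaf.stalk P, ∃ φ ∈ cocycleSections t n,
      ∀ P ∈ Z, ∃ b, algebraMap _ V.functionField b = t P ^ n * φ ∧
        b - c P ∈ IsLocalRing.maximalIdeal (V.presheaf.stalk P) ^ 2)
    {p k : ℕ} (hk : n₀ ≤ k) (c : ∀ P : Z,
      StalkModSq P.1 × StalkModSq P.1 × StalkModSq P.1 × StalkModSq P.1 × StalkModSq P.1) :
    c ∈ (reductionTuple t p k Z).range ↔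
      ∀ P, (WeierstrassCurve.ofTuple (c P)).IsNormalForm p := by
  constructor
  · rintro ⟨⟨a, h1, h2, h3⟩, rfl⟩ P
    have h0 {n : ℕ} {s : cocycleSections t n} (hs : s = 0) : reduction t n P.1 s = 0 := by
      rw [hs, map_zero]
    exact ⟨fun h => h0 (h1 h), fun h => ⟨h0 (h2 h).1, h0 (h2 h).2⟩,
      fun h => ⟨h0 (h3 h).1, h0 (h3 h).2.1, h0 (h3 h).2.2⟩⟩
  · intro hc
    -- The proposition `q` expresses that the normal form forces this coefficient to vanish.
    have hlift (n : ℕ) (hn : n₀ ≤ n) (d : ∀ P : Z, StalkModSq P.1) (q : Prop)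
        (hq : q → d = 0) : ∃ φ : cocycleSections t n, (q → φ = 0) ∧
          ∀ P : Z, reduction t n P.1 φ = d P := by
      by_cases h : q
      · exact ⟨0, fun _ => rfl, fun P => by rw [map_zero, hq h, Pi.zero_apply]⟩
      · classical
        choose e he using fun P : Z => Ideal.Quotient.mk_surjective (d P)
        obtain ⟨φ, hφ, hφZ⟩ := hn₀ n hn fun P => if hP : P ∈ Z then e ⟨P, hP⟩ else 0
        refine ⟨⟨φ, hφ⟩, fun h' => (h h').elim, fun P => ?_⟩
        obtain ⟨b, hb, hbc⟩ := hφZ P.1 P.2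
        rw [dif_pos P.2] at hbc
        rw [reduction_eq hb, ← he P]
        exact Ideal.Quotient.eq.mpr hbc
    obtain ⟨a₁, h₁, r₁⟩ := hlift k hk (fun P => (c P).1) (p = 3 ∨ 3 < p) fun h => funext fun P =>
      h.elim (fun h => ((hc P).2.1 h).1) fun h => ((hc P).2.2 h).1
    obtain ⟨a₂, h₂, r₂⟩ := hlift (2 * k) (by omega) (fun P => (c P).2.1) (p = 2 ∨ 3 < p)
      fun h => funext fun P => h.elim (fun h => (hc P).1 h) fun h => ((hc P).2.2 h).2.1
    obtain ⟨a₃, h₃, r₃⟩ := hlift (3 * k) (by omega) (fun P => (c P).2.2.1) (p = 3 ∨ 3 < p)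
      fun h => funext fun P => h.elim (fun h => ((hc P).2.1 h).2) fun h => ((hc P).2.2 h).2.2
    obtain ⟨a₄, -, r₄⟩ := hlift (4 * k) (by omega) (fun P => (c P).2.2.2.1) False False.elim
    obtain ⟨a₆, -, r₆⟩ := hlift (6 * k) (by omega) (fun P => (c P).2.2.2.2) False False.elim
    refine ⟨⟨(a₁, a₂, a₃, a₄, a₆), fun h => h₂ (.inl h), fun h => ⟨h₁ (.inl h), h₃ (.inl h)⟩,
      fun h => ⟨h₁ (.inr h), h₂ (.inr h), h₃ (.inr h)⟩⟩, funext fun P => ?_⟩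
    exact Prod.ext (r₁ P) (Prod.ext (r₂ P) (Prod.ext (r₃ P) (Prod.ext (r₄ P) (r₆ P))))

theorem card_normalSections_of_reduction {Z : Set V} [Finite Z] {n₀ : ℕ}
    (hn₀ : ∀ n, n₀ ≤ n → ∀ c : ∀ P : V, V.presheaf.stalk P, ∃ φ ∈ cocycleSections t n,
      ∀ P ∈ Z, ∃ b, algebraMap _ V.functionField b = t P ^ n * φ ∧
        b - c P ∈ IsLocalRing.maximalIdeal (V.presheaf.stalk P) ^ 2)
    {p k : ℕ} (hk : n₀ ≤ k) (T : ∀ P : Z, WeierstrassCurve (StalkModSq P.1) → Prop) :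
    Nat.card {a : normalSections t p k //
        ∀ P : Z, T P (.ofTuple (reductionTuple t p k Z a P))} =
      (∏ᶠ P : Z, Nat.card {W : WeierstrassCurve (StalkModSq P.1) // W.IsNormalForm p ∧ T P W}) *
        Nat.card (reductionTuple t p k Z).ker := by
  rw [card_setOf_apply_eq_mul_card_ker (reductionTuple t p k Z)
    fun c => ∀ P : Z, T P (.ofTuple (c P))]
  congr 1
  simp only [mem_range_reductionTuple_iff hn₀ hk, ← forall_and]
  cases nonempty_fintype Z
  rw [finprod_eq_prod_of_fintype, ← Nat.card_pi]
  refine Nat.card_congr ((Equiv.subtypePiEquivPi (p := fun P c =>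
    (WeierstrassCurve.ofTuple c).IsNormalForm p ∧ T P (.ofTuple c))).trans
    (Equiv.piCongrRight fun P => ?_))
  exact (Equiv.ofBijective _ WeierstrassCurve.bijective_ofTuple).subtypeEquiv fun _ => Iff.rfl

end Sections

end Counting

/-! ### From exact proportions in each degree to the density -/

section Density

theorem ncard_setOf_sigma {X : ℕ → Type*} (Q : ∀ k, X k → Prop)
    (hfin : ∀ k, Finite {x : X k // Q k x}) (N : ℕ) :
    {a : Σ k, X k | 1 ≤ a.1 ∧ a.1 ≤ N ∧ Q a.1 a.2}.ncard =
      ∑ k ∈ Finset.Icc 1 N, Nat.card {x : X k // Q k x} := by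
  rw [← Finset.sum_coe_sort, ← Nat.card_sigma]
  refine Nat.card_congr
    { toFun := fun a => ⟨⟨a.1.1, Finset.mem_Icc.mpr ⟨a.2.1, a.2.2.1⟩⟩, a.1.2, a.2.2.2⟩
      invFun := fun a => ⟨⟨a.1.1, a.2.1⟩, (Finset.mem_Icc.mp a.1.2).1, (Finset.mem_Icc.mp a.1.2).2,
        a.2.2⟩
      left_inv := fun _ => rfl
      right_inv := fun _ => rfl }

/-- The numerator differs from `d` times the denominator by a sum over `k ≤ k₀`, constant for large
`N`, while the denominator is at least `N`. -/
theorem tendsto_sum_div_sum {s c : ℕ → ℕ} {d : ℝ} {k₀ : ℕ} (hc : ∀ k, 0 < c k)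
    (h : ∀ k, k₀ ≤ k → (s k : ℝ) = c k * d) :
    Filter.Tendsto (fun N : ℕ => ((∑ k ∈ Finset.Icc 1 N, s k : ℕ) : ℝ) /
      ((∑ k ∈ Finset.Icc 1 N, c k : ℕ) : ℝ)) Filter.atTop (nhds d) := by
  have hle (N : ℕ) : N ≤ ∑ k ∈ Finset.Icc 1 N, c k := by
    simpa using Finset.card_nsmul_le_sum (Finset.Icc 1 N) c 1 fun k _ => hc k
  have hlim : Filter.Tendsto (fun N : ℕ => ((∑ k ∈ Finset.Icc 1 N, c k : ℕ) : ℝ))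
      Filter.atTop Filter.atTop :=
    Filter.tendsto_atTop_mono (fun N => Nat.cast_le.mpr (hle N)) tendsto_natCast_atTop_atTop
  have h0 := (hlim.const_div_atTop (∑ k ∈ Finset.Icc 1 k₀, ((s k : ℝ) - c k * d))).add_const d
  rw [zero_add] at h0
  refine h0.congr' ?_
  filter_upwards [Filter.eventually_ge_atTop (max k₀ 1)] with N hN
  have hpos : ((∑ k ∈ Finset.Icc 1 N, c k : ℕ) : ℝ) ≠ 0 := by
    have := hle N
    exact_mod_cast (show 0 < ∑ k ∈ Finset.Icc 1 N, c k by omega).ne'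
  have hsub : ∑ k ∈ Finset.Icc 1 k₀, ((s k : ℝ) - c k * d) =
      ∑ k ∈ Finset.Icc 1 N, ((s k : ℝ) - c k * d) := by
    refine Finset.sum_subset (Finset.Icc_subset_Icc_right (by omega)) fun k hk hk' => ?_
    rw [h k (by simp only [Finset.mem_Icc] at hk hk'; omega), sub_self]
  rw [hsub, Finset.sum_sub_distrib, ← Finset.sum_mul, ← Nat.cast_sum, ← Nat.cast_sum, sub_div,
    mul_div_cancel_left₀ _ hpos, sub_add_cancel]

end Density

/-! ### Assembly -/

section Tuples

variable {V : Scheme.{u}} [IsIntegral V] {L : V.Modules} {t : V → V.functionField}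
  {ι : ∀ n, PowSection L n → V.functionField}

/-- The sections of a power of `L`, as rational functions. -/
def IsEncoding.sectionEquiv (h : IsEncoding t ι) (n : ℕ) : PowSection L n ≃ cocycleSections t n :=
  Equiv.ofBijective (fun s => ⟨ι n s, h.mem_cocycleSections s⟩)
    ⟨fun _ _ hs => h.injective n (congrArg Subtype.val hs), fun φ => by
      obtain ⟨s, hs⟩ := (h.range_eq n).ge φ.2
      exact ⟨s, Subtype.ext hs⟩⟩

theorem IsEncoding.sectionEquiv_eq_zero_iff (h : IsEncoding t ι) {n : ℕ} (s : PowSection L n) :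
    h.sectionEquiv n s = 0 ↔ s = 0 := by
  have : h.sectionEquiv n 0 = 0 := Subtype.ext (h.map_zero n)
  rw [← this, EmbeddingLike.apply_eq_iff_eq]

/-- The tuples of sections in normal form, as tuples of rational functions. -/
def IsEncoding.tupleEquiv (h : IsEncoding t ι) (p k : ℕ) :
    {a : WeierstrassTuple L k // a.IsNormal p} ≃ normalSections t p k :=
  Equiv.subtypeEquiv
    { toFun := fun a => (h.sectionEquiv _ a.a₁, h.sectionEquiv _ a.a₂, h.sectionEquiv _ a.a₃,
        h.sectionEquiv _ a.a₄, h.sectionEquiv _ a.a₆)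
      invFun := fun φ => ⟨(h.sectionEquiv _).symm φ.1, (h.sectionEquiv _).symm φ.2.1,
        (h.sectionEquiv _).symm φ.2.2.1, (h.sectionEquiv _).symm φ.2.2.2.1,
        (h.sectionEquiv _).symm φ.2.2.2.2⟩
      left_inv := fun a => by simp
      right_inv := fun a => by simp }
    fun a => by
      simp only [WeierstrassTuple.IsNormal, ← h.sectionEquiv_eq_zero_iff]
      rfl

variable {K : Type u} [Field K] [Finite K] (f : V ⟶ Spec (.of K))

theorem IsEncoding.isSmoothAbove_iff_reductionTuple [Smooth f] (h : IsEncoding t ι)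
    (hL : IsLineBundle L) {p k : ℕ} [Fact p.Prime] [CharP K p] {Z : Set V}
    (a : {a : WeierstrassTuple L k // a.IsNormal p}) (P : Z) (hP : IsClosed {P.1}) :
    a.1.IsSmoothAbove f P.1 ↔ ¬ (WeierstrassCurve.ofTuple
      (reductionTuple t p k Z (h.tupleEquiv p k a) P)).IsSingularModSq := by
  obtain ⟨b₁, h₁⟩ := h.mem_cocycleSections a.1.a₁ P.1
  obtain ⟨b₂, h₂⟩ := h.mem_cocycleSections a.1.a₂ P.1
  obtain ⟨b₃, h₃⟩ := h.mem_cocycleSections a.1.a₃ P.1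
  obtain ⟨b₄, h₄⟩ := h.mem_cocycleSections a.1.a₄ P.1
  obtain ⟨b₆, h₆⟩ := h.mem_cocycleSections a.1.a₆ P.1
  let W : WeierstrassCurve (V.presheaf.stalk P.1) := ⟨b₁, b₂, b₃, b₄, b₆⟩
  have hW : WeierstrassCurve.ofTuple (reductionTuple t p k Z (h.tupleEquiv p k a) P) =
      W.map (Ideal.Quotient.mk (IsLocalRing.maximalIdeal (V.presheaf.stalk P.1) ^ 2)) :=
    WeierstrassCurve.ext (reduction_eq h₁) (reduction_eq h₂) (reduction_eq h₃) (reduction_eq h₄)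
      (reduction_eq h₆)
  rw [h.isSmoothAbove_iff f hL a.2 hP W h₁ h₂ h₃ h₄ h₆, hW,
    WeierstrassCurve.isSingularModSq_map_iff _ Ideal.Quotient.mk_surjective Ideal.mk_ker]

theorem charP_stalkModSq {K : Type u} [Field K] {V : Scheme.{u}} (f : V ⟶ Spec (.of K)) (p : ℕ)
    [CharP K p] (P : V) : CharP (StalkModSq P) p :=
  charP_of_injective_ringHom (RingHom.injective ((Ideal.Quotient.mk _).comp
    ((V.presheaf.germ ⊤ P trivial).hom.comp (baseToSections f ⊤)))) p

/-- Both counts are a product of local counts times the order of the same kernel, so their ratio is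
the product of the local proportions `1 - 1/#R_P`. -/
theorem IsEncoding.card_smooth [IsProper f] (m : ℕ) [SmoothOfRelativeDimension m f]
    (h : IsEncoding t ι) (hL : IsLineBundle L) (hA : IsAmple L) (p : ℕ) [Fact p.Prime] [CharP K p]
    {Z : Set V} (hZ : Z.Finite) (hZc : ∀ P ∈ Z, IsClosed {P}) : ∃ k₀ : ℕ, ∀ k, k₀ ≤ k →
      (Nat.card {a : WeierstrassTuple L k // a.IsNormal p ∧ ∀ P ∈ Z, a.IsSmoothAbove f P} : ℝ) =
        Nat.card {a : WeierstrassTuple L k // a.IsNormal p} *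
          ∏ᶠ P ∈ Z, (1 - ((Nat.card K : ℝ) ^ ((m + 1) * f.residueDegree P))⁻¹) := by
  have : Smooth f := SmoothOfRelativeDimension.smooth m f
  have : CompactSpace V := QuasiCompact.compactSpace_of_compactSpace f
  have hcard (P : V) (hP : IsClosed {P}) := card_stalk_quotient_maximalIdeal_sq f m hP
  have hfin : ∀ P ∈ Z, Finite (StalkModSq P) := fun P hP =>
    Nat.finite_of_card_ne_zero (by
      rw [hcard P (hZc P hP)]
      exact (pow_pos Nat.card_pos _).ne')
  obtain ⟨k₀, hk₀⟩ := (h.isAmpleCocycle hL hA).exists_section h.isCocycle hZ hZc hfin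
  refine ⟨k₀, fun k hk => ?_⟩
  have hZfin : Finite Z := hZ
  have e₁ : Nat.card {a : WeierstrassTuple L k // a.IsNormal p ∧
        ∀ P ∈ Z, a.IsSmoothAbove f P} =
      Nat.card {a : normalSections t p k // ∀ P : Z,
        ¬ (WeierstrassCurve.ofTuple (reductionTuple t p k Z a P)).IsSingularModSq} := by
    refine Nat.card_congr ((Equiv.subtypeSubtypeEquivSubtypeInter _
      fun a : WeierstrassTuple L k => ∀ P ∈ Z, a.IsSmoothAbove f P).symm.trans
      ((h.tupleEquiv p k).subtypeEquiv fun a => ?_))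
    rw [Subtype.forall]
    exact forall₂_congr fun P hP =>
      h.isSmoothAbove_iff_reductionTuple f hL a ⟨P, hP⟩ (hZc P hP)
  -- The total is written with a trivial local condition, so that the same counting lemma applies to
  -- both sides.
  have e₂ : Nat.card {a : WeierstrassTuple L k // a.IsNormal p} =
      Nat.card {a : normalSections t p k // Z → True} :=
    Nat.card_congr ((h.tupleEquiv p k).trans (Equiv.subtypeUnivEquiv fun _ _ => trivial).symm)
  rw [e₁, e₂, card_normalSections_of_reduction hk₀ hk fun _ W => ¬ W.IsSingularModSq,
    card_normalSections_of_reduction hk₀ hk fun _ _ => True]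
  cases nonempty_fintype Z
  rw [← finprod_set_coe_eq_finprod_mem, finprod_eq_prod_of_fintype, finprod_eq_prod_of_fintype,
    finprod_eq_prod_of_fintype]
  push_cast
  rw [mul_right_comm, ← Finset.prod_mul_distrib]
  congr 1
  refine Finset.prod_congr rfl fun P _ => ?_
  have := hfin P.1 P.2
  have := charP_stalkModSq f p P.1
  rw [WeierstrassCurve.card_nonsingular maximalIdeal_quotient_sq_sq, hcard P.1 (hZc P.1 P.2)]
  simp only [and_true, Nat.cast_pow]

theorem IsEncoding.finite_isNormal [IsProper f] (h : IsEncoding t ι) (p k : ℕ) :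
    Finite {a : WeierstrassTuple L k // a.IsNormal p} := by
  have hfin (n : ℕ) : Finite (cocycleSections t n) := finite_cocycleSections f h.isCocycle n
  exact Finite.of_equiv _ (h.tupleEquiv p k).symm

theorem hasDensity_smoothTuples [IsProper f] (m : ℕ) [SmoothOfRelativeDimension m f]
    (hL : IsLineBundle L) (hA : IsAmple L) (r : ℕ) (hr : (closedPointsLT f r).Finite) :
    HasDensity L (ringChar K) (smoothTuples f L r) (∏ᶠ P ∈ closedPointsLT f r,
      (1 - ((Nat.card K : ℝ) ^ ((m + 1) * f.residueDegree P))⁻¹)) := by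
  obtain ⟨t, ι, h⟩ := exists_isEncoding hL
  have : Fact (ringChar K).Prime :=
    ⟨(CharP.char_is_prime_or_zero K _).resolve_right (CharP.ringChar_ne_zero_of_finite K)⟩
  obtain ⟨k₀, hk₀⟩ := h.card_smooth f m hL hA (ringChar K) hr fun P hP => hP.1
  have hfin := h.finite_isNormal f (ringChar K)
  have hfin' (k : ℕ) : Finite {a : WeierstrassTuple L k //
      a.IsNormal (ringChar K) ∧ ∀ P ∈ closedPointsLT f r, a.IsSmoothAbove f P} :=
    Finite.of_injective (fun a => (⟨a.1, a.2.1⟩ : {a : WeierstrassTuple L k //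
      a.IsNormal (ringChar K)})) fun a b hab => Subtype.ext (Subtype.mk.inj hab)
  refine (tendsto_sum_div_sum (fun k => ?_) hk₀).congr fun N => ?_
  · have := hfin k
    have : Nonempty {a : WeierstrassTuple L k // a.IsNormal (ringChar K)} :=
      ⟨⟨0, 0, 0, 0, 0⟩, fun _ => rfl, fun _ => ⟨rfl, rfl⟩, fun _ => ⟨rfl, rfl, rfl⟩⟩
    exact Nat.card_pos
  · have h1 : smoothTuples f L r ∩ normalTuples L (ringChar K) N =
        {a : Σ k, WeierstrassTuple L k | 1 ≤ a.1 ∧ a.1 ≤ N ∧ a.2.IsNormal (ringChar K) ∧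
          ∀ P ∈ closedPointsLT f r, a.2.IsSmoothAbove f P} := by
      ext a
      exact ⟨fun h => ⟨h.1.1, h.2.2.1, h.1.2⟩, fun h => ⟨⟨h.1, h.2.2⟩, h.1, h.2.1, h.2.2.1⟩⟩
    rw [h1, normalTuples, ncard_setOf_sigma _ hfin', ncard_setOf_sigma _ hfin]

end Tuples

end

theorem mainTheorem9 {K : Type u} [Field K] [Finite K] {V : Scheme.{u}} [IsIntegral V]
    (f : V ⟶ Spec (.of K)) [IsProper f] [GeometricallyIrreducible f] (m : ℕ)
    [SmoothOfRelativeDimension m f] (L : V.Modules) (hL : IsLineBundle L) (hample : IsAmple L)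
    (r : ℕ) :
    (closedPointsLT f r).Finite ∧
      HasDensity L (ringChar K) (smoothTuples f L r)
        (∏ᶠ P ∈ closedPointsLT f r,
          (1 - ((Nat.card K : ℝ) ^ ((m + 1) * f.residueDegree P))⁻¹)) := by
  have : CompactSpace V := QuasiCompact.compactSpace_of_compactSpace f
  have hr := finite_closedPointsLT f r
  exact ⟨hr, hasDensity_smoothTuples f m hL hample r hr⟩
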